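/- Let $\Omega\subset\mathbb R^3$ be a bounded Lipschitz domain with outer unit normal $n$, let $T>0$, $r\ge \tfrac{11}{5}$, $r'=\tfrac{r}{r-1}$, $\alpha,\beta\ge 0$, and let $\nu_1,\nu_2,c_1,c_2,c_5,c_6>0$. Let $S:\mathbb R^{3\times3}_{sym}\to\mathbb R^{3\times3}_{sym}$ satisfy $S(0)=0$ and, for all $D_1,D_2\in\mathbb R^{3\times 3}_{sym}$, $$|S(D_1)-S(D_2)|\le c_1\bigl(\nu_1+\nu_2(|D_1|+|D_2|)^{r-2}\bigr)|D_1-D_2|,$$ $$(S(D_1)-S(D_2)):(D_1-D_2)\ge c_2\bigl(\nu_1+\nu_2(|D_1|+|D_2|)^{r-2}\bigr)|D_1-D_2|^2,$$ and let $s:\mathbb R^3\to\mathbb R^3$ satisfy $s(0)=0$, $|s(v_1)-s(v_2)|\le c_5|v_1-v_2|$ and $(s(v_1)-s(v_2))\cdot(v_1-v_2)\ge c_6|v_1-v_2|^2$ for all $v_1,v_2\in\mathbb R^3$. Let $\mathcal V$ be the space of Lipschitz fields $v:\overline\Omega\to\mathbb R^3$ with $\operatorname{div}v=0$ a.e. in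 $\Omega$ and $v\cdot n=0$ a.e. on $\partial\Omega$. Let $V_r$ be the closure of $\mathcal V$ with respect to $\|v\|_{V_r}=\|v\|_{W^{1,r}(\Omega)}+\|v\|_{L^2(\Omega)}+\|v\|_{L^2(\partial\Omega)}$, and $H$ its closure with respect to $\|v\|_H^2=\|v\|^2_{L^2(\Omega)}+\beta\|v\|^2_{L^2(\partial\Omega)}$; the space $V_r$ is mapped into its dual $V_r'$ through the inner product of $H$. Write $Dv$ for the symmetric part of $\nabla v$. Let $f\in L^{r'}(0,T;V_r')$. A weak solution is a function $v\in L^\infty(0,T;H)\cap L^r(0,T;V_r)$ with $\partial_t v\in L^{r'}(0,T;V_r')$ such that for a.e. $t\in(0,T)$ and all $\varphi\in V_r$ $$\langle\partial_t v,\varphi\rangle+\int_\Omega [S(Dv)-v\otimes v]:\nabla\varphi\,dx+\alpha\int_{\partial\Omega}s(v)\cdot\varphi\,dS=\langle f,\varphi\rangle ;$$ values $v(t)$, $t\in[0,T]$, are those of the representative of $v$ in $C([0,T];H)$. Let $u,v$ be weak solutions for the same $f$, and let $v\in L^{\frac{2r}{2r-3}}(0,T;V_r)$. (i) If $u(0)=v(0)$,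 then $u=v$, that is, $u(t)=v(t)$ in $V_r$ for a.e. $t\in(0,T)$, and in $H$ for all $t\in[0,T]$. (ii) Whether or not $u(0)=v(0)$, the difference $w=u-v$ satisfies $$\|w(t)\|_H^2\le K\,\|w(s)\|_H^2,\qquad 0\le s\le t\le T,$$ where, given a bound $M$ for $\|v\|_{L^{2r/(2r-3)}(0,T;V_r)}$, the constant $K$ depends only on $\Omega,r,\alpha,\beta,S,s,T$, the constants above, and $M$; in particular it does not depend on $u$. -/

import Mathlib

open MeasureTheory Set Filter Topology
open scoped ENNReal NNReal RealInnerProductSpace ContDiff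

noncomputable section

namespace DynFluid

/-- The space `ℝ³` with its Euclidean norm. -/
abbrev E3 : Type := EuclideanSpace ℝ (Fin 3)

/-- The space of real `3 × 3` matrices; its inner product is `A : B = ∑ A i j * B i j` and its norm
is the Frobenius norm. -/
abbrev T3 : Type := EuclideanSpace ℝ (Fin 3 × Fin 3)

/-- Symmetric matrices. -/
def IsSymm3 (A : T3) : Prop := ∀ i j, A (i, j) = A (j, i)

/-- The symmetric part of a matrix; applied to `∇v` it gives `Dv`. -/
def symPart (A : T3) : T3 := WithLp.toLp 2 fun p => (A (p.1, p.2) + A (p.2, p.1)) / 2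

/-- The tensor product `a ⊗ b`. -/
def outer (a b : E3) : T3 := WithLp.toLp 2 fun p => a p.1 * b p.2

/-- The gradient of a vector field, `(∇v) i j = ∂ⱼ vᵢ`. -/
def grad (v : E3 → E3) (x : E3) : T3 :=
  WithLp.toLp 2 fun p => fderiv ℝ v x (EuclideanSpace.single p.2 1) p.1

/-- The divergence of a vector field. -/
def divergence (v : E3 → E3) (x : E3) : ℝ := ∑ i : Fin 3, grad v x (i, i)

/-- Bounded Lipschitz domains in `ℝ³`: bounded, open, connected, nonempty, and near each
boundary point, in suitable orthonormal coordinates, the part of space that lies strictly above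
the graph of a Lipschitz function of two variables. -/
structure IsBoundedLipschitzDomain (Ω : Set E3) : Prop where
  isOpen : IsOpen Ω
  isConnected : IsConnected Ω
  isBounded : Bornology.IsBounded Ω
  boundary : ∀ x ∈ frontier Ω, ∃ (L : E3 ≃ₗᵢ[ℝ] E3) (a : EuclideanSpace ℝ (Fin 2) → ℝ)
    (K : ℝ≥0) (ρ : ℝ), LipschitzWith K a ∧ 0 < ρ ∧
      ∀ y ∈ Metric.ball x ρ, (y ∈ Ω ↔ a !₂[L y 0, L y 1] < L y 2)

/-- Lebesgue measure on `Ω`. -/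
abbrev vol (Ω : Set E3) : Measure E3 := volume.restrict Ω

/-- Surface measure on `∂Ω`: the two-dimensional Hausdorff measure, normalised so that it agrees
with area. -/
abbrev surf (Ω : Set E3) : Measure E3 := (μHE[2] : Measure E3).restrict (frontier Ω)

/-- `n` is the outer unit normal of `Ω` at the boundary point `x`: near `x` the set `Ω` agrees, up
to first order, with the half space `{y | ⟪y - x, n⟫ < 0}`. There is at most one such `n`, and for a
Lipschitz domain it exists at almost every boundary point. -/
def IsOuterNormal (Ω : Set E3) (x n : E3) : Prop :=
  ‖n‖ = 1 ∧ ∀ ε : ℝ, 0 < ε → ∀ᶠ y in 𝓝 x,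
    (y ∈ Ω → ⟪y - x, n⟫ ≤ ε * ‖y - x‖) ∧ (y ∉ Ω → -(ε * ‖y - x‖) ≤ ⟪y - x, n⟫)

/-- The space `𝒱` of fields that are Lipschitz on the closure of `Ω`, divergence free in `Ω` and
tangential on `∂Ω`. The boundary component `g = v` on `∂Ω` is read off from `v`. -/
structure IsAdmissible (Ω : Set E3) (v : E3 → E3) : Prop where
  lipschitz : ∃ K : ℝ≥0, LipschitzOnWith K v (closure Ω)
  div_eq_zero : ∀ᵐ x ∂(vol Ω), divergence v x = 0
  tangential : ∀ᵐ x ∂(surf Ω), ∀ n, IsOuterNormal Ω x n → ⟪v x, n⟫ = 0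

/-- `L^r(Ω) × L^r(Ω)^{3×3} × L²(Ω) × L²(∂Ω)`, where the fields `v` are placed as
`(v, ∇v, v, v|∂Ω)`. The (maximum) norm induced on fields is equivalent to
`‖v‖_{W^{1,r}(Ω)} + ‖v‖_{L²(Ω)} + ‖v‖_{L²(∂Ω)}`. -/
abbrev VAmbient (Ω : Set E3) (r : ℝ) : Type :=
  Lp E3 (ENNReal.ofReal r) (vol Ω) × Lp T3 (ENNReal.ofReal r) (vol Ω) ×
    Lp E3 2 (vol Ω) × Lp E3 2 (surf Ω)

/-- `L²(Ω) × L²(∂Ω)` with the Hilbert sum norm. -/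
abbrev HAmbient (Ω : Set E3) : Type := WithLp 2 (Lp E3 2 (vol Ω) × Lp E3 2 (surf Ω))

lemma ae_differentiableAt_of_lipschitzOn {Ω : Set E3} (hΩ : IsOpen Ω) {v : E3 → E3} {K : ℝ≥0}
    (hv : LipschitzOnWith K v (closure Ω)) : ∀ᵐ x ∂(vol Ω), DifferentiableAt ℝ v x := by
  have h := (hv.mono subset_closure).ae_differentiableWithinAt (μ := volume) hΩ.measurableSet
  filter_upwards [h, ae_restrict_mem hΩ.measurableSet] with x hx hxΩ
  exact hx.differentiableAt (hΩ.mem_nhds hxΩ)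

lemma grad_add {v w : E3 → E3} {x : E3} (hv : DifferentiableAt ℝ v x)
    (hw : DifferentiableAt ℝ w x) : grad (v + w) x = grad v x + grad w x := by
  ext p
  simp [grad, fderiv_add hv hw]

lemma grad_smul (c : ℝ) {v : E3 → E3} {x : E3} (hv : DifferentiableAt ℝ v x) :
    grad (c • v) x = c • grad v x := by
  ext p
  simp [grad, fderiv_const_smul hv c]

lemma grad_zero (x : E3) : grad (0 : E3 → E3) x = 0 := by
  ext p
  simp [grad]

lemma IsAdmissible.zero (Ω : Set E3) : IsAdmissible Ω 0 where
  lipschitz := ⟨0, (LipschitzWith.const (0 : E3)).lipschitzOnWith⟩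
  div_eq_zero := by simp [divergence, grad_zero]
  tangential := by simp

lemma IsAdmissible.add {Ω : Set E3} (hΩ : IsOpen Ω) {v w : E3 → E3} (hv : IsAdmissible Ω v)
    (hw : IsAdmissible Ω w) : IsAdmissible Ω (v + w) where
  lipschitz := by
    obtain ⟨K, hK⟩ := hv.lipschitz
    obtain ⟨K', hK'⟩ := hw.lipschitz
    exact ⟨K + K', hK.add hK'⟩
  div_eq_zero := by
    obtain ⟨K, hK⟩ := hv.lipschitz
    obtain ⟨K', hK'⟩ := hw.lipschitz
    filter_upwards [hv.div_eq_zero, hw.div_eq_zero, ae_differentiableAt_of_lipschitzOn hΩ hK,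
      ae_differentiableAt_of_lipschitzOn hΩ hK'] with x h1 h2 h3 h4
    have : divergence (v + w) x = divergence v x + divergence w x := by
      simp [divergence, grad_add h3 h4, Finset.sum_add_distrib]
    rw [this, h1, h2, add_zero]
  tangential := by
    filter_upwards [hv.tangential, hw.tangential] with x h1 h2 n hn
    simp [inner_add_left, h1 n hn, h2 n hn]

lemma IsAdmissible.smul {Ω : Set E3} (hΩ : IsOpen Ω) (c : ℝ) {v : E3 → E3}
    (hv : IsAdmissible Ω v) : IsAdmissible Ω (c • v) where
  lipschitz := by
    obtain ⟨K, hK⟩ := hv.lipschitz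
    exact ⟨‖c‖₊ * K, (lipschitzWith_smul c).comp_lipschitzOnWith hK⟩
  div_eq_zero := by
    obtain ⟨K, hK⟩ := hv.lipschitz
    filter_upwards [hv.div_eq_zero, ae_differentiableAt_of_lipschitzOn hΩ hK] with x h1 h3
    have : divergence (c • v) x = c * divergence v x := by
      simp [divergence, grad_smul c h3, Finset.mul_sum]
    rw [this, h1, mul_zero]
  tangential := by
    filter_upwards [hv.tangential] with x h1 n hn
    simp [inner_smul_left, h1 n hn]

/-- `x` is the image `(v, ∇v, v, v|∂Ω)` of the field `v`. -/
def RepresentsV (Ω : Set E3) (r : ℝ) (x : VAmbient Ω r) (v : E3 → E3) : Prop :=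
  x.1 =ᵐ[vol Ω] v ∧ x.2.1 =ᵐ[vol Ω] grad v ∧ x.2.2.1 =ᵐ[vol Ω] v ∧ x.2.2.2 =ᵐ[surf Ω] v

/-- `x` is the image `(v, √β v|∂Ω)` of the field `v`. -/
def RepresentsH (Ω : Set E3) (β : ℝ) (x : HAmbient Ω) (v : E3 → E3) : Prop :=
  x.fst =ᵐ[vol Ω] v ∧ x.snd =ᵐ[surf Ω] fun y => √β • v y

/-- The span of the images `(v, ∇v, v, v|∂Ω)` of the fields `v ∈ 𝒱`. For open `Ω` these images
already form a linear subspace, see `mem_preV_iff`. -/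
def preV (Ω : Set E3) (r : ℝ) [Fact (1 ≤ ENNReal.ofReal r)] : Submodule ℝ (VAmbient Ω r) :=
  Submodule.span ℝ {x | ∃ v, IsAdmissible Ω v ∧ RepresentsV Ω r x v}

/-- The span of the images `(v, √β v|∂Ω)` of the fields `v ∈ 𝒱`. For open `Ω` these images
already form a linear subspace, see `mem_preH_iff`. -/
def preH (Ω : Set E3) (β : ℝ) : Submodule ℝ (HAmbient Ω) :=
  Submodule.span ℝ {x | ∃ v, IsAdmissible Ω v ∧ RepresentsH Ω β x v}

lemma mem_preV_iff {Ω : Set E3} (hΩ : IsOpen Ω) {r : ℝ} [Fact (1 ≤ ENNReal.ofReal r)]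
    {x : VAmbient Ω r} : x ∈ preV Ω r ↔ ∃ v, IsAdmissible Ω v ∧ RepresentsV Ω r x v := by
  refine ⟨fun hx => ?_, fun hx => Submodule.subset_span hx⟩
  induction hx using Submodule.span_induction with
  | mem x hx => exact hx
  | zero =>
    refine ⟨0, IsAdmissible.zero Ω, Lp.coeFn_zero _ _ _, ?_, Lp.coeFn_zero _ _ _,
      Lp.coeFn_zero _ _ _⟩
    filter_upwards [Lp.coeFn_zero T3 (ENNReal.ofReal r) (vol Ω)] with y hy
    rw [grad_zero]
    exact hy
  | add x y _ _ hx hy =>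
    obtain ⟨v, hv, h1, h2, h3, h4⟩ := hx
    obtain ⟨w, hw, k1, k2, k3, k4⟩ := hy
    obtain ⟨K, hK⟩ := hv.lipschitz
    obtain ⟨K', hK'⟩ := hw.lipschitz
    refine ⟨v + w, hv.add hΩ hw, (Lp.coeFn_add _ _).trans (h1.add k1), ?_,
      (Lp.coeFn_add _ _).trans (h3.add k3), (Lp.coeFn_add _ _).trans (h4.add k4)⟩
    filter_upwards [Lp.coeFn_add x.2.1 y.2.1, h2, k2, ae_differentiableAt_of_lipschitzOn hΩ hK,
      ae_differentiableAt_of_lipschitzOn hΩ hK'] with z e1 e2 e3 e4 e5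
    rw [grad_add e4 e5, ← e2, ← e3]
    exact e1
  | smul c x _ hx =>
    obtain ⟨v, hv, h1, h2, h3, h4⟩ := hx
    obtain ⟨K, hK⟩ := hv.lipschitz
    refine ⟨c • v, hv.smul hΩ c, (Lp.coeFn_smul _ _).trans (h1.const_smul c), ?_,
      (Lp.coeFn_smul _ _).trans (h3.const_smul c), (Lp.coeFn_smul _ _).trans (h4.const_smul c)⟩
    filter_upwards [Lp.coeFn_smul c x.2.1, h2, ae_differentiableAt_of_lipschitzOn hΩ hK]
      with z e1 e2 e4
    rw [grad_smul c e4, ← e2]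
    exact e1

lemma mem_preH_iff {Ω : Set E3} (hΩ : IsOpen Ω) {β : ℝ} {x : HAmbient Ω} :
    x ∈ preH Ω β ↔ ∃ v, IsAdmissible Ω v ∧ RepresentsH Ω β x v := by
  refine ⟨fun hx => ?_, fun hx => Submodule.subset_span hx⟩
  induction hx using Submodule.span_induction with
  | mem x hx => exact hx
  | zero =>
    refine ⟨0, IsAdmissible.zero Ω, Lp.coeFn_zero _ _ _, ?_⟩
    filter_upwards [Lp.coeFn_zero E3 2 (surf Ω)] with y hy
    simpa using hy
  | add x y _ _ hx hy =>
    obtain ⟨v, hv, h1, h2⟩ := hx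
    obtain ⟨w, hw, k1, k2⟩ := hy
    refine ⟨v + w, hv.add hΩ hw, (Lp.coeFn_add _ _).trans (h1.add k1), ?_⟩
    filter_upwards [Lp.coeFn_add x.snd y.snd, h2, k2] with z e1 e2 e3
    rw [Pi.add_apply, smul_add, ← e2, ← e3]
    exact e1
  | smul c x _ hx =>
    obtain ⟨v, hv, h1, h2⟩ := hx
    refine ⟨c • v, hv.smul hΩ c, (Lp.coeFn_smul _ _).trans (h1.const_smul c), ?_⟩
    filter_upwards [Lp.coeFn_smul c x.snd, h2] with z e1 e2
    rw [Pi.smul_apply, smul_comm, ← e2]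
    exact e1

/-- The space `V_r`, the closure of `𝒱` in the norm
`‖v‖_{W^{1,r}(Ω)} + ‖v‖_{L²(Ω)} + ‖v‖_{L²(∂Ω)}`. -/
abbrev V (Ω : Set E3) (r : ℝ) [Fact (1 ≤ ENNReal.ofReal r)] : Type :=
  (preV Ω r).topologicalClosure

/-- The space `H`, the closure of `𝒱` in the norm `(‖v‖²_{L²(Ω)} + β ‖v‖²_{L²(∂Ω)})^{1/2}`; the pair
`(v, g)` is represented isometrically by `(v, √β g)` in `L²(Ω) × L²(∂Ω)`. -/
abbrev H (Ω : Set E3) (β : ℝ) : Type := (preH Ω β).topologicalClosure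

/-- The map `(v, ∇v, v, g) ↦ (v, √β g)`. -/
def ambientMap (Ω : Set E3) (r β : ℝ) [Fact (1 ≤ ENNReal.ofReal r)] :
    VAmbient Ω r →L[ℝ] HAmbient Ω :=
  (WithLp.prodContinuousLinearEquiv 2 ℝ (Lp E3 2 (vol Ω)) (Lp E3 2 (surf Ω))).symm.toContinuousLinearMap ∘L
    ((ContinuousLinearMap.id ℝ (Lp E3 2 (vol Ω))).prodMap
      (√β • ContinuousLinearMap.id ℝ (Lp E3 2 (surf Ω)))) ∘L
    (ContinuousLinearMap.snd ℝ (Lp T3 (ENNReal.ofReal r) (vol Ω)) _ ∘L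
      ContinuousLinearMap.snd ℝ (Lp E3 (ENNReal.ofReal r) (vol Ω)) _)

lemma ambientMap_mem {Ω : Set E3} {r β : ℝ} [Fact (1 ≤ ENNReal.ofReal r)] (x : VAmbient Ω r)
    (hx : x ∈ (preV Ω r).topologicalClosure) :
    ambientMap Ω r β x ∈ (preH Ω β).topologicalClosure := by
  refine map_mem_closure (ambientMap Ω r β).continuous hx fun y hy => ?_
  have h : preV Ω r ≤ (preH Ω β).comap (ambientMap Ω r β).toLinearMap := by
    refine Submodule.span_le.2 ?_
    rintro z ⟨v, hv, h1, h2, h3, h4⟩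
    refine Submodule.subset_span ⟨v, hv, h3, ?_⟩
    exact (Lp.coeFn_smul (√β) z.2.2.2).trans (h4.const_smul (√β))
  exact h hy

/-- The natural map `V_r → H`. Thus `⟪toH β v, toH β φ⟫ = ∫_Ω v · φ dx + β ∫_∂Ω v · φ dS`. -/
def toH {Ω : Set E3} {r : ℝ} [Fact (1 ≤ ENNReal.ofReal r)] (β : ℝ) : V Ω r →L[ℝ] H Ω β :=
  ((ambientMap Ω r β) ∘L (preV Ω r).topologicalClosure.subtypeL).codRestrict _
    fun x => ambientMap_mem x.1 x.2

section Fields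

variable {Ω : Set E3} {r : ℝ} [Fact (1 ≤ ENNReal.ofReal r)]

/-- The velocity field in `Ω` of an element of `V_r`. -/
def V.vel (v : V Ω r) : E3 → E3 := v.1.1

/-- The gradient in `Ω` of an element of `V_r`. -/
def V.gradient (v : V Ω r) : E3 → T3 := v.1.2.1

/-- The trace on `∂Ω` of an element of `V_r`. -/
def V.trace (v : V Ω r) : E3 → E3 := v.1.2.2.2

/-- `∫_Ω [S(Dv) - v ⊗ v] : ∇φ dx + α ∫_∂Ω s(v) · φ dS`. -/
def spatialForm (S : T3 → T3) (s : E3 → E3) (α : ℝ) (v φ : V Ω r) : ℝ :=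
  (∫ x, ⟪S (symPart (V.gradient v x)) - outer (V.vel v x) (V.vel v x), V.gradient φ x⟫ ∂(vol Ω)) +
    α * ∫ x, ⟪s (V.trace v x), V.trace φ x⟫ ∂(surf Ω)

/-- `ξ : (0, T) → V_r'` is the weak time derivative of `u : (0, T) → V_r`, where `V_r` is mapped into
`V_r'` through the inner product of `H`. -/
def IsWeakTimeDeriv (T β : ℝ) (u : ℝ → V Ω r) (ξ : ℝ → StrongDual ℝ (V Ω r)) : Prop :=
  ∀ (φ : V Ω r) (ψ : ℝ → ℝ), ContDiff ℝ ∞ ψ → HasCompactSupport ψ → tsupport ψ ⊆ Ioo 0 T →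
    ∫ t in Ioo 0 T, deriv ψ t * ⟪toH β (u t), toH β φ⟫ = -∫ t in Ioo 0 T, ψ t * ξ t φ

/-- Weak solutions on `(0, T)`: `u ∈ L^∞(0,T;H) ∩ L^r(0,T;V_r)`, `∂ₜu ∈ L^{r'}(0,T;V_r')`, and for
almost every `t` and all `φ ∈ V_r`,
`⟨∂ₜu, φ⟩ + ∫_Ω [S(Du) - u ⊗ u] : ∇φ dx + α ∫_∂Ω s(u) · φ dS = ⟨f, φ⟩`. -/
structure IsWeakSolution (S : T3 → T3) (s : E3 → E3) (α β T : ℝ)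
    (f : ℝ → StrongDual ℝ (V Ω r)) (u : ℝ → V Ω r) : Prop where
  memLp_H : MemLp (fun t => toH β (u t)) ∞ (volume.restrict (Ioo 0 T))
  memLp_V : MemLp u (ENNReal.ofReal r) (volume.restrict (Ioo 0 T))
  equation : ∃ ξ : ℝ → StrongDual ℝ (V Ω r),
    MemLp ξ (ENNReal.ofReal (r / (r - 1))) (volume.restrict (Ioo 0 T)) ∧
    IsWeakTimeDeriv T β u ξ ∧
    ∀ᵐ t ∂(volume.restrict (Ioo 0 T)), ∀ φ : V Ω r, ξ t φ + spatialForm S s α (u t) φ = f t φ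

/-- `U` is the representative of `u` in `C([0, T]; H)`; initial values are values of `U` at `0`. -/
def IsContRep (T β : ℝ) (u : ℝ → V Ω r) (U : ℝ → H Ω β) : Prop :=
  ContinuousOn U (Icc 0 T) ∧ ∀ᵐ t ∂(volume.restrict (Ioo 0 T)), U t = toH β (u t)

end Fields

/-- Growth and monotonicity of the extra stress `S` on symmetric matrices. -/
structure IsStressLaw (r ν₁ ν₂ c₁ c₂ : ℝ) (S : T3 → T3) : Prop where
  symm : ∀ D, IsSymm3 D → IsSymm3 (S D)
  zero : S 0 = 0
  growth : ∀ D₁ D₂, IsSymm3 D₁ → IsSymm3 D₂ →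
    ‖S D₁ - S D₂‖ ≤ c₁ * (ν₁ + ν₂ * (‖D₁‖ + ‖D₂‖) ^ (r - 2)) * ‖D₁ - D₂‖
  monotone : ∀ D₁ D₂, IsSymm3 D₁ → IsSymm3 D₂ →
    c₂ * (ν₁ + ν₂ * (‖D₁‖ + ‖D₂‖) ^ (r - 2)) * ‖D₁ - D₂‖ ^ 2 ≤ ⟪S D₁ - S D₂, D₁ - D₂⟫

/-- Lipschitz continuity and strong monotonicity of the boundary response `s`. -/
structure IsBoundaryLaw (c₅ c₆ : ℝ) (s : E3 → E3) : Prop where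
  zero : s 0 = 0
  lipschitz : ∀ v₁ v₂, ‖s v₁ - s v₂‖ ≤ c₅ * ‖v₁ - v₂‖
  monotone : ∀ v₁ v₂, c₆ * ‖v₁ - v₂‖ ^ 2 ≤ ⟪s v₁ - s v₂, v₁ - v₂⟫

end DynFluid

end

open DynFluid

noncomputable section

namespace DynFluid

/-! ### Functions of time with a weak derivative -/

/-! Put `w = u - v`. Subtracting the two equations and testing with `w` removes `f`. By monotonicity
the stress contributes at least `c₂ ν₁ ‖Dw‖₂²`, and the boundary term has a favourable sign. Since
the convective form is skew-symmetric, the difference of the two convective terms reduces to one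
that contains `∇v` but not `∇u`, so that formally `½ d/dt ‖w‖²_H ≤ -c₂ ν₁ ‖Dw‖₂² - ∫ (w ⊗ w) : ∇v`
(`spatialForm_sub_ge`).

Hölder's inequality bounds the last integral by `‖w‖_p² ‖v‖_{V_r}` with `p = 2r/(r-1)`. The decisive
estimate is a Korn-Sobolev inequality with a free scale, `‖w‖_p ≤ C δ^(-a) (‖w‖₂ + δ ‖Dw‖₂)` for `0
< δ ≤ δ₀`, where `a = 3/(2r)`. Taking `δ` to be a small multiple of `(1 + ‖v‖)^(-1/(2-2a))` lets the
viscous term absorb `‖Dw‖₂²` and leaves `k (1 + ‖v‖)^(1/(1-a)) ‖w‖²_H`. As `1/(1-a) = 2r/(2r-3)`,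
the coefficient is integrable in time exactly under the assumption on `v`, and Gronwall's inequality
gives (ii) with a constant free of `u` (`exists_norm_sub_sq_le`). For equal initial values this
gives equality in `H`, and injectivity of `V_r → H` (`toH_injective`) gives equality in `V_r`.

The Korn-Sobolev inequality rests on the identity `⟨∇w z, z⟩ = Dw : (z ⊗ z)`: along a segment of
direction `z` the component of `w` in that direction changes only through `Dw`. Averaging over the
directions of a cone inside the domain recovers the whole vector `w x` and bounds it by an average
of `|w|` and a potential of `|Dw|`; that potential maps `L²` to `L^p` for `2 < p < 6`. The full
gradient never enters.

Skew-symmetry says that tangential solenoidal fields are orthogonal to gradients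
(`integral_fderiv_apply_eq_zero`). It is proved with cutoffs in a thin layer above the boundary
graph: tangency at the boundary point below makes the normal component of the field of the order of
the height, which compensates the steep slope of the cutoff. Statements about `V_r` are proved for
Lipschitz fields and extended by density.

The differential inequality is made rigorous by the energy identity
`norm_sq_sub_norm_sq_eq_integral`, obtained from difference quotients in time and the continuity of
translations in `L^p`. -/

lemma integral_deriv_smoothTransition_mul {G : ℝ → ℝ} (s : ℝ) {ε : ℝ} (hε : 0 < ε) :
    ∫ x, deriv (fun x => Real.smoothTransition ((x - s) / ε)) x * G x =
      ∫ y in (0 : ℝ)..1, deriv Real.smoothTransition y * G (s + ε * y) := by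
  have hd : ∀ x, deriv (fun x => Real.smoothTransition ((x - s) / ε)) x =
      deriv Real.smoothTransition ((x - s) / ε) * (1 / ε) := by
    intro x
    have h1 : HasDerivAt Real.smoothTransition (deriv Real.smoothTransition ((x - s) / ε))
        ((x - s) / ε) :=
      ((Real.smoothTransition.contDiff (n := 1)).differentiable (by simp) _).hasDerivAt
    have h2 : HasDerivAt (fun x : ℝ => (x - s) / ε) (1 / ε) x :=
      ((hasDerivAt_id x).sub_const s).div_const ε
    exact (h1.comp x h2).deriv
  have hz : ∀ y, y ∉ Ioc (0 : ℝ) 1 → deriv Real.smoothTransition y = 0 := by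
    intro y hy
    by_cases h0 : y ≤ 0
    · refine IsLocalMin.deriv_eq_zero (Eventually.of_forall fun z => ?_)
      rw [Real.smoothTransition.zero_of_nonpos h0]
      exact Real.smoothTransition.nonneg z
    · refine IsLocalMax.deriv_eq_zero (Eventually.of_forall fun z => ?_)
      have h1 : 1 ≤ y := by
        by_contra h1
        exact hy ⟨not_le.1 h0, (not_le.1 h1).le⟩
      rw [Real.smoothTransition.one_of_one_le h1]
      exact Real.smoothTransition.le_one z
  have h1 := intervalIntegral.smul_integral_comp_add_mul (a := 0) (b := 1)
    (fun x => deriv (fun x => Real.smoothTransition ((x - s) / ε)) x * G x) ε s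
  have h2 : ∫ x in (s + ε * 0)..(s + ε * 1),
      deriv (fun x => Real.smoothTransition ((x - s) / ε)) x * G x =
      ∫ x, deriv (fun x => Real.smoothTransition ((x - s) / ε)) x * G x := by
    rw [intervalIntegral.integral_of_le (by nlinarith)]
    refine setIntegral_eq_integral_of_forall_compl_eq_zero fun x hx => ?_
    rw [hd, hz, zero_mul, zero_mul]
    rintro ⟨k1, k2⟩
    apply hx
    rw [div_le_one hε] at k2
    have := (div_pos_iff_of_pos_right hε).1 k1
    constructor <;> linarith
  rw [← h2, ← h1, smul_eq_mul, ← intervalIntegral.integral_const_mul]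
  refine intervalIntegral.integral_congr fun y _ => ?_
  simp only [hd]
  rw [add_sub_cancel_left, mul_div_cancel_left₀ _ hε.ne']
  field_simp

/-- The derivative of a ramp of width `ε` starting at `s` is an approximate identity: rescaled to
the unit interval, it is a fixed density of integral one against `G (s + ε * y)`. -/
lemma tendsto_integral_deriv_smoothTransition_mul {G : ℝ → ℝ} (hG : Continuous G) (s : ℝ) :
    Tendsto (fun ε => ∫ x, deriv (fun x => Real.smoothTransition ((x - s) / ε)) x * G x)
      (𝓝[>] 0) (𝓝 (G s)) := by
  have hc : Continuous (deriv Real.smoothTransition) :=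
    (Real.smoothTransition.contDiff (n := 1)).continuous_deriv le_rfl
  have h1 : Continuous fun ε : ℝ => ∫ y in (0 : ℝ)..1,
      deriv Real.smoothTransition y * G (s + ε * y) :=
    intervalIntegral.continuous_parametric_intervalIntegral_of_continuous
      (by simp only [Function.uncurry_def]; fun_prop) continuous_const
  have h2 : ∫ y in (0 : ℝ)..1, deriv Real.smoothTransition y * G (s + 0 * y) = G s := by
    simp only [zero_mul, add_zero]
    rw [intervalIntegral.integral_mul_const, intervalIntegral.integral_deriv_eq_sub]
    · simp
    · exact fun x _ => (Real.smoothTransition.contDiff (n := 1)).differentiable (by simp) x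
    · exact hc.intervalIntegrable _ _
  have h3 := (h1.tendsto 0).mono_left (nhdsWithin_le_nhds (s := Ioi 0))
  simp only [h2] at h3
  refine h3.congr' ?_
  filter_upwards [self_mem_nhdsWithin] with ε hε
  exact (integral_deriv_smoothTransition_mul s hε).symm

/-- A continuous function with integrable weak derivative is a primitive of it. -/
theorem sub_eq_integral_of_weakDeriv {g η : ℝ → ℝ} {T : ℝ} (hg : ContinuousOn g (Icc 0 T))
    (hη : IntegrableOn η (Ioo 0 T))
    (h : ∀ ψ : ℝ → ℝ, ContDiff ℝ ∞ ψ → HasCompactSupport ψ → tsupport ψ ⊆ Ioo 0 T →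
      ∫ t in Ioo 0 T, deriv ψ t * g t = -∫ t in Ioo 0 T, ψ t * η t)
    {s t : ℝ} (hs : 0 < s) (hst : s ≤ t) (ht : t < T) : g t - g s = ∫ τ in s..t, η τ := by
  have hT : (0 : ℝ) ≤ T := by linarith
  -- A globally continuous extension, so that the limit of the ramps applies; it agrees with `g`
  -- wherever it is tested.
  set G : ℝ → ℝ := IccExtend hT (fun x : Icc 0 T => g x) with hGdef
  have hG : Continuous G := (continuousOn_iff_continuous_domRestrict.1 hg).Icc_extend'
  have hGg : ∀ x ∈ Icc 0 T, G x = g x := fun x hx => by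
    simp [hGdef, IccExtend_of_mem hT _ hx]
  -- A smooth plateau: it rises on `[s, s + ε]` and falls on `[t, t + ε]`. Its derivative picks out
  -- `G s - G t`, and the function itself tends to the indicator of `Ioc s t`, because both ramps
  -- vanish at their starting point and lie to its right.
  let ψ : ℝ → ℝ → ℝ := fun ε x =>
    Real.smoothTransition ((x - s) / ε) - Real.smoothTransition ((x - t) / ε)
  have hstep : ∀ (a ε : ℝ), ContDiff ℝ ∞ fun x : ℝ => Real.smoothTransition ((x - a) / ε) :=
    fun a ε => (Real.smoothTransition.contDiff (n := ⊤)).comp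
      ((contDiff_id.sub contDiff_const).div_const ε)
  have hψ : ∀ ε, ContDiff ℝ ∞ (ψ ε) := fun ε => (hstep s ε).sub (hstep t ε)
  have hzero : ∀ ε, 0 < ε → ∀ x, x ∉ Icc s (t + ε) → ψ ε x = 0 := by
    intro ε hε x hx
    by_cases h1 : x < s
    · simp only [ψ]
      rw [Real.smoothTransition.zero_of_nonpos, Real.smoothTransition.zero_of_nonpos, sub_zero]
      · exact div_nonpos_of_nonpos_of_nonneg (by linarith) hε.le
      · exact div_nonpos_of_nonpos_of_nonneg (by linarith) hε.le
    · have h2 : t + ε < x := by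
        by_contra h2
        exact hx ⟨not_lt.1 h1, not_lt.1 h2⟩
      simp only [ψ]
      rw [Real.smoothTransition.one_of_one_le, Real.smoothTransition.one_of_one_le, sub_self]
      · rw [one_le_div hε]; linarith
      · rw [one_le_div hε]; linarith
  have hsupp : ∀ ε, 0 < ε → tsupport (ψ ε) ⊆ Icc s (t + ε) := fun ε hε =>
    closure_minimal (fun x hx => by
      by_contra h'
      exact hx (hzero ε hε x h')) isClosed_Icc
  have hbound : ∀ ε x, |ψ ε x| ≤ 1 := fun ε x => by
    have h1 := Real.smoothTransition.nonneg ((x - s) / ε)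
    have h2 := Real.smoothTransition.nonneg ((x - t) / ε)
    have h3 := Real.smoothTransition.le_one ((x - s) / ε)
    have h4 := Real.smoothTransition.le_one ((x - t) / ε)
    simp only [ψ, abs_le]
    constructor <;> linarith
  have hev : ∀ᶠ ε in 𝓝[>] (0 : ℝ), 0 < ε ∧ t + ε < T := by
    filter_upwards [self_mem_nhdsWithin, nhdsWithin_le_nhds (Iio_mem_nhds (sub_pos.2 ht))]
      with ε h1 h2
    exact ⟨h1, by have : ε < T - t := h2; linarith⟩
  have hL : Tendsto (fun ε => ∫ x in Ioo 0 T, deriv (ψ ε) x * g x) (𝓝[>] 0) (𝓝 (G s - G t)) := by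
    refine ((tendsto_integral_deriv_smoothTransition_mul hG s).sub
      (tendsto_integral_deriv_smoothTransition_mul hG t)).congr' ?_
    filter_upwards [hev] with ε hε
    have e1 : ∀ a, Integrable fun x =>
        deriv (fun x => Real.smoothTransition ((x - a) / ε)) x * G x := by
      intro a
      refine Continuous.integrable_of_hasCompactSupport ?_ ?_
      · exact ((hstep a ε).continuous_deriv (by simp)).mul hG
      · refine HasCompactSupport.mul_right ?_
        refine HasCompactSupport.intro (isCompact_Icc (a := a) (b := a + ε)) fun x hx => ?_
        by_cases h1 : x < a
        · refine IsLocalMin.deriv_eq_zero (Eventually.of_forall fun z => ?_)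
          show Real.smoothTransition ((x - a) / ε) ≤ _
          rw [Real.smoothTransition.zero_of_nonpos
            (div_nonpos_of_nonpos_of_nonneg (by linarith) hε.1.le)]
          exact Real.smoothTransition.nonneg _
        · have h2 : a + ε < x := by
            by_contra h2
            exact hx ⟨not_lt.1 h1, not_lt.1 h2⟩
          refine IsLocalMax.deriv_eq_zero (Eventually.of_forall fun z => ?_)
          show _ ≤ Real.smoothTransition ((x - a) / ε)
          rw [Real.smoothTransition.one_of_one_le (by rw [one_le_div hε.1]; linarith)]
          exact Real.smoothTransition.le_one _
    rw [← integral_sub (e1 s) (e1 t)]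
    have e2 : ∀ x, deriv (ψ ε) x = deriv (fun x => Real.smoothTransition ((x - s) / ε)) x -
        deriv (fun x => Real.smoothTransition ((x - t) / ε)) x := fun x =>
      deriv_fun_sub ((hstep s ε).differentiable (by simp) x)
        ((hstep t ε).differentiable (by simp) x)
    have e3 : ∫ x in Ioo 0 T, deriv (ψ ε) x * g x = ∫ x in Ioo 0 T, deriv (ψ ε) x * G x :=
      setIntegral_congr_fun measurableSet_Ioo fun x hx => by
        simp only [hGg x (Ioo_subset_Icc_self hx)]
    rw [e3, setIntegral_eq_integral_of_forall_compl_eq_zero]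
    · simp only [e2, sub_mul]
    · intro x hx
      have : x ∉ tsupport (deriv (ψ ε)) := fun h' => hx (by
        have := hsupp ε hε.1 (tsupport_deriv_subset h')
        exact ⟨by linarith [this.1], by linarith [this.2, hε.2]⟩)
      rw [image_eq_zero_of_notMem_tsupport this, zero_mul]
  have hR : Tendsto (fun ε => ∫ x in Ioo 0 T, ψ ε x * η x) (𝓝[>] 0)
      (𝓝 (∫ x in Ioo 0 T, (Ioc s t).indicator η x)) := by
    refine tendsto_integral_filter_of_dominated_convergence (fun x => ‖η x‖) ?_ ?_ hη.norm ?_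
    · exact Eventually.of_forall fun ε => (hψ ε).continuous.aestronglyMeasurable.mul hη.1
    · refine Eventually.of_forall fun ε => Eventually.of_forall fun x => ?_
      rw [norm_mul]
      exact mul_le_of_le_one_left (norm_nonneg _) (hbound ε x)
    · refine Eventually.of_forall fun x => ?_
      refine tendsto_const_nhds.congr' ?_
      have key : ∀ a, ∀ᶠ ε in 𝓝[>] (0 : ℝ),
          Real.smoothTransition ((x - a) / ε) = if a < x then 1 else 0 := by
        intro a
        split_ifs with hax
        · filter_upwards [self_mem_nhdsWithin,
            nhdsWithin_le_nhds (Iio_mem_nhds (sub_pos.2 hax))] with ε h1 h2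
          have h2 : ε < x - a := h2
          exact Real.smoothTransition.one_of_one_le (by rw [one_le_div h1]; exact h2.le)
        · filter_upwards [self_mem_nhdsWithin] with ε h1
          exact Real.smoothTransition.zero_of_nonpos
            (div_nonpos_of_nonpos_of_nonneg (by linarith) (le_of_lt h1))
      filter_upwards [key s, key t] with ε h1 h2
      simp only [ψ, h1, h2, indicator_apply, mem_Ioc]
      by_cases k1 : s < x
      · by_cases k2 : t < x
        · simp [k1, k2]
        · simp [k1, k2, not_lt.1 k2]
      · simp [k1, not_lt.2 ((not_lt.1 k1).trans hst)]
  have hLR : Tendsto (fun ε => ∫ x in Ioo 0 T, deriv (ψ ε) x * g x) (𝓝[>] 0)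
      (𝓝 (-∫ x in Ioo 0 T, (Ioc s t).indicator η x)) := by
    refine hR.neg.congr' ?_
    filter_upwards [hev] with ε hε
    refine (h (ψ ε) (hψ ε) ?_ ?_).symm
    · exact HasCompactSupport.of_support_subset_isCompact isCompact_Icc
        ((subset_tsupport _).trans (hsupp ε hε.1))
    · exact (hsupp ε hε.1).trans fun x hx => ⟨by linarith [hx.1], by linarith [hx.2, hε.2]⟩
  have hIoc : Ioc s t ⊆ Ioo 0 T := fun x hx => ⟨by linarith [hx.1], by linarith [hx.2]⟩
  have := tendsto_nhds_unique hL hLR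
  rw [hGg s ⟨hs.le, by linarith⟩, hGg t ⟨by linarith, ht.le⟩,
    setIntegral_indicator measurableSet_Ioc, inter_eq_self_of_subset_right hIoc,
    ← intervalIntegral.integral_of_le hst] at this
  linarith

/-- Continuity of translations in `L^p(ℝ; E)`. -/
lemma tendsto_eLpNorm_translate_sub {E : Type*} [NormedAddCommGroup E] {p : ℝ≥0∞} [Fact (1 ≤ p)]
    (hp : p ≠ ⊤) {f : ℝ → E} (hf : MemLp f p) :
    Tendsto (fun h : ℝ => eLpNorm (fun x => f (x + h) - f x) p) (𝓝 0) (𝓝 0) := by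
  let g : ℝ → C(ℝ, ℝ) := fun h => ⟨fun x => x + h, by fun_prop⟩
  have hg : Continuous g :=
    (ContinuousMap.mk (fun a : ℝ × ℝ => a.2 + a.1) (by fun_prop)).curry.continuous
  have hgm : ∀ h, MeasurePreserving (g h) volume volume := fun h => measurePreserving_add_right _ h
  have h1 : Continuous fun h => Lp.compMeasurePreserving (g h) (hgm h) (hf.toLp f) :=
    continuous_const.compMeasurePreservingLp hg hgm hp
  have h2 := (h1.sub (continuous_const (y := hf.toLp f))).norm.tendsto 0
  have h3 : ∀ h, ‖Lp.compMeasurePreserving (g h) (hgm h) (hf.toLp f) - hf.toLp f‖ =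
      (eLpNorm (fun x => f (x + h) - f x) p).toReal := by
    intro h
    rw [Lp.toLp_compMeasurePreserving, ← MemLp.toLp_sub, Lp.norm_toLp]
    rfl
  replace h2 := h2.congr h3
  have h5 := h3 0
  have hm : ∀ h, MemLp (fun x => f (x + h) - f x) p volume := fun h =>
    (hf.comp_measurePreserving (hgm h)).sub hf
  have h4 : eLpNorm (fun x => f (x + 0) - f x) p = 0 := by simp
  rw [h4, ENNReal.toReal_zero] at h5
  replace h2 : Tendsto (fun h => (eLpNorm (fun x => f (x + h) - f x) p).toReal) (𝓝 0) (𝓝 0) := by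
    convert h2 using 2
    exact h5.symm
  rwa [← ENNReal.tendsto_toReal_iff (fun h => (hm h).2.ne) ENNReal.zero_ne_top, ENNReal.toReal_zero]

/-- Gronwall's inequality with an integrable coefficient, up to the constant in the exponent. -/
theorem le_exp_integral_mul_of_sub_le {g k : ℝ → ℝ} {a b : ℝ} (hg : ContinuousOn g (Icc a b))
    (hg0 : ∀ t ∈ Icc a b, 0 ≤ g t) (hk : IntervalIntegrable k volume a b) (hk0 : ∀ t, 0 ≤ k t)
    (h : ∀ s t, a ≤ s → s ≤ t → t ≤ b → g t - g s ≤ ∫ τ in s..t, k τ * g τ) :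
    ∀ t ∈ Icc a b, g t ≤ Real.exp (2 * ∫ τ in a..t, k τ) * g a := by
  by_cases hab : a ≤ b
  swap
  · intro t ht
    exact absurd (ht.1.trans ht.2) hab
  have hKc : ContinuousOn (fun t => ∫ τ in a..t, k τ) (Icc a b) := by
    have := intervalIntegral.continuousOn_primitive_interval' hk (left_mem_uIcc)
    rwa [uIcc_of_le hab] at this
  have hsub : ∀ {s t}, a ≤ s → s ≤ t → t ≤ b → IntervalIntegrable k volume s t := by
    intro s t h1 h2 h3
    refine hk.mono_set ?_
    rw [uIcc_of_le hab, uIcc_of_le h2]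
    exact Icc_subset_Icc h1 h3
  have hcl : IsClosed ({t | g t ≤ Real.exp (2 * ∫ τ in a..t, k τ) * g a} ∩ Icc a b) := by
    have h1 : ContinuousOn (fun t => Real.exp (2 * ∫ τ in a..t, k τ) * g a - g t) (Icc a b) :=
      ((Real.continuous_exp.comp_continuousOn (continuousOn_const.mul hKc)).mul
        continuousOn_const).sub hg
    convert h1.preimage_isClosed_of_isClosed isClosed_Icc (isClosed_Ici (a := 0)) using 1
    ext t
    simp [and_comm]
  intro t ht
  -- Continuous induction: the set of times at which the bound holds is closed, contains `a`, and
  -- can be continued to the right of each of its points.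
  refine hcl.Icc_subset_of_forall_mem_nhdsWithin ?_ ?_ ht
  · simp
  rintro x ⟨hx, hxa, hxb⟩
  have hcx : ContinuousWithinAt (fun t => ∫ τ in a..t, k τ) (Icc a b) x := hKc x ⟨hxa, hxb.le⟩
  have hnear : ∀ᶠ y in 𝓝[>] x, y < b ∧ ∫ τ in x..y, k τ ≤ 1 / 2 := by
    have hle : 𝓝[>] x ≤ 𝓝[Icc a b] x := by
      rw [← nhdsWithin_Ioo_eq_nhdsGT hxb]
      exact nhdsWithin_mono _ fun y hy => ⟨hxa.trans hy.1.le, hy.2.le⟩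
    have h1 : ∀ᶠ y in 𝓝[>] x, ∫ τ in a..y, k τ < (∫ τ in a..x, k τ) + 1 / 2 :=
      (hcx.mono_left hle).eventually (gt_mem_nhds (by linarith))
    filter_upwards [h1, Ioo_mem_nhdsGT hxb] with y hy1 hy2
    refine ⟨hy2.2, ?_⟩
    rw [← intervalIntegral.integral_add_adjacent_intervals (hsub le_rfl hxa hxb.le)
      (hsub hxa hy2.1.le hy2.2.le)] at hy1
    linarith
  filter_upwards [hnear, self_mem_nhdsWithin] with y hy hxy
  have hxy : x < y := hxy
  have hyb := hy.1
  obtain ⟨m, hm, hmax⟩ := isCompact_Icc.exists_isMaxOn (nonempty_Icc.2 hxy.le)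
    (hg.mono (Icc_subset_Icc hxa hyb.le))
  set I := ∫ τ in x..y, k τ with hI
  have hI0 : 0 ≤ I := intervalIntegral.integral_nonneg hxy.le fun _ _ => hk0 _
  have hgm0 : 0 ≤ g m := hg0 m ⟨hxa.trans hm.1, hm.2.trans hyb.le⟩
  -- On a piece with `I ≤ 1 / 2` the maximum of `g` absorbs its own contribution: `g m * (1 - I) ≤ g
  -- x`. Together with `(1 - I)⁻¹ ≤ 1 + 2 * I ≤ exp (2 * I)` this produces the factor two in the
  -- exponent.
  have h1 : g m - g x ≤ g m * I := by
    have hkI : ∫ τ in x..m, k τ ≤ I := by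
      rw [hI, ← intervalIntegral.integral_add_adjacent_intervals
        (hsub hxa hm.1 (hm.2.trans hyb.le)) (hsub (hxa.trans hm.1) hm.2 hyb.le)]
      have : 0 ≤ ∫ τ in m..y, k τ := intervalIntegral.integral_nonneg hm.2 fun _ _ => hk0 _
      linarith
    calc g m - g x ≤ ∫ τ in x..m, k τ * g τ := h x m hxa hm.1 (hm.2.trans hyb.le)
      _ ≤ ∫ τ in x..m, k τ * g m := by
        have hkm := hsub hxa hm.1 (hm.2.trans hyb.le)
        refine intervalIntegral.integral_mono_on hm.1 ?_ (hkm.mul_const _) ?_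
        · refine hkm.mul_continuousOn (hg.mono ?_)
          rw [uIcc_of_le hm.1]
          exact Icc_subset_Icc hxa (hm.2.trans hyb.le)
        · intro z hz
          exact mul_le_mul_of_nonneg_left (hmax ⟨hz.1, hz.2.trans hm.2⟩) (hk0 z)
      _ = (∫ τ in x..m, k τ) * g m := intervalIntegral.integral_mul_const _ _
      _ ≤ g m * I := by rw [mul_comm]; exact mul_le_mul_of_nonneg_left hkI hgm0
  have h2 : g y ≤ g m := hmax (right_mem_Icc.2 hxy.le)
  have h3 : g m ≤ Real.exp (2 * I) * g x := by
    have e1 : 1 + 2 * I ≤ Real.exp (2 * I) := by linarith [Real.add_one_le_exp (2 * I)]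
    have e2 : 1 ≤ (1 + 2 * I) * (1 - I) := by nlinarith [hy.2]
    have hgx : g m * (1 - I) ≤ g x := by linarith
    have : 0 ≤ 1 + 2 * I := by linarith
    have e3 := mul_le_mul_of_nonneg_left hgx this
    have e4 := mul_le_mul_of_nonneg_right e1 (hg0 x ⟨hxa, hxb.le⟩)
    have e5 := mul_le_mul_of_nonneg_left e2 hgm0
    nlinarith
  have hx : g x ≤ Real.exp (2 * ∫ τ in a..x, k τ) * g a := hx
  show g y ≤ Real.exp (2 * ∫ τ in a..y, k τ) * g a
  rw [← intervalIntegral.integral_add_adjacent_intervals (hsub le_rfl hxa hxb.le)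
      (hsub hxa hxy.le hyb.le), mul_add, Real.exp_add]
  calc g y ≤ Real.exp (2 * I) * g x := h2.trans h3
    _ ≤ Real.exp (2 * I) * (Real.exp (2 * ∫ τ in a..x, k τ) * g a) :=
      mul_le_mul_of_nonneg_left hx (Real.exp_pos _).le
    _ = _ := by ring

/-! ### The energy identity for a weakly differentiable function with values in `V` and `H` -/

section Energy

variable {V H : Type*} [NormedAddCommGroup V] [NormedSpace ℝ V] [NormedAddCommGroup H]
  [InnerProductSpace ℝ H] {p q : ℝ≥0∞}

lemma aestronglyMeasurable_dual_apply {α : Type*} {m : MeasurableSpace α} {μ : Measure α}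
    {ξ : α → StrongDual ℝ V} {w : α → V} (hξ : AEStronglyMeasurable ξ μ)
    (hw : AEStronglyMeasurable w μ) : AEStronglyMeasurable (fun x => ξ x (w x)) μ :=
  (ContinuousLinearMap.id ℝ (StrongDual ℝ V)).aestronglyMeasurable_comp₂ hξ hw

lemma integrable_dual_apply {α : Type*} {m : MeasurableSpace α} {μ : Measure α}
    [p.HolderConjugate q] {ξ : α → StrongDual ℝ V} {w : α → V} (hξ : MemLp ξ q μ)
    (hw : MemLp w p μ) : Integrable (fun x => ξ x (w x)) μ := by
  have : q.HolderTriple p 1 := ENNReal.HolderTriple.symm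
  rw [← memLp_one_iff_integrable]
  refine MemLp.of_bilin (fun (f : StrongDual ℝ V) x => f x) 1 hξ hw
    (aestronglyMeasurable_dual_apply hξ.1 hw.1) (Eventually.of_forall fun x => ?_)
  rw [one_mul]
  exact (ξ x).le_opNNNorm (w x)

lemma integral_norm_dual_apply_le {α : Type*} {m : MeasurableSpace α} {μ : Measure α}
    [p.HolderConjugate q] {ξ : α → StrongDual ℝ V} {w : α → V} (hξ : MemLp ξ q μ)
    (hw : MemLp w p μ) (s : Set α) :
    ∫ x in s, ‖ξ x (w x)‖ ∂μ ≤ (eLpNorm ξ q μ * eLpNorm w p μ).toReal := by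
  have : q.HolderTriple p 1 := ENNReal.HolderTriple.symm
  have h1 : eLpNorm (fun x => ξ x (w x)) 1 μ ≤ 1 * eLpNorm ξ q μ * eLpNorm w p μ := by
    refine eLpNorm_le_eLpNorm_mul_eLpNorm_of_nnnorm hξ.1 hw.1
      (fun (f : StrongDual ℝ V) x => f x) 1 (Eventually.of_forall fun x => ?_)
    rw [one_mul]
    exact (ξ x).le_opNNNorm (w x)
  rw [one_mul] at h1
  rw [integral_norm_eq_lintegral_enorm (aestronglyMeasurable_dual_apply hξ.1 hw.1).restrict]
  refine ENNReal.toReal_mono (ENNReal.mul_ne_top hξ.2.ne hw.2.ne) (le_trans ?_ h1)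
  rw [eLpNorm_one_eq_lintegral_enorm]
  exact lintegral_mono' Measure.restrict_le_self le_rfl

lemma memLp_translate {E : Type*} [NormedAddCommGroup E] {f : ℝ → E} (hf : MemLp f p) (h : ℝ) :
    MemLp (fun x => f (x + h)) p :=
  hf.comp_measurePreserving (measurePreserving_add_right volume h)

/-- Change one factor at a time: by Hölder each change costs the translation modulus of one factor
times the norm of the other. Joint continuity in two independent shifts is needed because the
functional and its argument are displaced differently in the averaged energy identity. -/
lemma tendsto_integral_translate_apply [p.HolderConjugate q] [Fact (1 ≤ p)] [Fact (1 ≤ q)]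
    (hp : p ≠ ⊤) (hq : q ≠ ⊤) {ξ : ℝ → StrongDual ℝ V} {w : ℝ → V} (hξ : MemLp ξ q)
    (hw : MemLp w p) (s : Set ℝ) :
    Tendsto (fun z : ℝ × ℝ => ∫ τ in s, ξ (τ + z.1) (w (τ + z.2))) (𝓝 (0, 0))
      (𝓝 (∫ τ in s, ξ τ (w τ))) := by
  have ht1 := tendsto_eLpNorm_translate_sub hq hξ
  have ht2 := tendsto_eLpNorm_translate_sub hp hw
  have hfst : Tendsto (Prod.fst : ℝ × ℝ → ℝ) (𝓝 (0, 0)) (𝓝 0) := continuous_fst.tendsto (0, 0)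
  have hsnd : Tendsto (Prod.snd : ℝ × ℝ → ℝ) (𝓝 (0, 0)) (𝓝 0) := continuous_snd.tendsto (0, 0)
  have k1 : Tendsto (fun z : ℝ × ℝ => eLpNorm (fun x => ξ (x + z.1) - ξ x) q * eLpNorm w p)
      (𝓝 (0, 0)) (𝓝 0) := by
    have c1 : Tendsto (fun z : ℝ × ℝ => eLpNorm (fun x => ξ (x + z.1) - ξ x) q) (𝓝 (0, 0))
      (𝓝 0) := ht1.comp hfst
    have := ENNReal.Tendsto.mul_const c1 (Or.inr hw.2.ne)
    rwa [zero_mul] at this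
  have k2 : Tendsto (fun z : ℝ × ℝ => eLpNorm ξ q * eLpNorm (fun x => w (x + z.2) - w x) p)
      (𝓝 (0, 0)) (𝓝 0) := by
    have c1 : Tendsto (fun z : ℝ × ℝ => eLpNorm (fun x => w (x + z.2) - w x) p) (𝓝 (0, 0))
      (𝓝 0) := ht2.comp hsnd
    have := ENNReal.Tendsto.const_mul c1 (Or.inr hξ.2.ne)
    rwa [mul_zero] at this
  have k3 := ((ENNReal.tendsto_toReal ENNReal.zero_ne_top).comp k1).add
    ((ENNReal.tendsto_toReal ENNReal.zero_ne_top).comp k2)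
  rw [ENNReal.toReal_zero, add_zero] at k3
  rw [tendsto_iff_norm_sub_tendsto_zero]
  refine squeeze_zero (fun _ => norm_nonneg _) (fun z => ?_) k3
  have m1 := memLp_translate hξ z.1
  have m2 := memLp_translate hw z.2
  have m3 : MemLp (fun x => ξ (x + z.1) - ξ x) q := m1.sub hξ
  have m4 : MemLp (fun x => w (x + z.2) - w x) p := m2.sub hw
  have e : (∫ τ in s, ξ (τ + z.1) (w (τ + z.2))) - ∫ τ in s, ξ τ (w τ) =
      (∫ τ in s, (ξ (τ + z.1) - ξ τ) (w (τ + z.2))) + ∫ τ in s, ξ τ (w (τ + z.2) - w τ) := by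
    rw [← integral_sub (integrable_dual_apply (p := p) (q := q) m1 m2).integrableOn
      (integrable_dual_apply (p := p) (q := q) hξ hw).integrableOn,
      ← integral_add (integrable_dual_apply (p := p) (q := q) m3 m2).integrableOn
        (integrable_dual_apply (p := p) (q := q) hξ m4).integrableOn]
    refine integral_congr_ae (Eventually.of_forall fun τ => ?_)
    simp
  rw [e]
  refine (norm_add_le _ _).trans (add_le_add ?_ ?_)
  · have := (norm_integral_le_integral_norm _).trans
      (integral_norm_dual_apply_le (p := p) (q := q) m3 m2 s)
    have e2 : eLpNorm (fun x => w (x + z.2)) p = eLpNorm w p :=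
      eLpNorm_comp_measurePreserving hw.1 (measurePreserving_add_right volume z.2)
    rw [e2] at this
    exact this
  · exact (norm_integral_le_integral_norm _).trans
      (integral_norm_dual_apply_le (p := p) (q := q) hξ m4 s)

/-- Supplies Fubini's theorem for the averaged energy identity. Hölder bounds the inner integral
uniformly in `σ`, since translations preserve norms. -/
lemma integrable_translate_apply [p.HolderConjugate q] {ξ : ℝ → StrongDual ℝ V} {w : ℝ → V}
    (hξ : MemLp ξ q) (hw : MemLp w p) (s t h k : ℝ) :
    Integrable (Function.uncurry fun σ τ : ℝ => ξ (τ + σ) (w (τ + k)))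
      ((volume.restrict (Ioc 0 h)).prod (volume.restrict (Ioc s t))) := by
  have hle : ((volume.restrict (Ioc 0 h)).prod (volume.restrict (Ioc s t)) : Measure (ℝ × ℝ)) ≪
      volume.prod volume := by
    rw [Measure.prod_restrict]
    exact Measure.restrict_le_self.absolutelyContinuous
  have hmp : Measure.QuasiMeasurePreserving (fun z : ℝ × ℝ => z.2 + z.1)
      ((volume.restrict (Ioc 0 h)).prod (volume.restrict (Ioc s t))) volume := by
    have h0 : Measure.QuasiMeasurePreserving (fun z : ℝ × ℝ => z.2 + z.1)
        (volume.prod volume) volume := by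
      have := (Measure.quasiMeasurePreserving_snd (μ := (volume : Measure ℝ))
        (ν := (volume : Measure ℝ))).comp
        ((measurePreserving_prod_add volume volume).quasiMeasurePreserving)
      simpa [Function.comp_def, add_comm] using this
    exact h0.mono_left hle
  have hmp2 : Measure.QuasiMeasurePreserving (fun z : ℝ × ℝ => z.2 + k)
      ((volume.restrict (Ioc 0 h)).prod (volume.restrict (Ioc s t))) volume := by
    have h0 : Measure.QuasiMeasurePreserving (fun z : ℝ × ℝ => z.2 + k)
        (volume.prod volume) volume :=
      (measurePreserving_add_right volume k).quasiMeasurePreserving.comp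
        Measure.quasiMeasurePreserving_snd
    exact h0.mono_left hle
  have hmeas : AEStronglyMeasurable (Function.uncurry fun σ τ : ℝ => ξ (τ + σ) (w (τ + k)))
      ((volume.restrict (Ioc 0 h)).prod (volume.restrict (Ioc s t))) :=
    aestronglyMeasurable_dual_apply (hξ.1.comp_quasiMeasurePreserving hmp)
      (hw.1.comp_quasiMeasurePreserving hmp2)
  rw [integrable_prod_iff hmeas]
  constructor
  · exact Eventually.of_forall fun σ => (integrable_dual_apply (p := p) (q := q)
      (memLp_translate hξ σ) (memLp_translate hw k)).integrableOn
  · refine Integrable.of_bound (C := (eLpNorm ξ q * eLpNorm w p).toReal)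
      hmeas.norm.integral_prod_right' (Eventually.of_forall fun σ => ?_)
    have := integral_norm_dual_apply_le (p := p) (q := q) (memLp_translate hξ σ)
      (memLp_translate hw k) (Ioc s t)
    have e1 : eLpNorm (fun x => ξ (x + σ)) q = eLpNorm ξ q :=
      eLpNorm_comp_measurePreserving hξ.1 (measurePreserving_add_right volume σ)
    have e2 : eLpNorm (fun x => w (x + k)) p = eLpNorm w p :=
      eLpNorm_comp_measurePreserving hw.1 (measurePreserving_add_right volume k)
    rw [e1, e2] at this
    rw [Real.norm_of_nonneg (integral_nonneg fun _ => norm_nonneg _)]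
    exact this

/-- The energy identity for Steklov averages. -/
lemma integral_norm_sq_sub_eq_integral [p.HolderConjugate q] {T : ℝ} (j : V →L[ℝ] H)
    {ξ : ℝ → StrongDual ℝ V} {w : ℝ → V} {W : ℝ → H} (hξ : MemLp ξ q) (hw : MemLp w p)
    (hW : Continuous W) (hWw : ∀ᵐ t, t ∈ Ioo 0 T → W t = j (w t))
    (hder : ∀ (φ : V) (s t : ℝ), 0 < s → s ≤ t → t < T →
      ⟪W t - W s, j φ⟫ = ∫ τ in s..t, ξ τ φ)
    {s t h : ℝ} (hs : 0 < s) (hst : s ≤ t) (hh : 0 < h) (ht : t + h < T) :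
    (∫ τ in t..t + h, ‖W τ‖ ^ 2) - (∫ τ in s..s + h, ‖W τ‖ ^ 2) =
      ∫ σ in (0 : ℝ)..h, ((∫ τ in Ioc s t, ξ (τ + σ) (w (τ + h))) +
        ∫ τ in Ioc s t, ξ (τ + σ) (w (τ + 0))) := by
  have hG : Continuous fun τ => ‖W τ‖ ^ 2 := hW.norm.pow 2
  have hi : ∀ a b, IntervalIntegrable (fun τ => ‖W τ‖ ^ 2) volume a b :=
    fun a b => hG.intervalIntegrable a b
  -- The integrals over the overlap cancel. What remains is treated by `‖x‖² - ‖y‖² = ⟨x - y, x +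
  -- y⟩`, with the increment `x - y` written as the integral of `ξ` over a window of length `h`.
  have e1 : (∫ τ in t..t + h, ‖W τ‖ ^ 2) - (∫ τ in s..s + h, ‖W τ‖ ^ 2) =
      ∫ τ in Ioc s t, (‖W (τ + h)‖ ^ 2 - ‖W τ‖ ^ 2) := by
    rw [← intervalIntegral.integral_of_le hst, intervalIntegral.integral_sub
      (Continuous.intervalIntegrable (by fun_prop) _ _) (hi _ _),
      intervalIntegral.integral_comp_add_right (fun τ => ‖W τ‖ ^ 2)]
    have := intervalIntegral.integral_add_adjacent_intervals (hi s t) (hi t (t + h))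
    have := intervalIntegral.integral_add_adjacent_intervals (hi s (s + h)) (hi (s + h) (t + h))
    linarith
  have i1 := integrable_translate_apply (p := p) (q := q) hξ hw s t h h
  have i2 := integrable_translate_apply (p := p) (q := q) hξ hw s t h 0
  have a1 := i1.integral_prod_left
  have a2 := i2.integral_prod_left
  have b1 := i1.integral_prod_right
  have b2 := i2.integral_prod_right
  have e2 := integral_integral_swap i1
  have e3 := integral_integral_swap i2
  simp only [Function.uncurry] at a1 a2 b1 b2
  rw [e1, intervalIntegral.integral_of_le hh.le, integral_add a1 a2, e2, e3, ← integral_add b1 b2]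
  have hshift : ∀ᵐ τ, τ + h ∈ Ioo 0 T → W (τ + h) = j (w (τ + h)) :=
    (measurePreserving_add_right volume h).quasiMeasurePreserving.ae hWw
  refine setIntegral_congr_ae measurableSet_Ioc ?_
  filter_upwards [hWw, hshift] with τ h1 h2 hτ
  have hτ1 : τ ∈ Ioo 0 T := ⟨by linarith [hτ.1], by linarith [hτ.2]⟩
  have hτ2 : τ + h ∈ Ioo 0 T := ⟨by linarith [hτ.1], by linarith [hτ.2]⟩
  have d : ∀ φ, ∫ σ in Ioc 0 h, ξ (τ + σ) φ = ⟪W (τ + h) - W τ, j φ⟫ := by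
    intro φ
    rw [hder φ τ (τ + h) hτ1.1 (by linarith) hτ2.2, ← intervalIntegral.integral_of_le hh.le]
    have := intervalIntegral.integral_comp_add_left (a := 0) (b := h) (fun x => ξ x φ) τ
    rw [this, add_zero]
  rw [d, d, add_zero, ← h2 hτ2, ← h1 hτ1, ← inner_add_right, inner_add_right, inner_sub_left,
    inner_sub_left, real_inner_self_eq_norm_sq, real_inner_self_eq_norm_sq,
    real_inner_comm (W τ) (W (τ + h))]
  ring

lemma memLp_indicator_Ioo {E : Type*} [NormedAddCommGroup E] {f : ℝ → E} {a b : ℝ}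
    (hf : MemLp f p (volume.restrict (Ioo a b))) : MemLp ((Ioo a b).indicator f) p volume := by
  rw [memLp_indicator_iff_restrict measurableSet_Ioo]
  exact hf

/-- The energy identity: if `W` is continuous in `H`, agrees almost everywhere with `j w`,
`w ∈ L^p(0,T;V)`, and has the derivative `ξ ∈ L^{p'}(0,T;V')`, then `½‖W‖²` is a primitive of
`⟨ξ, w⟩`. -/
theorem norm_sq_sub_norm_sq_eq_integral [p.HolderConjugate q] [Fact (1 ≤ p)] [Fact (1 ≤ q)]
    (hp : p ≠ ⊤) (hq : q ≠ ⊤) {T : ℝ} (j : V →L[ℝ] H) {ξ : ℝ → StrongDual ℝ V} {w : ℝ → V}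
    {W : ℝ → H} (hξ : MemLp ξ q (volume.restrict (Ioo 0 T)))
    (hw : MemLp w p (volume.restrict (Ioo 0 T))) (hW : ContinuousOn W (Icc 0 T))
    (hWw : ∀ᵐ t ∂(volume.restrict (Ioo 0 T)), W t = j (w t))
    (hder : ∀ (φ : V) (s t : ℝ), 0 < s → s ≤ t → t < T →
      ⟪W t - W s, j φ⟫ = ∫ τ in s..t, ξ τ φ)
    {s t : ℝ} (hs : 0 < s) (hst : s ≤ t) (ht : t < T) :
    ‖W t‖ ^ 2 - ‖W s‖ ^ 2 = 2 * ∫ τ in s..t, ξ τ (w τ) := by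
  have hT : (0 : ℝ) ≤ T := by linarith
  -- Extension by zero makes translations act on the whole line; nothing changes on the interior
  -- windows used below.
  obtain ⟨ξ', hξ'⟩ : ∃ f : ℝ → StrongDual ℝ V, f = (Ioo 0 T).indicator ξ := ⟨_, rfl⟩
  obtain ⟨w', hw'⟩ : ∃ f : ℝ → V, f = (Ioo 0 T).indicator w := ⟨_, rfl⟩
  have mξ : MemLp ξ' q := by
    rw [hξ']
    exact memLp_indicator_Ioo hξ
  have mw : MemLp w' p := by
    rw [hw']
    exact memLp_indicator_Ioo hw
  obtain ⟨G, hGdef⟩ : ∃ f : ℝ → H, f = IccExtend hT (fun x : Icc 0 T => W x) := ⟨_, rfl⟩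
  have hG : Continuous G := by
    rw [hGdef]
    exact (continuousOn_iff_continuous_domRestrict.1 hW).Icc_extend'
  have hGg : ∀ x ∈ Icc 0 T, G x = W x := fun x hx => by simp [hGdef, IccExtend_of_mem hT _ hx]
  have hsub : ∀ {x}, x ∈ Ioc s t → x ∈ Ioo 0 T := fun hx =>
    ⟨by linarith [hx.1], by linarith [hx.2]⟩
  let B : ℝ × ℝ → ℝ := fun z => ∫ τ in Ioc s t, ξ' (τ + z.1) (w' (τ + z.2))
  have hB : Tendsto B (𝓝 (0, 0)) (𝓝 (∫ τ in Ioc s t, ξ' τ (w' τ))) :=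
    tendsto_integral_translate_apply hp hq mξ mw (Ioc s t)
  have hB0 : ∫ τ in Ioc s t, ξ' τ (w' τ) = ∫ τ in s..t, ξ τ (w τ) := by
    rw [intervalIntegral.integral_of_le hst]
    refine setIntegral_congr_fun measurableSet_Ioc fun τ hτ => ?_
    simp [hξ', hw', hsub hτ]
  set B0 := ∫ τ in s..t, ξ τ (w τ)
  rw [hB0] at hB
  have key : ∀ h, 0 < h → t + h < T →
      (∫ τ in t..t + h, ‖G τ‖ ^ 2) - (∫ τ in s..s + h, ‖G τ‖ ^ 2) =
        ∫ σ in (0 : ℝ)..h, (B (σ, h) + B (σ, 0)) := by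
    intro h hh hth
    refine integral_norm_sq_sub_eq_integral (p := p) (q := q) (T := T) j mξ mw hG ?_ ?_ hs hst
      hh hth
    · rw [ae_restrict_iff' measurableSet_Ioo] at hWw
      filter_upwards [hWw] with τ h1 h2
      rw [hGg τ (Ioo_subset_Icc_self h2), h1 h2, hw', indicator_of_mem h2]
    · intro φ a b ha hab hb
      rw [hGg a ⟨ha.le, by linarith⟩, hGg b ⟨by linarith, hb.le⟩, hder φ a b ha hab hb]
      refine intervalIntegral.integral_congr fun τ hτ => ?_
      rw [uIcc_of_le hab] at hτ
      have : τ ∈ Ioo 0 T := ⟨by linarith [hτ.1], by linarith [hτ.2]⟩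
      simp only [hξ', indicator_of_mem this]
  have hGc : Continuous fun τ => ‖G τ‖ ^ 2 := hG.norm.pow 2
  have hlim : ∀ a, Tendsto (fun h : ℝ => h⁻¹ * ∫ τ in a..a + h, ‖G τ‖ ^ 2) (𝓝[>] 0)
      (𝓝 (‖G a‖ ^ 2)) := by
    intro a
    have := (hGc.integral_hasStrictDerivAt a a).hasDerivAt.tendsto_slope_zero_right
    simpa using this
  have hL : Tendsto (fun h : ℝ => h⁻¹ * ∫ σ in (0 : ℝ)..h, (B (σ, h) + B (σ, 0))) (𝓝[>] 0)
      (𝓝 (‖G t‖ ^ 2 - ‖G s‖ ^ 2)) := by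
    refine ((hlim t).sub (hlim s)).congr' ?_
    filter_upwards [self_mem_nhdsWithin, nhdsWithin_le_nhds (Iio_mem_nhds (sub_pos.2 ht))]
      with h h1 h2
    have h2 : h < T - t := h2
    rw [← key h h1 (by linarith), mul_sub]
  -- Both shifts tend to zero with `h`, so the mean of `B (σ, h) + B (σ, 0)` tends to twice the
  -- unshifted pairing. This is the factor two of the energy identity.
  have hR : Tendsto (fun h : ℝ => h⁻¹ * ∫ σ in (0 : ℝ)..h, (B (σ, h) + B (σ, 0))) (𝓝[>] 0)
      (𝓝 (2 * B0)) := by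
    rw [Metric.tendsto_nhds]
    intro ε hε
    have h1 : ∀ᶠ z : ℝ × ℝ in 𝓝 (0, 0), dist (B z) B0 < ε / 3 :=
      Metric.tendsto_nhds.1 hB _ (by positivity)
    obtain ⟨δ, hδ, hball⟩ := Metric.eventually_nhds_iff.1 h1
    filter_upwards [self_mem_nhdsWithin, nhdsWithin_le_nhds (Iio_mem_nhds hδ)] with h h2 h3
    have h2 : 0 < h := h2
    have h3 : h < δ := h3
    have hbd : ∀ σ ∈ uIoc 0 h, ‖B (σ, h) + B (σ, 0) - 2 * B0‖ ≤ 2 * (ε / 3) := by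
      intro σ hσ
      rw [uIoc_of_le h2.le] at hσ
      have a1 := @hball (σ, h) (by
        simp only [Prod.dist_eq, Real.dist_eq, sub_zero, abs_of_pos hσ.1, abs_of_pos h2]
        exact max_lt (hσ.2.trans_lt h3) h3)
      have a2 := @hball (σ, 0) (by
        simp only [Prod.dist_eq, Real.dist_eq, sub_zero, abs_of_pos hσ.1, abs_zero]
        exact max_lt (hσ.2.trans_lt h3) hδ)
      rw [Real.dist_eq] at a1 a2
      rw [Real.norm_eq_abs]
      have := abs_add_le (B (σ, h) - B0) (B (σ, 0) - B0)
      rw [show B (σ, h) + B (σ, 0) - 2 * B0 = (B (σ, h) - B0) + (B (σ, 0) - B0) by ring]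
      linarith
    have hii : IntervalIntegrable (fun σ => B (σ, h) + B (σ, 0)) volume 0 h := by
      rw [intervalIntegrable_iff_integrableOn_Ioc_of_le h2.le]
      exact (integrable_translate_apply (p := p) (q := q) mξ mw s t h h).integral_prod_left.add
        (integrable_translate_apply (p := p) (q := q) mξ mw s t h 0).integral_prod_left
    have h4 := intervalIntegral.norm_integral_le_of_norm_le_const hbd
    rw [intervalIntegral.integral_sub hii (by simp), intervalIntegral.integral_const, sub_zero,
      abs_of_pos h2, smul_eq_mul, Real.norm_eq_abs] at h4
    rw [Real.dist_eq]
    set I := ∫ σ in (0 : ℝ)..h, (B (σ, h) + B (σ, 0))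
    have h5 : h⁻¹ * I - 2 * B0 = h⁻¹ * (I - h * (2 * B0)) := by field_simp
    rw [h5, abs_mul, abs_of_pos (inv_pos.2 h2)]
    calc h⁻¹ * |I - h * (2 * B0)| ≤ h⁻¹ * (2 * (ε / 3) * h) :=
          mul_le_mul_of_nonneg_left h4 (inv_pos.2 h2).le
      _ = 2 * (ε / 3) := by field_simp
      _ < ε := by linarith
  have := tendsto_nhds_unique hL hR
  rwa [hGg t ⟨by linarith, ht.le⟩, hGg s ⟨hs.le, by linarith⟩] at this

end Energy

/-! ### Graph coordinates -/

/-- The plane in which the graph coordinates of a Lipschitz domain live. -/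
abbrev E2 : Type := EuclideanSpace ℝ (Fin 2)

/-- The projection of `ℝ³` to its first two coordinates. -/
def proj2 : E3 →L[ℝ] E2 :=
  LinearMap.toContinuousLinearMap
    { toFun := fun y => !₂[y 0, y 1]
      map_add' := fun x y => by ext i; fin_cases i <;> simp
      map_smul' := fun c y => by ext i; fin_cases i <;> simp }

lemma proj2_apply (y : E3) : proj2 y = !₂[y 0, y 1] := rfl

lemma norm_proj2_le (y : E3) : ‖proj2 y‖ ≤ ‖y‖ := by
  rw [EuclideanSpace.norm_eq, EuclideanSpace.norm_eq]
  refine Real.sqrt_le_sqrt ?_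
  simp [proj2_apply, Fin.sum_univ_succ]
  positivity

/-- The vertical direction of the orthonormal coordinates `L`. -/
def axis (L : E3 ≃ₗᵢ[ℝ] E3) : E3 := L.symm (EuclideanSpace.single 2 1)

/-- The height above the graph of `a` in the coordinates `L`. -/
def height (L : E3 ≃ₗᵢ[ℝ] E3) (a : E2 → ℝ) (y : E3) : ℝ := L y 2 - a (proj2 (L y))

/-- The point with horizontal coordinate `z.1` and height `z.2` above the graph of `a`. -/
def graphPoint (L : E3 ≃ₗᵢ[ℝ] E3) (a : E2 → ℝ) (z : E2 × ℝ) : E3 :=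
  L.symm !₂[z.1 0, z.1 1, z.2 + a z.1]

section Chart

variable {L : E3 ≃ₗᵢ[ℝ] E3} {a : E2 → ℝ} {K : ℝ≥0}

lemma norm_axis : ‖axis L‖ = 1 := by simp [axis]

lemma apply_axis : L (axis L) = EuclideanSpace.single 2 1 := by simp [axis]

lemma proj2_axis : proj2 (L (axis L)) = 0 := by
  rw [apply_axis, proj2_apply]
  ext i
  fin_cases i <;> simp

lemma height_add_smul_axis (y : E3) (t : ℝ) : height L a (y + t • axis L) = height L a y + t := by
  simp only [height, map_add, map_smul, proj2_axis, smul_zero, add_zero]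
  simp [apply_axis]
  ring

lemma lipschitzWith_height (ha : LipschitzWith K a) : LipschitzWith (1 + K) (height L a) := by
  refine LipschitzWith.sub ?_ ?_
  · refine LipschitzWith.of_dist_le_mul fun x y => ?_
    rw [NNReal.coe_one, one_mul, dist_eq_norm, dist_eq_norm, ← L.norm_map, map_sub]
    exact PiLp.norm_apply_le (L x - L y) 2
  · have h1 : LipschitzWith 1 fun y => proj2 (L y) := by
      refine LipschitzWith.of_dist_le_mul fun x y => ?_
      rw [NNReal.coe_one, one_mul, dist_eq_norm, dist_eq_norm, ← map_sub, ← map_sub]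
      exact (norm_proj2_le _).trans_eq (L.norm_map _)
    have h2 := ha.comp h1
    rw [mul_one] at h2
    exact h2

lemma height_graphPoint (z : E2 × ℝ) : height L a (graphPoint L a z) = z.2 := by
  have : (!₂[z.1 0, z.1 1] : E2) = z.1 := by
    ext i
    fin_cases i <;> simp
  simp [height, graphPoint, proj2_apply, this]

lemma proj2_graphPoint (z : E2 × ℝ) : proj2 (L (graphPoint L a z)) = z.1 := by
  rw [graphPoint, L.apply_symm_apply, proj2_apply]
  ext i
  fin_cases i <;> simp

lemma graphPoint_eq (y : E3) : graphPoint L a (proj2 (L y), height L a y) = y := by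
  rw [graphPoint, LinearIsometryEquiv.symm_apply_eq]
  ext i
  fin_cases i <;> simp [height, proj2_apply]

lemma graphPoint_add (y : E2) (s t : ℝ) :
    graphPoint L a (y, s + t) = graphPoint L a (y, s) + t • axis L := by
  rw [graphPoint, LinearIsometryEquiv.symm_apply_eq, map_add, map_smul, apply_axis, graphPoint,
    L.apply_symm_apply]
  ext i
  fin_cases i <;> simp
  ring

lemma lipschitzWith_graphPoint_zero (ha : LipschitzWith K a) :
    LipschitzWith (1 + K) fun y => graphPoint L a (y, 0) := by
  refine LipschitzWith.of_dist_le_mul fun x y => ?_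
  have h1 : graphPoint L a (x, 0) - graphPoint L a (y, 0) =
      L.symm (!₂[(x - y) 0, (x - y) 1, 0]) + (a x - a y) • axis L := by
    rw [graphPoint, graphPoint, axis, ← map_smul, ← map_add, ← map_sub]
    congr 1
    ext i
    fin_cases i <;> simp
  have h2 : ‖(!₂[(x - y) 0, (x - y) 1, 0] : E3)‖ = ‖x - y‖ := by
    simp [EuclideanSpace.norm_eq, Fin.sum_univ_succ]
  rw [dist_eq_norm, h1]
  refine (norm_add_le _ _).trans ?_
  rw [L.symm.norm_map, h2, norm_smul, norm_axis, mul_one, NNReal.coe_add, NNReal.coe_one, add_mul,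
    one_mul, ← dist_eq_norm, ← dist_eq_norm]
  exact add_le_add le_rfl (ha.dist_le_mul x y)

/-- Vertical shears preserve volume fibre by fibre, so straightening the boundary produces no
Jacobian and needs only continuity of `a`. -/
lemma measurePreserving_graphPoint (ha : Continuous a) :
    MeasurePreserving (graphPoint L a) (volume.prod volume) volume := by
  have h1 : MeasurePreserving (fun z : E2 × ℝ => (z.1, z.2 + a z.1)) (volume.prod volume)
      (volume.prod volume) := by
    refine (MeasurePreserving.id volume).skew_product (g := fun y s => s + a y) ?_ ?_
    · exact (Continuous.measurable (by simp only [Function.uncurry_def]; fun_prop))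
    · exact Eventually.of_forall fun y => (measurePreserving_add_right volume (a y)).map_eq
  have h2 : MeasurePreserving (fun z : E2 × ℝ => (z.2, WithLp.ofLp z.1)) (volume.prod volume)
      (volume.prod volume) :=
    ((MeasurePreserving.id volume).prod (PiLp.volume_preserving_ofLp (Fin 2))).comp
      Measure.measurePreserving_swap
  have h3 : MeasurePreserving (MeasurableEquiv.piFinSuccAbove (fun _ : Fin 3 => ℝ) 2).symm
      (volume.prod volume) volume :=
    (volume_preserving_piFinSuccAbove (fun _ : Fin 3 => ℝ) 2).symm
  have h4 := PiLp.volume_preserving_toLp (Fin 3)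
  have h5 := (L.symm.measurePreserving.comp h4).comp ((h3.comp h2).comp h1)
  have e : graphPoint L a = (L.symm ∘ WithLp.toLp 2) ∘
      ((MeasurableEquiv.piFinSuccAbove (fun _ : Fin 3 => ℝ) 2).symm ∘
        fun z : E2 × ℝ => (z.2, WithLp.ofLp z.1)) ∘ fun z : E2 × ℝ => (z.1, z.2 + a z.1) := by
    funext z
    simp only [graphPoint, Function.comp_apply]
    congr 1
    ext i
    fin_cases i <;> rfl
  rw [e]
  exact h5

/-- A set of vanishing area casts a vertical shadow of vanishing volume. -/
lemma volume_shadow_eq_zero {N : Set E3} (hN : (μHE[2] : Measure E3) N = 0) :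
    volume {y : E3 | ∃ t : ℝ, y + t • axis L ∈ N} = 0 := by
  have h1 : LipschitzWith 1 fun y : E3 => proj2 (L y) := by
    refine LipschitzWith.of_dist_le_mul fun x y => ?_
    rw [NNReal.coe_one, one_mul, dist_eq_norm, dist_eq_norm, ← map_sub, ← map_sub]
    exact (norm_proj2_le _).trans_eq (L.norm_map _)
  -- The projection to the plane is 1-Lipschitz and therefore does not increase Hausdorff measure.
  -- The shadow lies in the cylinder over this null set, and Fubini applies.
  have h2 : (volume : Measure E2) ((fun y : E3 => proj2 (L y)) '' N) = 0 := by
    have hc := Measure.addHaarScalarFactor_volume_hausdorffMeasure_ne_zero 2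
    rw [Measure.euclideanHausdorffMeasure_def, Measure.smul_apply, smul_eq_zero] at hN
    have hN' := hN.resolve_left hc
    rw [← EuclideanSpace.euclideanHausdorffMeasure_eq_volume,
      Measure.euclideanHausdorffMeasure_def, Measure.smul_apply]
    have := h1.hausdorffMeasure_image_le (d := (2 : ℕ)) (by positivity) N
    rw [hN', mul_zero] at this
    rw [le_antisymm this zero_le, smul_zero]
  have hmp := measurePreserving_graphPoint (L := L) (a := fun _ => 0) continuous_const
  obtain ⟨M, hM, hMm, hM0⟩ := exists_measurable_superset_of_null h2
  have hsub : {y : E3 | ∃ t : ℝ, y + t • axis L ∈ N} ⊆ (fun y : E3 => proj2 (L y)) ⁻¹' M := by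
    rintro y ⟨t, ht⟩
    refine hM ⟨_, ht, ?_⟩
    simp [proj2_axis]
  refine measure_mono_null hsub ?_
  have hmeas : MeasurableSet ((fun y : E3 => proj2 (L y)) ⁻¹' M) :=
    h1.continuous.measurable hMm
  rw [← hmp.measure_preimage hmeas.nullMeasurableSet]
  have : graphPoint L (fun _ => 0) ⁻¹' ((fun y : E3 => proj2 (L y)) ⁻¹' M) = M ×ˢ univ := by
    ext z
    simp [proj2_graphPoint]
  rw [this, Measure.prod_prod, hM0, zero_mul]

/-- Moving by `t` along the axis raises the height by exactly `t`; the deviation of `z` from the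
axis loses at most `(1 + K) * κ * t ≤ t`. Thus the height never falls below its value at `x`, and
one cone of directions serves a whole chart. -/
lemma height_pos_of_cone (ha : LipschitzWith K a) {x z : E3} {κ t : ℝ} (hx : 0 < height L a x)
    (hκ : (1 + K) * κ ≤ 1) (hz : ‖z - axis L‖ ≤ κ) (ht : 0 ≤ t) : 0 < height L a (x + t • z) := by
  have h1 := (lipschitzWith_height (L := L) ha).dist_le_mul (x + t • z) (x + t • axis L)
  rw [height_add_smul_axis, dist_eq_norm, dist_eq_norm, add_sub_add_left_eq_sub, ← smul_sub,
    norm_smul, Real.norm_of_nonneg ht, Real.norm_eq_abs] at h1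
  have h2 := (abs_le.1 h1).1
  have h3 : ((1 + K : ℝ≥0) : ℝ) * (t * ‖z - axis L‖) ≤ t := by
    push_cast
    calc (1 + (K : ℝ)) * (t * ‖z - axis L‖) ≤ (1 + K) * (t * κ) := by gcongr
      _ = t * ((1 + K) * κ) := by ring
      _ ≤ t * 1 := by gcongr
      _ = t := mul_one t
  linarith

variable {Ω : Set E3} {x₀ : E3} {ρ : ℝ}

lemma mem_frontier_of_height_eq_zero
    (hch : ∀ y ∈ Metric.ball x₀ ρ, (y ∈ Ω ↔ 0 < height L a y)) {y : E3}
    (hy : y ∈ Metric.ball x₀ ρ) (h0 : height L a y = 0) : y ∈ frontier Ω := by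
  have hcont : Continuous fun t : ℝ => y + t • axis L := by fun_prop
  refine ⟨?_, fun hyi => ?_⟩
  · have h1 : Tendsto (fun t : ℝ => y + t • axis L) (𝓝[>] 0) (𝓝 y) := by
      have := hcont.tendsto 0
      rw [zero_smul, add_zero] at this
      exact this.mono_left nhdsWithin_le_nhds
    refine mem_closure_of_tendsto h1 ?_
    filter_upwards [h1 (Metric.isOpen_ball.mem_nhds hy), self_mem_nhdsWithin] with t ht1 ht2
    rw [hch _ ht1, height_add_smul_axis, h0, zero_add]
    exact ht2
  · have := (hch y hy).1 (interior_subset hyi)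
    exact absurd h0 this.ne'

lemma height_eq_zero_of_mem_frontier (hΩ : IsOpen Ω) (ha : LipschitzWith K a)
    (hch : ∀ y ∈ Metric.ball x₀ ρ, (y ∈ Ω ↔ 0 < height L a y)) {y : E3}
    (hy : y ∈ Metric.ball x₀ ρ) (hf : y ∈ frontier Ω) : height L a y = 0 := by
  rw [hΩ.frontier_eq] at hf
  refine le_antisymm (not_lt.1 fun h => hf.2 ((hch y hy).2 h)) ?_
  by_contra hneg
  have hn : {z | height L a z < 0} ∩ Metric.ball x₀ ρ ∈ 𝓝 y :=
    ((isOpen_lt (lipschitzWith_height ha).continuous continuous_const).inter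
      Metric.isOpen_ball).mem_nhds ⟨not_le.1 hneg, hy⟩
  obtain ⟨z, ⟨hz1, hz2⟩, hz3⟩ := mem_closure_iff_nhds.1 hf.1 _ hn
  exact absurd ((hch z hz2).1 hz3) (not_lt.2 (le_of_lt hz1))

/-- This keeps the gradient of the height function away from zero, so that it can be normalised to a
normal vector. -/
lemma fderiv_height_axis (y : E3) (hd : DifferentiableAt ℝ (height L a) y) :
    fderiv ℝ (height L a) y (axis L) = 1 := by
  rw [← hd.lineDeriv_eq_fderiv]
  refine HasLineDerivAt.lineDeriv ?_
  rw [HasLineDerivAt]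
  simp only [height_add_smul_axis]
  exact (hasDerivAt_id (0 : ℝ)).const_add _

/-- Where the height function is differentiable, its gradient is an inner normal. -/
lemma fderiv_height_eq_zero_of_tangential
    (hch : ∀ y ∈ Metric.ball x₀ ρ, (y ∈ Ω ↔ 0 < height L a y)) {y v : E3}
    (hy : y ∈ Metric.ball x₀ ρ) (h0 : height L a y = 0)
    (hd : DifferentiableAt ℝ (height L a) y) (hv : ∀ n, IsOuterNormal Ω y n → ⟪v, n⟫ = 0) :
    fderiv ℝ (height L a) y v = 0 := by
  set g : E3 := (InnerProductSpace.toDual ℝ E3).symm (fderiv ℝ (height L a) y) with hg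
  have hgi : ∀ w, fderiv ℝ (height L a) y w = ⟪w, g⟫ := fun w => by
    rw [real_inner_comm, hg, InnerProductSpace.toDual_symm_apply]
  have hg0 : 0 < ‖g‖ := by
    rw [norm_pos_iff]
    intro h
    have := fderiv_height_axis y hd
    rw [hgi, h, inner_zero_right] at this
    exact zero_ne_one this
  -- Near `y` the domain is the set of positive height, so the first-order expansion of the height
  -- at its zero `y` gives both half-space conditions, with error `ε * ‖g‖` before normalisation.
  have hnormal : IsOuterNormal Ω y (-(‖g‖⁻¹ • g)) := by
    refine ⟨?_, fun ε hε => ?_⟩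
    · rw [norm_neg, norm_smul, norm_inv, norm_norm, inv_mul_cancel₀ hg0.ne']
    have hfd := (hd.hasFDerivAt.isLittleO).bound (mul_pos hε hg0)
    filter_upwards [hfd, Metric.isOpen_ball.mem_nhds hy] with z hz hzb
    rw [h0, sub_zero, hgi, Real.norm_eq_abs, abs_le] at hz
    rw [inner_neg_right, inner_smul_right]
    have e1 : ‖g‖⁻¹ * (ε * ‖g‖ * ‖z - y‖) = ε * ‖z - y‖ := by field_simp
    refine ⟨fun hzΩ => ?_, fun hzΩ => ?_⟩
    · have h1 := (hch z hzb).1 hzΩ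
      have h2 : -(ε * ‖g‖ * ‖z - y‖) ≤ ⟪z - y, g⟫ := by linarith
      have := mul_le_mul_of_nonneg_left h2 (inv_pos.2 hg0).le
      linarith
    · have h1 : height L a z ≤ 0 := not_lt.1 fun h => hzΩ ((hch z hzb).2 h)
      have h2 : ⟪z - y, g⟫ ≤ ε * ‖g‖ * ‖z - y‖ := by linarith
      have := mul_le_mul_of_nonneg_left h2 (inv_pos.2 hg0).le
      linarith
  have h1 := hv _ hnormal
  rw [inner_neg_right, inner_smul_right, neg_eq_zero] at h1
  rw [hgi]
  exact (mul_eq_zero.1 h1).resolve_left (inv_pos.2 hg0).ne'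

/-- The height is affine along vertical lines, so its gradient at a point of the domain equals that
at the boundary point below. This transports tangency from the boundary into the interior. -/
lemma fderiv_height_add_smul_axis (y : E3) (t : ℝ) :
    fderiv ℝ (height L a) (y + t • axis L) = fderiv ℝ (height L a) y := by
  have h1 := fderiv_comp_add_right (𝕜 := ℝ) (f := height L a) (x := y) (t • axis L)
  rw [← h1]
  have h2 : (fun x => height L a (x + t • axis L)) = fun x => height L a x + t := by
    funext x
    exact height_add_smul_axis x t
  rw [h2, fderiv_add_const]

lemma differentiableAt_height_add_smul_axis {y : E3} (hd : DifferentiableAt ℝ (height L a) y)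
    (t : ℝ) : DifferentiableAt ℝ (height L a) (y + t • axis L) := by
  rw [← differentiableAt_comp_add_right]
  have h2 : (fun x => height L a (x + t • axis L)) = fun x => height L a x + t := by
    funext x
    exact height_add_smul_axis x t
  rw [h2]
  exact hd.add_const _

end Chart

lemma IsBoundedLipschitzDomain.exists_chart {Ω : Set E3} (hΩ : IsBoundedLipschitzDomain Ω)
    {x : E3} (hx : x ∈ frontier Ω) : ∃ (L : E3 ≃ₗᵢ[ℝ] E3) (a : E2 → ℝ) (K : ℝ≥0) (ρ : ℝ),
      LipschitzWith K a ∧ 0 < ρ ∧ ∀ y ∈ Metric.ball x ρ, (y ∈ Ω ↔ 0 < height L a y) := by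
  obtain ⟨L, a, K, ρ, ha, hρ, h⟩ := hΩ.boundary x hx
  refine ⟨L, a, K, ρ, ha, hρ, fun y hy => ?_⟩
  rw [h y hy, height, sub_pos, proj2_apply]

/-! ### Symmetric gradients along segments -/

lemma symPart_add (A B : T3) : symPart (A + B) = symPart A + symPart B := by
  ext p
  simp [symPart]
  ring

lemma symPart_smul (c : ℝ) (A : T3) : symPart (c • A) = c • symPart A := by
  ext p
  simp [symPart]
  ring

/-- The symmetric part as a continuous linear map. -/
def symPartL : T3 →L[ℝ] T3 :=
  LinearMap.toContinuousLinearMap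
    { toFun := symPart
      map_add' := symPart_add
      map_smul' := symPart_smul }

lemma isSymm3_symPart (A : T3) : IsSymm3 (symPart A) := fun i j => by
  simp [symPart, add_comm]

lemma inner_T3 (A B : T3) : ⟪A, B⟫ = ∑ i, ∑ j, A (i, j) * B (i, j) := by
  rw [PiLp.inner_apply, ← Finset.univ_product_univ, Finset.sum_product]
  refine Finset.sum_congr rfl fun i _ => Finset.sum_congr rfl fun j _ => ?_
  simp [mul_comm]

lemma inner_E3 (a b : E3) : ⟪a, b⟫ = ∑ i, a i * b i := by
  rw [PiLp.inner_apply]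
  refine Finset.sum_congr rfl fun i _ => ?_
  simp [mul_comm]

lemma inner_symPart_of_isSymm3 {A : T3} (hA : IsSymm3 A) (B : T3) : ⟪A, symPart B⟫ = ⟪A, B⟫ := by
  rw [inner_T3, inner_T3]
  have h : ∑ i, ∑ j, A (i, j) * B (j, i) = ∑ i, ∑ j, A (i, j) * B (i, j) := by
    rw [Finset.sum_comm]
    exact Finset.sum_congr rfl fun i _ => Finset.sum_congr rfl fun j _ => by rw [hA j i]
  calc ∑ i, ∑ j, A (i, j) * symPart B (i, j)
      = (∑ i, ∑ j, A (i, j) * B (i, j) + ∑ i, ∑ j, A (i, j) * B (j, i)) / 2 := by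
        rw [← Finset.sum_add_distrib, Finset.sum_div]
        refine Finset.sum_congr rfl fun i _ => ?_
        rw [← Finset.sum_add_distrib, Finset.sum_div]
        refine Finset.sum_congr rfl fun j _ => ?_
        simp [symPart]
        ring
    _ = _ := by rw [h]; ring

lemma norm_outer (a b : E3) : ‖outer a b‖ = ‖a‖ * ‖b‖ := by
  have h : ‖outer a b‖ ^ 2 = (‖a‖ * ‖b‖) ^ 2 := by
    rw [← real_inner_self_eq_norm_sq, mul_pow, ← real_inner_self_eq_norm_sq,
      ← real_inner_self_eq_norm_sq, inner_T3, inner_E3, inner_E3, Finset.sum_mul_sum]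
    refine Finset.sum_congr rfl fun i _ => Finset.sum_congr rfl fun j _ => ?_
    simp [outer]
    ring
  exact (pow_left_inj₀ (norm_nonneg _) (by positivity) two_ne_zero).1 h

lemma fderiv_eq_sum_grad (w : E3 → E3) (y z : E3) (i : Fin 3) :
    fderiv ℝ w y z i = ∑ j, grad w y (i, j) * z j := by
  have hz : z = ∑ j, z j • EuclideanSpace.single j (1 : ℝ) := by
    ext k
    simp [Finset.sum_apply, Pi.single_apply]
  conv_lhs => rw [hz]
  simp [map_sum, grad, mul_comm]

lemma inner_fderiv_eq (w : E3 → E3) (y z v : E3) :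
    ⟪fderiv ℝ w y z, v⟫ = ⟪grad w y, outer v z⟫ := by
  rw [inner_E3, inner_T3]
  refine Finset.sum_congr rfl fun i _ => ?_
  rw [fderiv_eq_sum_grad, Finset.sum_mul]
  refine Finset.sum_congr rfl fun j _ => ?_
  simp [outer]
  ring

/-- The tensor `z ⊗ z` is symmetric, so only the symmetric part of the gradient is seen. This is why
no separate Korn inequality for the full gradient is required. -/
lemma abs_inner_fderiv_self_le (w : E3 → E3) (y z : E3) :
    |⟪fderiv ℝ w y z, z⟫| ≤ ‖symPart (grad w y)‖ * ‖z‖ ^ 2 := by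
  have hs : IsSymm3 (outer z z) := fun i j => by simp [outer, mul_comm]
  rw [inner_fderiv_eq, real_inner_comm, ← inner_symPart_of_isSymm3 hs, real_inner_comm]
  refine (abs_real_inner_le_norm _ _).trans_eq ?_
  rw [norm_outer, sq]

lemma measurable_grad (w : E3 → E3) : Measurable (grad w) := by
  refine (PiLp.continuous_toLp 2 _).measurable.comp (measurable_pi_lambda _ fun p => ?_)
  have h1 : Measurable fun x => fderiv ℝ w x (EuclideanSpace.single p.2 1) :=
    measurable_fderiv_apply_const ℝ w _
  exact (EuclideanSpace.proj (𝕜 := ℝ) p.1).continuous.measurable.comp h1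

/-- The fundamental theorem of calculus for the component `⟨w, z⟩` along the segment from `x` to `x
+ δ • z`. The constants `2` and `4` are bounds for `‖z‖` and `‖z‖ ^ 2`. -/
lemma enorm_inner_le_of_segment {w : E3 → E3} {K : ℝ≥0} (hw : LipschitzWith K w) {x z : E3}
    {δ : ℝ} (hδ : 0 < δ) (hz : ‖z‖ ≤ 2)
    (hd : ∀ᵐ θ : ℝ ∂(volume.restrict (Ioo 0 1)), DifferentiableAt ℝ w (x + (θ * δ) • z)) :
    ‖⟪w x, z⟫‖ₑ ≤ 2 * ‖w (x + δ • z)‖ₑ +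
      4 * ENNReal.ofReal δ * ∫⁻ θ in Ioo (0 : ℝ) 1, ‖symPart (grad w (x + (θ * δ) • z))‖ₑ := by
  set g : ℝ → ℝ := fun θ => ⟪w (x + (θ * δ) • z), z⟫ with hg
  have hlip : ∃ K', LipschitzWith K' g := by
    refine ⟨‖z‖₊ * (K * (‖δ‖₊ * ‖z‖₊)), LipschitzWith.of_dist_le_mul fun s t => ?_⟩
    rw [Real.dist_eq, hg]
    simp only
    rw [← inner_sub_left]
    refine (abs_real_inner_le_norm _ _).trans ?_
    rw [mul_comm]
    push_cast
    rw [mul_assoc]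
    refine mul_le_mul_of_nonneg_left ?_ (norm_nonneg _)
    rw [← dist_eq_norm, mul_assoc]
    refine (hw.dist_le_mul _ _).trans (mul_le_mul_of_nonneg_left ?_ K.2)
    rw [dist_add_left, dist_eq_norm, ← sub_smul, norm_smul, ← sub_mul, norm_mul, Real.dist_eq]
    simp only [Real.norm_eq_abs]
    exact le_of_eq (by ring)
  obtain ⟨K', hK'⟩ := hlip
  have hFTC := (hK'.lipschitzOnWith (s := uIcc 0 1)).absolutelyContinuousOnInterval
    |>.integral_deriv_eq_sub
  have hder : ∀ᵐ θ : ℝ ∂(volume.restrict (Ioo 0 1)),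
      ‖deriv g θ‖ₑ ≤ ENNReal.ofReal (4 * δ) * ‖symPart (grad w (x + (θ * δ) • z))‖ₑ := by
    filter_upwards [hd] with θ hθ
    have h1 : HasDerivAt (fun θ : ℝ => x + (θ * δ) • z) (δ • z) θ := by
      have : HasDerivAt (fun θ : ℝ => θ * δ) δ θ := by simpa using (hasDerivAt_id θ).mul_const δ
      exact (this.smul_const z).const_add x
    have h2 : HasDerivAt (fun θ : ℝ => w (x + (θ * δ) • z))
        (fderiv ℝ w (x + (θ * δ) • z) (δ • z)) θ := hθ.hasFDerivAt.comp_hasDerivAt θ h1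
    have h3 : HasDerivAt g (⟪fderiv ℝ w (x + (θ * δ) • z) (δ • z), z⟫) θ := by
      simpa using h2.inner ℝ (hasDerivAt_const θ z)
    rw [h3.deriv, map_smul, inner_smul_left, ← ofReal_norm, ← ofReal_norm (symPart _),
      ← ENNReal.ofReal_mul (by positivity)]
    refine ENNReal.ofReal_le_ofReal ?_
    rw [norm_mul]
    simp only [conj_trivial, Real.norm_eq_abs, abs_of_pos hδ]
    have h4 := abs_inner_fderiv_self_le w (x + (θ * δ) • z) z
    have h5 : ‖z‖ ^ 2 ≤ 4 := by nlinarith [norm_nonneg z]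
    have h6 : ‖symPart (grad w (x + (θ * δ) • z))‖ * ‖z‖ ^ 2 ≤
        ‖symPart (grad w (x + (θ * δ) • z))‖ * 4 := by gcongr
    nlinarith
  have h1 : ‖∫ θ in (0 : ℝ)..1, deriv g θ‖ₑ ≤
      4 * ENNReal.ofReal δ * ∫⁻ θ in Ioo (0 : ℝ) 1, ‖symPart (grad w (x + (θ * δ) • z))‖ₑ := by
    rw [intervalIntegral.integral_of_le zero_le_one, integral_Ioc_eq_integral_Ioo]
    refine (enorm_integral_le_lintegral_enorm _).trans ((lintegral_mono_ae hder).trans ?_)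
    rw [lintegral_const_mul' _ _ ENNReal.ofReal_ne_top, ENNReal.ofReal_mul (by norm_num)]
    simp
  have h2 : ⟪w x, z⟫ = ⟪w (x + δ • z), z⟫ - ∫ θ in (0 : ℝ)..1, deriv g θ := by
    rw [hFTC]
    simp [hg]
  rw [h2]
  refine (enorm_sub_le).trans (add_le_add ?_ h1)
  have h3 : 2 * ‖w (x + δ • z)‖ₑ = ENNReal.ofReal (2 * ‖w (x + δ • z)‖) := by
    rw [ENNReal.ofReal_mul (by norm_num), ofReal_norm]
    simp
  rw [← ofReal_norm, h3]
  refine ENNReal.ofReal_le_ofReal ((abs_real_inner_le_norm _ _).trans ?_)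
  rw [mul_comm]
  gcongr

/-- Allows Rademacher's theorem to be used along segments: for each fixed `θ` the dilation in `z` is
nonsingular, and Fubini exchanges the order of `θ` and `z`. -/
lemma ae_ae_notMem_of_null {Z : Set E3} (hZ : volume Z = 0) (x : E3) {δ : ℝ} (hδ : 0 < δ) :
    ∀ᵐ z : E3, ∀ᵐ θ : ℝ ∂(volume.restrict (Ioo 0 1)), x + (θ * δ) • z ∉ Z := by
  obtain ⟨M, hM, hMm, hM0⟩ := exists_measurable_superset_of_null hZ
  have hms : MeasurableSet {p : ℝ × E3 | x + (p.1 * δ) • p.2 ∉ M} := by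
    have : Measurable fun p : ℝ × E3 => x + (p.1 * δ) • p.2 :=
      Continuous.measurable (by fun_prop)
    exact this hMm.compl
  have h1 : ∀ᵐ θ : ℝ ∂(volume.restrict (Ioo 0 1)), ∀ᵐ z : E3, x + (θ * δ) • z ∉ M := by
    filter_upwards [ae_restrict_mem measurableSet_Ioo] with θ hθ
    have hne : θ * δ ≠ 0 := (mul_pos hθ.1 hδ).ne'
    have hq : Measure.QuasiMeasurePreserving (fun z : E3 => x + (θ * δ) • z) volume volume := by
      refine (measurePreserving_add_left volume x).quasiMeasurePreserving.comp
        ⟨measurable_const_smul _, ?_⟩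
      rw [Measure.map_addHaar_smul _ hne]
      exact Measure.smul_absolutelyContinuous
    have : ∀ᵐ y : E3, y ∉ M := by rw [← compl_mem_ae_iff] at hM0; exact hM0
    exact hq.ae this
  have h2 := (Measure.ae_ae_comm (μ := volume.restrict (Ioo (0 : ℝ) 1)) (ν := (volume : Measure E3))
    (p := fun θ z => x + (θ * δ) • z ∉ M) hms).1 h1
  filter_upwards [h2] with z hz
  filter_upwards [hz] with θ hθ h
  exact hθ (hM h)

/-- A ball of radius `κ / 2` and its translate by a vector of length `κ / 2` parallel to `v` both
fit into the larger ball, and `⟨v, ·⟩` changes by `κ / 2 * ‖v‖` between them. It cannot be small on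
both. -/
lemma enorm_le_lintegral_inner (v e : E3) {κ : ℝ} (hκ : 0 < κ) :
    ENNReal.ofReal (κ / 4) * volume (Metric.ball e (κ / 2)) * ‖v‖ₑ ≤
      ∫⁻ z in Metric.closedBall e κ, ‖⟪v, z⟫‖ₑ := by
  by_cases hv : v = 0
  · simp [hv]
  have hv0 : 0 < ‖v‖ := norm_pos_iff.2 hv
  set b : E3 := (κ / 2) • (‖v‖⁻¹ • v) with hb
  have hbn : ‖b‖ = κ / 2 := by
    rw [hb, norm_smul, norm_smul, norm_inv, norm_norm, inv_mul_cancel₀ hv0.ne', mul_one,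
      Real.norm_of_nonneg (by positivity)]
  have hvb : ⟪v, b⟫ = κ / 2 * ‖v‖ := by
    rw [hb, inner_smul_right, inner_smul_right, real_inner_self_eq_norm_sq]
    field_simp
  have hsub : Metric.ball e (κ / 2) ⊆ Metric.closedBall e κ := fun z hz => by
    rw [Metric.mem_ball] at hz
    rw [Metric.mem_closedBall]
    linarith
  have hm : Measurable fun z : E3 => ‖⟪v, z⟫‖ₑ := by fun_prop
  have h1 : ENNReal.ofReal (κ / 2 * ‖v‖) * volume (Metric.ball e (κ / 2)) ≤
      (∫⁻ z in Metric.ball e (κ / 2), ‖⟪v, z⟫‖ₑ) + ∫⁻ z in Metric.ball e (κ / 2), ‖⟪v, z + b⟫‖ₑ := by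
    rw [← lintegral_add_left hm, ← setLIntegral_const]
    refine lintegral_mono fun z => ?_
    have : ENNReal.ofReal (κ / 2 * ‖v‖) = ‖⟪v, z + b⟫ - ⟪v, z⟫‖ₑ := by
      rw [inner_add_right, add_sub_cancel_left, hvb, Real.enorm_eq_ofReal (by positivity)]
    rw [this]
    exact enorm_sub_le.trans_eq (add_comm _ _)
  have h2 : ∫⁻ z in Metric.ball e (κ / 2), ‖⟪v, z⟫‖ₑ ≤ ∫⁻ z in Metric.closedBall e κ, ‖⟪v, z⟫‖ₑ :=
    lintegral_mono_set hsub
  have h3 : ∫⁻ z in Metric.ball e (κ / 2), ‖⟪v, z + b⟫‖ₑ ≤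
      ∫⁻ z in Metric.closedBall e κ, ‖⟪v, z⟫‖ₑ := by
    rw [← lintegral_indicator measurableSet_ball, ← lintegral_indicator measurableSet_closedBall,
      ← lintegral_add_right_eq_self ((Metric.closedBall e κ).indicator fun z => ‖⟪v, z⟫‖ₑ) b]
    refine lintegral_mono fun z => ?_
    by_cases hz : z ∈ Metric.ball e (κ / 2)
    · have hz' : z + b ∈ Metric.closedBall e κ := by
        rw [Metric.mem_ball, dist_eq_norm] at hz
        rw [Metric.mem_closedBall, dist_eq_norm, add_sub_right_comm]
        exact (norm_add_le _ _).trans (by rw [hbn]; linarith)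
      rw [indicator_of_mem hz, indicator_of_mem hz']
    · rw [indicator_of_notMem hz]
      exact zero_le
  have h4 := h1.trans (add_le_add h2 h3)
  rw [← two_mul] at h4
  have e1 : ENNReal.ofReal (κ / 2 * ‖v‖) = 2 * (ENNReal.ofReal (κ / 4) * ‖v‖ₑ) := by
    rw [← ofReal_norm v, ← ENNReal.ofReal_mul (by positivity),
      show κ / 2 * ‖v‖ = 2 * (κ / 4 * ‖v‖) by ring, ENNReal.ofReal_mul (by norm_num)]
    simp
  rw [e1, mul_assoc, ENNReal.mul_le_mul_iff_right (by simp) (by simp)] at h4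
  calc _ = ENNReal.ofReal (κ / 4) * ‖v‖ₑ * volume (Metric.ball e (κ / 2)) := by ring
    _ ≤ _ := h4

/-! ### Averages over cones -/

lemma sq_lintegral_le {α : Type*} {m : MeasurableSpace α} (μ : Measure α) {g : α → ℝ≥0∞}
    (hg : AEMeasurable g μ) : (∫⁻ x, g x ∂μ) ^ (2 : ℝ) ≤ μ univ * ∫⁻ x, g x ^ (2 : ℝ) ∂μ := by
  have h := ENNReal.lintegral_mul_le_Lp_mul_Lq μ Real.HolderConjugate.two_two hg
    (aemeasurable_const (b := (1 : ℝ≥0∞)))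
  simp only [Pi.mul_apply, mul_one, ENNReal.one_rpow, lintegral_const, one_mul] at h
  calc (∫⁻ x, g x ∂μ) ^ (2 : ℝ)
      ≤ ((∫⁻ x, g x ^ (2 : ℝ) ∂μ) ^ (1 / 2 : ℝ) * μ univ ^ (1 / 2 : ℝ)) ^ (2 : ℝ) :=
        ENNReal.rpow_le_rpow h (by norm_num)
    _ = _ := by
        rw [ENNReal.mul_rpow_of_nonneg _ _ (by norm_num), ← ENNReal.rpow_mul, ← ENNReal.rpow_mul]
        norm_num
        rw [mul_comm]

lemma lintegral_comp_add_smul {G : E3 → ℝ≥0∞} (hG : Measurable G) (x : E3) {τ : ℝ} (hτ : 0 < τ) :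
    ∫⁻ z, G (x + τ • z) = ENNReal.ofReal τ ^ (-3 : ℝ) * ∫⁻ y, G y := by
  have h1 : ∫⁻ z, G (x + τ • z) = ∫⁻ y, G (x + y) ∂(Measure.map (fun z : E3 => τ • z) volume) := by
    rw [lintegral_map (by fun_prop) (by fun_prop)]
  rw [h1, Measure.map_addHaar_smul _ hτ.ne', lintegral_smul_measure,
    lintegral_add_left_eq_self G x, smul_eq_mul]
  congr 1
  rw [finrank_euclideanSpace_fin, ENNReal.ofReal_rpow_of_pos hτ,
    abs_of_pos (inv_pos.2 (pow_pos hτ 3))]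
  congr 1
  rw [Real.rpow_neg hτ.le]
  norm_cast

/-- The integral of `g` over the ball `B` of directions, seen from `x` at scale `τ`. -/
def coneAvg (B : Set E3) (τ : ℝ) (g : E3 → ℝ≥0∞) (x : E3) : ℝ≥0∞ := ∫⁻ z in B, g (x + τ • z)

lemma measurable_coneAvg {B : Set E3} {g : E3 → ℝ≥0∞} (hg : Measurable g) (δ : ℝ) :
    Measurable fun q : E3 × ℝ => coneAvg B (q.2 * δ) g q.1 := by
  have : Measurable fun q : (E3 × ℝ) × E3 => g (q.1.1 + (q.1.2 * δ) • q.2) :=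
    hg.comp (Continuous.measurable (by fun_prop))
  exact this.lintegral_prod_right'

/-- Interpolation between two bounds for the square of the average: a pointwise one of order `τ ^
(-3)`, from Cauchy-Schwarz and rescaling, and an integral one uniform in `τ`, from translation
invariance. The pointwise bound is spent on the excess power `p - 2`. -/
lemma lintegral_coneAvg_rpow_le {B : Set E3} {g : E3 → ℝ≥0∞} (hg : Measurable g) {p τ : ℝ}
    (hp : 2 ≤ p) (hτ : 0 < τ) :
    ∫⁻ x, coneAvg B τ g x ^ p ≤ volume B ^ ((p - 2) / 2 + 2) *
      ENNReal.ofReal τ ^ (-(3 * (p - 2) / 2)) * (∫⁻ x, g x ^ (2 : ℝ)) ^ (p / 2) := by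
  set N := ∫⁻ x, g x ^ (2 : ℝ) with hN
  have hq : 0 ≤ (p - 2) / 2 := by linarith
  have hg2 : Measurable fun x => g x ^ (2 : ℝ) := hg.pow_const _
  have hsq : ∀ x, coneAvg B τ g x ^ (2 : ℝ) ≤ volume B * ∫⁻ z in B, g (x + τ • z) ^ (2 : ℝ) := by
    intro x
    have := sq_lintegral_le (volume.restrict B) (g := fun z => g (x + τ • z))
      (hg.comp (by fun_prop)).aemeasurable
    rwa [Measure.restrict_apply_univ] at this
  have hsup : ∀ x, coneAvg B τ g x ^ (2 : ℝ) ≤ volume B * (ENNReal.ofReal τ ^ (-3 : ℝ) * N) := by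
    intro x
    refine (hsq x).trans (mul_le_mul_right ?_ _)
    rw [← lintegral_comp_add_smul hg2 x hτ]
    exact setLIntegral_le_lintegral _ _
  have hL2 : ∫⁻ x, coneAvg B τ g x ^ (2 : ℝ) ≤ volume B * (volume B * N) := by
    have hm : Measurable fun q : E3 × E3 => g (q.1 + τ • q.2) ^ (2 : ℝ) :=
      hg2.comp (Continuous.measurable (by fun_prop))
    calc ∫⁻ x, coneAvg B τ g x ^ (2 : ℝ)
        ≤ ∫⁻ x, volume B * ∫⁻ z in B, g (x + τ • z) ^ (2 : ℝ) := lintegral_mono hsq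
      _ = volume B * ∫⁻ x, ∫⁻ z in B, g (x + τ • z) ^ (2 : ℝ) :=
        lintegral_const_mul _ hm.lintegral_prod_right'
      _ = volume B * ∫⁻ z in B, ∫⁻ x, g (x + τ • z) ^ (2 : ℝ) := by
        rw [lintegral_lintegral_swap hm.aemeasurable]
      _ = volume B * (volume B * N) := by
        congr 1
        have : ∀ z, ∫⁻ x, g (x + τ • z) ^ (2 : ℝ) = N := fun z =>
          lintegral_add_right_eq_self (fun x => g x ^ (2 : ℝ)) (τ • z)
        simp only [this, setLIntegral_const]
        rw [mul_comm]
  calc ∫⁻ x, coneAvg B τ g x ^ p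
      = ∫⁻ x, (coneAvg B τ g x ^ (2 : ℝ)) ^ ((p - 2) / 2) * coneAvg B τ g x ^ (2 : ℝ) := by
        refine lintegral_congr fun x => ?_
        rw [← ENNReal.rpow_mul, ← ENNReal.rpow_add_of_nonneg _ _ (by linarith) (by norm_num)]
        congr 1
        ring
    _ ≤ ∫⁻ x, (volume B * (ENNReal.ofReal τ ^ (-3 : ℝ) * N)) ^ ((p - 2) / 2) *
          coneAvg B τ g x ^ (2 : ℝ) :=
        lintegral_mono fun x => mul_le_mul_left (ENNReal.rpow_le_rpow (hsup x) hq) _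
    _ = (volume B * (ENNReal.ofReal τ ^ (-3 : ℝ) * N)) ^ ((p - 2) / 2) *
          ∫⁻ x, coneAvg B τ g x ^ (2 : ℝ) := by
        refine lintegral_const_mul _ (Measurable.pow_const ?_ _)
        have := (measurable_coneAvg (B := B) hg 1).comp
          (measurable_id.prodMk (measurable_const (a := τ)))
        simpa [Function.comp_def] using this
    _ ≤ (volume B * (ENNReal.ofReal τ ^ (-3 : ℝ) * N)) ^ ((p - 2) / 2) *
          (volume B * (volume B * N)) := mul_le_mul_right hL2 _
    _ = _ := by
        rw [ENNReal.mul_rpow_of_nonneg _ _ hq, ENNReal.mul_rpow_of_nonneg _ _ hq,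
          ← ENNReal.rpow_mul, ENNReal.rpow_add_of_nonneg _ _ hq (by norm_num : (0 : ℝ) ≤ 2),
          show p / 2 = (p - 2) / 2 + 1 by ring, ENNReal.rpow_add_of_nonneg _ _ hq zero_le_one,
          ENNReal.rpow_one, show -3 * ((p - 2) / 2) = -(3 * (p - 2) / 2) by ring,
          ENNReal.rpow_two]
        ring

lemma lintegral_Ioo_rpow_lt_top {s : ℝ} (hs : -1 < s) :
    ∫⁻ θ in Ioo (0 : ℝ) 1, ENNReal.ofReal θ ^ s < ⊤ := by
  have h1 : IntegrableOn (fun θ : ℝ => θ ^ s) (Ioo 0 1) := by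
    have := intervalIntegral.intervalIntegrable_rpow' (a := 0) (b := 1) hs
    rw [intervalIntegrable_iff_integrableOn_Ioo_of_le zero_le_one] at this
    exact this
  have h2 := h1.2
  rw [hasFiniteIntegral_iff_enorm] at h2
  refine lt_of_le_of_lt (le_of_eq ?_) h2
  refine setLIntegral_congr_fun measurableSet_Ioo fun θ hθ => ?_
  rw [ENNReal.ofReal_rpow_of_pos hθ.1, Real.enorm_eq_ofReal (Real.rpow_nonneg hθ.1.le _)]

/-- Hölder's inequality after splitting off `θ ^ (m / p)`; the free weight shares the singularity at
the vertex of the cone between the two factors. -/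
lemma rpow_lintegral_Ioo_le {p m : ℝ} (hp : 1 < p) (F : ℝ → ℝ≥0∞) (hF : Measurable F) :
    (∫⁻ θ in Ioo (0 : ℝ) 1, F θ) ^ p ≤
      (∫⁻ θ in Ioo (0 : ℝ) 1, ENNReal.ofReal θ ^ (-(m / (p - 1)))) ^ (p - 1) *
        ∫⁻ θ in Ioo (0 : ℝ) 1, ENNReal.ofReal θ ^ m * F θ ^ p := by
  have hp0 : 0 < p := by linarith
  have hp1 : 0 < p - 1 := by linarith
  have hpq : p.conjExponent.HolderConjugate p := (Real.HolderConjugate.conjExponent hp).symm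
  have hq : p.conjExponent = p / (p - 1) := rfl
  have h := ENNReal.lintegral_mul_le_Lp_mul_Lq (volume.restrict (Ioo (0 : ℝ) 1)) hpq
    (f := fun θ => ENNReal.ofReal θ ^ (-(m / p))) (g := fun θ => ENNReal.ofReal θ ^ (m / p) * F θ)
    (by fun_prop) (by fun_prop)
  have e1 : ∫⁻ θ in Ioo (0 : ℝ) 1, ((fun θ => ENNReal.ofReal θ ^ (-(m / p))) *
      fun θ => ENNReal.ofReal θ ^ (m / p) * F θ) θ = ∫⁻ θ in Ioo (0 : ℝ) 1, F θ := by
    refine setLIntegral_congr_fun measurableSet_Ioo fun θ hθ => ?_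
    simp only [Pi.mul_apply]
    rw [← mul_assoc, ← ENNReal.rpow_add _ _ (by simpa using hθ.1) ENNReal.ofReal_ne_top]
    simp
  have e2 : ∫⁻ θ in Ioo (0 : ℝ) 1, (ENNReal.ofReal θ ^ (-(m / p))) ^ p.conjExponent =
      ∫⁻ θ in Ioo (0 : ℝ) 1, ENNReal.ofReal θ ^ (-(m / (p - 1))) := by
    refine lintegral_congr fun θ => ?_
    rw [← ENNReal.rpow_mul, hq]
    congr 1
    field_simp
  have e3 : ∫⁻ θ in Ioo (0 : ℝ) 1, (ENNReal.ofReal θ ^ (m / p) * F θ) ^ p =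
      ∫⁻ θ in Ioo (0 : ℝ) 1, ENNReal.ofReal θ ^ m * F θ ^ p := by
    refine lintegral_congr fun θ => ?_
    rw [ENNReal.mul_rpow_of_nonneg _ _ hp0.le, ← ENNReal.rpow_mul, div_mul_cancel₀ _ hp0.ne']
  rw [e1, e2, e3] at h
  refine (ENNReal.rpow_le_rpow h hp0.le).trans_eq ?_
  rw [ENNReal.mul_rpow_of_nonneg _ _ hp0.le, ← ENNReal.rpow_mul, ← ENNReal.rpow_mul, hq]
  congr 2
  · field_simp
  · rw [one_div, inv_mul_cancel₀ hp0.ne', ENNReal.rpow_one]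

/-- Averages of `g` over a truncated cone, weighted by the inverse square of the distance to the
vertex, are bounded from `L²` to `L^p`, `2 < p < 6`. -/
lemma exists_lintegral_cone_potential_le {p : ℝ} (hp2 : 2 < p) (hp6 : p < 6) {B : Set E3}
    (hB : volume B ≠ ⊤) : ∃ C : ℝ≥0∞, C ≠ ⊤ ∧ ∀ (δ : ℝ), 0 < δ → ∀ g : E3 → ℝ≥0∞, Measurable g →
      ∫⁻ x, (∫⁻ θ in Ioo (0 : ℝ) 1, coneAvg B (θ * δ) g x) ^ p ≤
        C * ENNReal.ofReal δ ^ (-(3 * (p - 2) / 2)) * (∫⁻ x, g x ^ (2 : ℝ)) ^ (p / 2) := by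
  -- Integrability of the two powers of `θ` requires `3 * (p - 2) / 2 - 1 < m` and `m < p - 1`. This
  -- interval is nonempty exactly for `p < 6`, and `m` is its midpoint.
  set m : ℝ := 5 * p / 4 - 5 / 2 with hm
  set C1 := (∫⁻ θ in Ioo (0 : ℝ) 1, ENNReal.ofReal θ ^ (-(m / (p - 1)))) ^ (p - 1)
  set C2 := ∫⁻ θ in Ioo (0 : ℝ) 1, ENNReal.ofReal θ ^ (m - 3 * (p - 2) / 2)
  have hC1 : C1 ≠ ⊤ := by
    refine ENNReal.rpow_ne_top_of_nonneg (by linarith) (lintegral_Ioo_rpow_lt_top ?_).ne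
    rw [neg_lt_neg_iff, div_lt_one (by linarith)]
    linarith
  have hC2 : C2 ≠ ⊤ := (lintegral_Ioo_rpow_lt_top (by linarith)).ne
  refine ⟨C1 * (volume B ^ ((p - 2) / 2 + 2) * C2), ?_, fun δ hδ g hg => ?_⟩
  · exact ENNReal.mul_ne_top hC1 (ENNReal.mul_ne_top
      (ENNReal.rpow_ne_top_of_nonneg (by linarith) hB) hC2)
  set N := ∫⁻ x, g x ^ (2 : ℝ)
  have hmeas := measurable_coneAvg (B := B) hg δ
  have hmeas2 : Measurable fun q : E3 × ℝ =>
      ENNReal.ofReal q.2 ^ m * coneAvg B (q.2 * δ) g q.1 ^ p :=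
    ((ENNReal.measurable_ofReal.comp measurable_snd).pow_const _).mul (hmeas.pow_const _)
  calc ∫⁻ x, (∫⁻ θ in Ioo (0 : ℝ) 1, coneAvg B (θ * δ) g x) ^ p
      ≤ ∫⁻ x, C1 * ∫⁻ θ in Ioo (0 : ℝ) 1, ENNReal.ofReal θ ^ m * coneAvg B (θ * δ) g x ^ p :=
        lintegral_mono fun x => rpow_lintegral_Ioo_le (by linarith) _
          (hmeas.comp (measurable_const.prodMk measurable_id))
    _ = C1 * ∫⁻ x, ∫⁻ θ in Ioo (0 : ℝ) 1, ENNReal.ofReal θ ^ m * coneAvg B (θ * δ) g x ^ p :=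
        lintegral_const_mul _ hmeas2.lintegral_prod_right'
    _ = C1 * ∫⁻ θ in Ioo (0 : ℝ) 1, ∫⁻ x, ENNReal.ofReal θ ^ m * coneAvg B (θ * δ) g x ^ p := by
        rw [lintegral_lintegral_swap hmeas2.aemeasurable]
    _ ≤ C1 * ∫⁻ θ in Ioo (0 : ℝ) 1, ENNReal.ofReal θ ^ (m - 3 * (p - 2) / 2) *
          (volume B ^ ((p - 2) / 2 + 2) * ENNReal.ofReal δ ^ (-(3 * (p - 2) / 2)) * N ^ (p / 2)) := by
        refine mul_le_mul_right ?_ _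
        refine setLIntegral_mono' measurableSet_Ioo fun θ hθ => ?_
        have hm1 : Measurable fun x => coneAvg B (θ * δ) g x ^ p :=
          (hmeas.comp (measurable_id.prodMk (measurable_const (a := θ)))).pow_const _
        rw [lintegral_const_mul _ hm1]
        refine (mul_le_mul_right (lintegral_coneAvg_rpow_le hg hp2.le (mul_pos hθ.1 hδ)) _).trans_eq ?_
        rw [ENNReal.ofReal_mul hθ.1.le, ENNReal.mul_rpow_of_ne_top ENNReal.ofReal_ne_top
          ENNReal.ofReal_ne_top, sub_eq_add_neg m,
          ENNReal.rpow_add _ _ (by simpa using hθ.1) ENNReal.ofReal_ne_top]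
        ring
    _ = _ := by
        rw [lintegral_mul_const _ (by fun_prop)]
        ring

/-! ### A Korn-Sobolev inequality on Lipschitz domains -/

/-- The closed cone of length `δ₀` with vertex `x` and directions in `closedBall e κ` lies in `Ω`,
up to its vertex. -/
def HasInnerCone (Ω : Set E3) (x e : E3) (κ δ₀ : ℝ) : Prop :=
  ∀ z ∈ Metric.closedBall e κ, ∀ t, 0 < t → t ≤ δ₀ → x + t • z ∈ Ω

/-- The segment estimate integrated over the directions of the cone, which together detect the whole
vector `w x`. Since the segments run inside `Ω`, indicators may be inserted, and afterwards the
averages make sense on all of `ℝ³`. -/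
lemma enorm_le_of_hasInnerCone {Ω : Set E3} (hΩ : IsOpen Ω) {x e : E3} {κ δ : ℝ} (hκ : 0 < κ)
    (hκ1 : κ ≤ 1) (he : ‖e‖ ≤ 1) (hδ : 0 < δ) (hc : HasInnerCone Ω x e κ δ) {w : E3 → E3}
    {K : ℝ≥0} (hw : LipschitzWith K w) :
    ENNReal.ofReal (κ / 4) * volume (Metric.ball e (κ / 2)) * ‖w x‖ₑ ≤
      2 * coneAvg (Metric.closedBall e κ) δ (Ω.indicator fun y => ‖w y‖ₑ) x +
      4 * ENNReal.ofReal δ * ∫⁻ θ in Ioo (0 : ℝ) 1, coneAvg (Metric.closedBall e κ) (θ * δ)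
        (Ω.indicator fun y => ‖symPart (grad w y)‖ₑ) x := by
  have hms : Measurable fun y => ‖symPart (grad w y)‖ₑ :=
    (symPartL.continuous.measurable.comp (measurable_grad w)).enorm
  have hwm : Measurable fun y => ‖w y‖ₑ := hw.continuous.measurable.enorm
  have hmi := hms.indicator hΩ.measurableSet
  refine (enorm_le_lintegral_inner (w x) e hκ).trans ?_
  have h1 : ∀ᵐ z : E3, z ∈ Metric.closedBall e κ → ‖⟪w x, z⟫‖ₑ ≤
      2 * Ω.indicator (fun y => ‖w y‖ₑ) (x + δ • z) + 4 * ENNReal.ofReal δ *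
        ∫⁻ θ in Ioo (0 : ℝ) 1, Ω.indicator (fun y => ‖symPart (grad w y)‖ₑ) (x + (θ * δ) • z) := by
    have hZ : volume {y | ¬ DifferentiableAt ℝ w y} = 0 := hw.ae_differentiableAt
    filter_upwards [ae_ae_notMem_of_null hZ x hδ] with z hz hzB
    have hz2 : ‖z‖ ≤ 2 := by
      have := norm_le_norm_add_norm_sub e z
      rw [Metric.mem_closedBall, dist_eq_norm, norm_sub_rev] at hzB
      linarith
    have h2 := enorm_inner_le_of_segment hw (x := x) hδ hz2 (by
      filter_upwards [hz] with θ hθ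
      simpa using hθ)
    refine h2.trans (le_of_eq ?_)
    rw [indicator_of_mem (hc z hzB δ hδ le_rfl)]
    congr 2
    refine setLIntegral_congr_fun measurableSet_Ioo fun θ hθ => ?_
    rw [indicator_of_mem (hc z hzB (θ * δ) (mul_pos hθ.1 hδ) (by nlinarith [hθ.2]))]
  refine (setLIntegral_mono_ae' measurableSet_closedBall h1).trans (le_of_eq ?_)
  have hm2 : Measurable fun q : E3 × ℝ =>
      Ω.indicator (fun y => ‖symPart (grad w y)‖ₑ) (x + (q.2 * δ) • q.1) :=
    hmi.comp (Continuous.measurable (by fun_prop))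
  have hm1 : Measurable fun z : E3 => Ω.indicator (fun y => ‖w y‖ₑ) (x + δ • z) :=
    (hwm.indicator hΩ.measurableSet).comp (Continuous.measurable (by fun_prop))
  rw [lintegral_add_left (hm1.const_mul 2), lintegral_const_mul _ hm1,
    lintegral_const_mul _ hm2.lintegral_prod_right',
    lintegral_lintegral_swap hm2.aemeasurable]
  rfl

lemma add_rpow_le_two_rpow_mul {p : ℝ} (hp : 0 ≤ p) (a b : ℝ≥0∞) :
    (a + b) ^ p ≤ 2 ^ p * (a ^ p + b ^ p) := by
  have h1 : a + b ≤ 2 * max a b := by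
    rw [two_mul]
    exact add_le_add (le_max_left _ _) (le_max_right _ _)
  refine (ENNReal.rpow_le_rpow h1 hp).trans ?_
  rw [ENNReal.mul_rpow_of_nonneg _ _ hp]
  refine mul_le_mul_right ?_ _
  rcases le_total a b with h | h
  · rw [max_eq_right h]
    exact le_add_self
  · rw [max_eq_left h]
    exact le_self_add

/-- The assertion of the Korn-Sobolev inequality on the part of `Ω` in `s`. -/
def KornSobolevOn (Ω : Set E3) (p : ℝ) (s : Set E3) : Prop :=
  ∃ C : ℝ≥0∞, C ≠ ⊤ ∧ ∃ δ₀ : ℝ, 0 < δ₀ ∧ ∀ δ : ℝ, 0 < δ → δ ≤ δ₀ → ∀ (w : E3 → E3) (K : ℝ≥0),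
    LipschitzWith K w → ∫⁻ x in Ω ∩ s, ‖w x‖ₑ ^ p ≤
      C * ENNReal.ofReal δ ^ (-(3 * (p - 2) / 2)) * ((∫⁻ x in Ω, ‖w x‖ₑ ^ (2 : ℝ)) ^ (p / 2) +
        ENNReal.ofReal δ ^ p * (∫⁻ x in Ω, ‖symPart (grad w x)‖ₑ ^ (2 : ℝ)) ^ (p / 2))

/-- The same cone of directions is available at all points of `Ω ∩ s`, so the pointwise estimate can
be raised to the power `p` and integrated, using the `L²` to `L^p` bounds for cone averages on `ℝ³`.
-/
lemma kornSobolevOn_of_hasInnerCone {Ω : Set E3} (hΩ : IsOpen Ω) {p : ℝ} (hp2 : 2 < p)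
    (hp6 : p < 6) {s : Set E3} (hs : MeasurableSet s) {e : E3} {κ δ₀ : ℝ} (hκ : 0 < κ)
    (hκ1 : κ ≤ 1) (he : ‖e‖ ≤ 1) (hδ₀ : 0 < δ₀) (hc : ∀ x ∈ Ω ∩ s, HasInnerCone Ω x e κ δ₀) :
    KornSobolevOn Ω p s := by
  have hp0 : 0 ≤ p := by linarith
  set B := Metric.closedBall e κ with hB
  have hBt : volume B ≠ ⊤ := measure_closedBall_lt_top.ne
  obtain ⟨C0, hC0, hpot⟩ := exists_lintegral_cone_potential_le hp2 hp6 hBt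
  set c := ENNReal.ofReal (κ / 4) * volume (Metric.ball e (κ / 2)) with hcdef
  have hc0 : c ≠ 0 := mul_ne_zero (by simpa using hκ) (Metric.measure_ball_pos _ _ (by linarith)).ne'
  have hct : c ≠ ⊤ := ENNReal.mul_ne_top ENNReal.ofReal_ne_top measure_ball_lt_top.ne
  have hcp0 : c ^ p ≠ 0 := by
    rw [Ne, ENNReal.rpow_eq_zero_iff]
    rintro (h | h)
    · exact hc0 h.1
    · exact hct h.1
  have hcpt : c ^ p ≠ ⊤ := ENNReal.rpow_ne_top_of_nonneg hp0 hct
  set D : ℝ≥0∞ := volume B ^ ((p - 2) / 2 + 2) with hD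
  have hDt : D ≠ ⊤ := ENNReal.rpow_ne_top_of_nonneg (by linarith) hBt
  refine ⟨(c ^ p)⁻¹ * (2 ^ p * (2 ^ p * D + 4 ^ p * C0)), ?_, δ₀, hδ₀,
    fun δ hδ hδ' w K hw => ?_⟩
  · refine ENNReal.mul_ne_top (ENNReal.inv_ne_top.2 hcp0) (ENNReal.mul_ne_top
      (ENNReal.rpow_ne_top_of_nonneg hp0 (by simp)) (ENNReal.add_ne_top.2 ⟨?_, ?_⟩))
    · exact ENNReal.mul_ne_top (ENNReal.rpow_ne_top_of_nonneg hp0 (by simp)) hDt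
    · exact ENNReal.mul_ne_top (ENNReal.rpow_ne_top_of_nonneg hp0 (by simp)) hC0
  have hms : Measurable fun y => ‖symPart (grad w y)‖ₑ :=
    (symPartL.continuous.measurable.comp (measurable_grad w)).enorm
  have hwm : Measurable fun y => ‖w y‖ₑ := hw.continuous.measurable.enorm
  set g1 := Ω.indicator fun y => ‖w y‖ₑ with hg1
  set g2 := Ω.indicator fun y => ‖symPart (grad w y)‖ₑ with hg2
  have hm1 : Measurable g1 := hwm.indicator hΩ.measurableSet
  have hm2 : Measurable g2 := hms.indicator hΩ.measurableSet
  have hN : ∀ f : E3 → ℝ≥0∞, ∫⁻ x, Ω.indicator f x ^ (2 : ℝ) = ∫⁻ x in Ω, f x ^ (2 : ℝ) := by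
    intro f
    rw [← lintegral_indicator hΩ.measurableSet]
    refine lintegral_congr fun x => ?_
    by_cases hx : x ∈ Ω
    · simp [hx]
    · simp [hx]
  have hI1 := lintegral_coneAvg_rpow_le (B := B) hm1 hp2.le hδ
  have hI2 := hpot δ hδ g2 hm2
  rw [hg1, hN, ← hg1] at hI1
  rw [hg2, hN, ← hg2] at hI2
  set N1 := (∫⁻ x in Ω, ‖w x‖ₑ ^ (2 : ℝ)) ^ (p / 2)
  set N2 := (∫⁻ x in Ω, ‖symPart (grad w x)‖ₑ ^ (2 : ℝ)) ^ (p / 2)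
  set A := ENNReal.ofReal δ ^ (-(3 * (p - 2) / 2))
  set P : E3 → ℝ≥0∞ := fun x => ∫⁻ θ in Ioo (0 : ℝ) 1, coneAvg B (θ * δ) g2 x
  have hmA : Measurable fun x => coneAvg B δ g1 x := by
    have := (measurable_coneAvg (B := B) hm1 1).comp
      (measurable_id.prodMk (measurable_const (a := δ)))
    simpa [Function.comp_def] using this
  have hmP : Measurable P := (measurable_coneAvg (B := B) hm2 δ).lintegral_prod_right'
  have key : c ^ p * ∫⁻ x in Ω ∩ s, ‖w x‖ₑ ^ p ≤
      2 ^ p * (2 ^ p * (D * A * N1) + (4 * ENNReal.ofReal δ) ^ p * (C0 * A * N2)) := by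
    calc c ^ p * ∫⁻ x in Ω ∩ s, ‖w x‖ₑ ^ p = ∫⁻ x in Ω ∩ s, (c * ‖w x‖ₑ) ^ p := by
          rw [← lintegral_const_mul _ (hwm.pow_const _)]
          simp_rw [ENNReal.mul_rpow_of_nonneg _ _ hp0]
      _ ≤ ∫⁻ x in Ω ∩ s, (2 * coneAvg B δ g1 x + 4 * ENNReal.ofReal δ * P x) ^ p := by
          refine setLIntegral_mono' (hΩ.measurableSet.inter hs) fun x hx => ?_
          refine ENNReal.rpow_le_rpow ?_ hp0
          exact enorm_le_of_hasInnerCone hΩ hκ hκ1 he hδ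
            (fun z hz t ht htδ => hc x hx z hz t ht (htδ.trans hδ')) hw
      _ ≤ ∫⁻ x, (2 * coneAvg B δ g1 x + 4 * ENNReal.ofReal δ * P x) ^ p :=
          setLIntegral_le_lintegral _ _
      _ ≤ ∫⁻ x, 2 ^ p * (2 ^ p * coneAvg B δ g1 x ^ p + (4 * ENNReal.ofReal δ) ^ p * P x ^ p) := by
          refine lintegral_mono fun x => (add_rpow_le_two_rpow_mul hp0 _ _).trans_eq ?_
          rw [ENNReal.mul_rpow_of_nonneg _ _ hp0, ENNReal.mul_rpow_of_nonneg _ (P x) hp0]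
      _ = 2 ^ p * (2 ^ p * ∫⁻ x, coneAvg B δ g1 x ^ p) +
            2 ^ p * ((4 * ENNReal.ofReal δ) ^ p * ∫⁻ x, P x ^ p) := by
          have hsum : Measurable fun x =>
              2 ^ p * coneAvg B δ g1 x ^ p + (4 * ENNReal.ofReal δ) ^ p * P x ^ p :=
            ((hmA.pow_const _).const_mul _).add ((hmP.pow_const _).const_mul _)
          rw [lintegral_const_mul _ hsum, lintegral_add_left ((hmA.pow_const _).const_mul _),
            lintegral_const_mul _ (hmA.pow_const _), lintegral_const_mul _ (hmP.pow_const _), mul_add]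
      _ ≤ _ := by
          rw [← mul_add]
          gcongr
  calc ∫⁻ x in Ω ∩ s, ‖w x‖ₑ ^ p = (c ^ p)⁻¹ * (c ^ p * ∫⁻ x in Ω ∩ s, ‖w x‖ₑ ^ p) := by
        rw [← mul_assoc, ENNReal.inv_mul_cancel hcp0 hcpt, one_mul]
    _ ≤ (c ^ p)⁻¹ *
        (2 ^ p * (2 ^ p * (D * A * N1) + (4 * ENNReal.ofReal δ) ^ p * (C0 * A * N2))) :=
        mul_le_mul_right key _
    _ ≤ (c ^ p)⁻¹ * (2 ^ p * (2 ^ p * D + 4 ^ p * C0)) * A * (N1 + ENNReal.ofReal δ ^ p * N2) := by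
        rw [ENNReal.mul_rpow_of_nonneg 4 _ hp0]
        set Δ := ENNReal.ofReal δ ^ p
        rw [mul_assoc (c ^ p)⁻¹, mul_assoc (c ^ p)⁻¹, mul_assoc (2 ^ p), mul_assoc (2 ^ p)]
        refine mul_le_mul_right (mul_le_mul_right ?_ _) _
        calc 2 ^ p * (D * A * N1) + 4 ^ p * Δ * (C0 * A * N2)
            ≤ (2 ^ p * (D * A * N1) + 4 ^ p * Δ * (C0 * A * N2)) +
              (2 ^ p * D * A * (Δ * N2) + 4 ^ p * C0 * A * N1) := le_self_add
          _ = _ := by ring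

lemma HasInnerCone.of_ball_subset {Ω : Set E3} {x : E3} {ρ : ℝ}
    (h : Metric.ball x ρ ⊆ Ω) {y : E3} (hy : y ∈ Metric.ball x (ρ / 2)) :
    HasInnerCone Ω y 0 1 (ρ / 4) := by
  intro z hz t ht htρ
  refine h ?_
  rw [mem_closedBall_zero_iff] at hz
  rw [Metric.mem_ball, dist_eq_norm] at hy ⊢
  rw [add_sub_right_comm]
  refine (norm_add_le _ _).trans_lt ?_
  rw [norm_smul, Real.norm_of_nonneg ht.le]
  nlinarith [norm_nonneg z]

/-- By compactness of the closure a local statement suffices: constants add and admissible scales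
shrink under finite unions. Near an interior point every direction is allowed (centre `0`, radius
`1`); near a boundary point the cone around the chart axis has aperture `(1 + K)⁻¹`. -/
theorem exists_kornSobolevOn_univ {Ω : Set E3} (hΩ : IsBoundedLipschitzDomain Ω) {p : ℝ}
    (hp2 : 2 < p) (hp6 : p < 6) : KornSobolevOn Ω p (closure Ω) := by
  refine hΩ.isBounded.isCompact_closure.induction_on (p := KornSobolevOn Ω p) ?_ ?_ ?_ ?_
  · exact ⟨0, by simp, 1, one_pos, fun δ _ _ w K _ => by simp⟩
  · rintro s t hst ⟨C, hC, δ₀, hδ₀, h⟩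
    refine ⟨C, hC, δ₀, hδ₀, fun δ h1 h2 w K hw => le_trans ?_ (h δ h1 h2 w K hw)⟩
    exact lintegral_mono_set (inter_subset_inter_right _ hst)
  · rintro s t ⟨C, hC, δ₀, hδ₀, h⟩ ⟨C', hC', δ₀', hδ₀', h'⟩
    refine ⟨C + C', ENNReal.add_ne_top.2 ⟨hC, hC'⟩, min δ₀ δ₀', lt_min hδ₀ hδ₀',
      fun δ h1 h2 w K hw => ?_⟩
    rw [inter_union_distrib_left]
    refine (lintegral_union_le _ _ _).trans ?_
    rw [add_mul, add_mul]
    exact add_le_add (h δ h1 (h2.trans (min_le_left _ _)) w K hw)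
      (h' δ h1 (h2.trans (min_le_right _ _)) w K hw)
  · intro x hx
    by_cases hxΩ : x ∈ Ω
    · obtain ⟨ρ, hρ, hball⟩ := Metric.isOpen_iff.1 hΩ.isOpen x hxΩ
      refine ⟨Metric.ball x (ρ / 2), mem_nhdsWithin_of_mem_nhds
        (Metric.ball_mem_nhds x (by linarith)), ?_⟩
      exact kornSobolevOn_of_hasInnerCone hΩ.isOpen hp2 hp6 measurableSet_ball one_pos le_rfl
        (by simp) (by linarith : 0 < ρ / 4) fun y hy => HasInnerCone.of_ball_subset hball hy.2
    · have hxf : x ∈ frontier Ω := by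
        rw [hΩ.isOpen.frontier_eq]
        exact ⟨hx, hxΩ⟩
      obtain ⟨L, a, K, ρ, ha, hρ, hch⟩ := hΩ.exists_chart hxf
      refine ⟨Metric.ball x (ρ / 2), mem_nhdsWithin_of_mem_nhds
        (Metric.ball_mem_nhds x (by linarith)), ?_⟩
      have hK : (0 : ℝ) < 1 + K := by positivity
      refine kornSobolevOn_of_hasInnerCone hΩ.isOpen hp2 hp6 measurableSet_ball
        (e := axis L) (κ := (1 + K : ℝ)⁻¹) (δ₀ := ρ / 4) (inv_pos.2 hK)
        (inv_le_one_of_one_le₀ (by simp)) norm_axis.le (by linarith) ?_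
      rintro y ⟨hyΩ, hy⟩ z hz t ht htρ
      have hzn : ‖z‖ ≤ 2 := by
        have h1 : ((1 + K : ℝ)⁻¹) ≤ 1 := inv_le_one_of_one_le₀ (by simp)
        rw [Metric.mem_closedBall, dist_eq_norm, norm_sub_rev] at hz
        have := norm_le_norm_add_norm_sub (axis L) z
        rw [norm_axis] at this
        linarith
      have hyb : y ∈ Metric.ball x ρ := Metric.ball_subset_ball (by linarith) hy
      have hb : y + t • z ∈ Metric.ball x ρ := by
        rw [Metric.mem_ball, dist_eq_norm] at hy ⊢
        rw [add_sub_right_comm]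
        refine (norm_add_le _ _).trans_lt ?_
        rw [norm_smul, Real.norm_of_nonneg ht.le]
        nlinarith [norm_nonneg z]
      rw [hch _ hb]
      rw [Metric.mem_closedBall, dist_eq_norm] at hz
      exact height_pos_of_cone ha ((hch y hyb).1 hyΩ) (mul_inv_cancel₀ hK.ne').le hz ht.le

/-! ### Lipschitz fields with compact support -/

/-- The factor `g` may be unbounded away from the support of `χ`; it is therefore always evaluated
at a point where `χ` does not vanish. -/
lemma exists_lipschitzWith_smul {F : Type*} [NormedAddCommGroup F] [NormedSpace ℝ F] {χ : E3 → ℝ}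
    {g : E3 → F} {K₁ K₂ : ℝ≥0} (hχ : LipschitzWith K₁ χ) (hg : LipschitzWith K₂ g)
    (hc : HasCompactSupport χ) : ∃ K, LipschitzWith K fun x => χ x • g x := by
  obtain ⟨A, hA⟩ := hc.isCompact.exists_bound_of_continuousOn (f := g) hg.continuous.continuousOn
  obtain ⟨B, hB⟩ := hc.exists_bound_of_continuous hχ.continuous
  have hB0 : 0 ≤ B := (norm_nonneg _).trans (hB 0)
  have hA' : ∀ x, χ x ≠ 0 → ‖g x‖ ≤ max A 0 := fun x hx =>
    (hA x (subset_tsupport _ hx)).trans (le_max_left _ _)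
  have hM0 : 0 ≤ max A 0 := le_max_right _ _
  refine ⟨(max A 0).toNNReal * K₁ + B.toNNReal * K₂, LipschitzWith.of_dist_le_mul fun x y => ?_⟩
  rw [NNReal.coe_add, NNReal.coe_mul, NNReal.coe_mul, Real.coe_toNNReal _ hM0,
    Real.coe_toNNReal _ hB0, dist_eq_norm, add_mul, mul_assoc, mul_assoc]
  have h1 := hχ.dist_le_mul x y
  have h2 := hg.dist_le_mul x y
  rw [dist_eq_norm] at h1 h2
  by_cases hx : χ x = 0
  · by_cases hy : χ y = 0
    · rw [hx, hy, zero_smul, zero_smul, sub_zero, norm_zero]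
      positivity
    · have : χ x • g x - χ y • g y = (χ x - χ y) • g y := by
        rw [sub_smul, hx, zero_smul, zero_smul]
      rw [this, norm_smul, mul_comm]
      exact (mul_le_mul (hA' y hy) h1 (norm_nonneg _) hM0).trans
        (le_add_of_nonneg_right (by positivity))
  · have : χ x • g x - χ y • g y = (χ x - χ y) • g x + χ y • (g x - g y) := by
      rw [sub_smul, smul_sub]
      abel
    rw [this]
    refine (norm_add_le _ _).trans (add_le_add ?_ ?_)
    · rw [norm_smul, mul_comm]
      exact mul_le_mul (hA' x hx) h1 (norm_nonneg _) hM0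
    · rw [norm_smul]
      exact mul_le_mul (hB y) h2 (norm_nonneg _) hB0

lemma integrable_of_bound_of_compact {f : E3 → ℝ} {s : Set E3} (hs : IsCompact s) {C : ℝ}
    (hf : AEStronglyMeasurable f) (hC : ∀ᵐ x, ‖f x‖ ≤ C) (h0 : ∀ x, x ∉ s → f x = 0) :
    Integrable f := by
  have h1 : IntegrableOn f s :=
    Measure.integrableOn_of_bounded hs.measure_lt_top.ne hf (ae_restrict_of_ae hC)
  exact (integrableOn_iff_integrable_of_support_subset fun x hx => by
    by_contra h
    exact hx (h0 x h)).1 h1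

lemma grad_congr {v w : E3 → E3} {Ω : Set E3} (hΩ : IsOpen Ω) (h : EqOn v w Ω) {x : E3}
    (hx : x ∈ Ω) : grad v x = grad w x := by
  have : v =ᶠ[𝓝 x] w := h.eventuallyEq_of_mem (hΩ.mem_nhds hx)
  simp only [grad, this.fderiv_eq]

lemma IsAdmissible.congr {Ω : Set E3} (hΩ : IsOpen Ω) {v w : E3 → E3} (hv : IsAdmissible Ω v)
    (h : EqOn v w (closure Ω)) : IsAdmissible Ω w where
  lipschitz := by
    obtain ⟨K, hK⟩ := hv.lipschitz
    refine ⟨K, fun x hx y hy => ?_⟩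
    rw [← h hx, ← h hy]
    exact hK hx hy
  div_eq_zero := by
    filter_upwards [hv.div_eq_zero, ae_restrict_mem hΩ.measurableSet] with x h1 h2
    rw [← h1, divergence, divergence, grad_congr hΩ (h.mono subset_closure) h2]
  tangential := by
    filter_upwards [hv.tangential, ae_restrict_mem isClosed_frontier.measurableSet] with x h1 h2 n hn
    rw [← h (frontier_subset_closure h2)]
    exact h1 n hn

/-- Admissible fields extend to Lipschitz fields on `ℝ³` with compact support. -/
lemma IsAdmissible.exists_extension {Ω : Set E3} (hΩ : IsOpen Ω) (hb : Bornology.IsBounded Ω)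
    {v : E3 → E3} (hv : IsAdmissible Ω v) : ∃ (w : E3 → E3) (K : ℝ≥0), LipschitzWith K w ∧
      HasCompactSupport w ∧ IsAdmissible Ω w ∧ EqOn v w (closure Ω) := by
  obtain ⟨K, hK⟩ := hv.lipschitz
  obtain ⟨g, hg, hvg⟩ := hK.extend_finite_dimension
  obtain ⟨R, hR⟩ := hb.closure.subset_closedBall (0 : E3)
  let χ : ContDiffBump (0 : E3) := ⟨max R 1, max R 1 + 1, by positivity, by linarith⟩
  obtain ⟨Kχ, hKχ⟩ := ContDiff.lipschitzWith_of_hasCompactSupport χ.hasCompactSupport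
    (χ.contDiff (n := 1)) (by simp)
  obtain ⟨K', hK'⟩ := exists_lipschitzWith_smul hKχ hg χ.hasCompactSupport
  have heq : EqOn v (fun x => χ x • g x) (closure Ω) := fun x hx => by
    have : χ x = 1 := χ.one_of_mem_closedBall
      (Metric.closedBall_subset_closedBall (le_max_left _ _) (hR hx))
    simp only [this, one_smul, hvg hx]
  exact ⟨fun x => χ x • g x, K', hK', χ.hasCompactSupport.smul_right, hv.congr hΩ heq, heq⟩

/-! ### Integration by parts for tangential solenoidal fields -/

lemma divergence_eq_sum (u : E3 → E3) (x : E3) :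
    divergence u x = ∑ j, fderiv ℝ u x (EuclideanSpace.single j 1) j := by
  simp [divergence, grad]

lemma fderiv_apply_eq_sum (Φ : E3 → ℝ) (x z : E3) :
    fderiv ℝ Φ x z = ∑ j, fderiv ℝ Φ x (EuclideanSpace.single j 1) * z j := by
  have hz : z = ∑ j, z j • EuclideanSpace.single j (1 : ℝ) := by
    ext k
    simp [Finset.sum_apply, Pi.single_apply]
  conv_lhs => rw [hz]
  simp [map_sum, mul_comm]

lemma lipschitzWith_apply {u : E3 → E3} {K : ℝ≥0} (hu : LipschitzWith K u) (j : Fin 3) :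
    LipschitzWith K fun x => u x j := by
  refine LipschitzWith.of_dist_le_mul fun x y => ?_
  refine le_trans ?_ (hu.dist_le_mul x y)
  rw [dist_eq_norm, dist_eq_norm]
  exact PiLp.norm_apply_le (u x - u y) j

lemma measurable_fderiv_apply_field {Φ : E3 → ℝ} {u : E3 → E3} (hu : Continuous u) :
    Measurable fun x => fderiv ℝ Φ x (u x) := by
  rw [funext fun x => fderiv_apply_eq_sum Φ x (u x)]
  refine Finset.measurable_sum _ fun j _ => (measurable_fderiv_apply_const ℝ Φ _).mul ?_
  exact (EuclideanSpace.proj (𝕜 := ℝ) j).continuous.measurable.comp hu.measurable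

lemma fderiv_eq_zero_of_notMem_tsupport {Φ : E3 → ℝ} {x : E3} (hx : x ∉ tsupport Φ) :
    fderiv ℝ Φ x = 0 :=
  image_eq_zero_of_notMem_tsupport fun h => hx (tsupport_fderiv_subset ℝ h)

lemma exists_bound_fderiv_apply {Φ : E3 → ℝ} {u : E3 → E3} {K₁ : ℝ≥0} (hΦ : LipschitzWith K₁ Φ)
    (hc : HasCompactSupport Φ) (hu : Continuous u) : ∃ C, ∀ x, |fderiv ℝ Φ x (u x)| ≤ C := by
  obtain ⟨A, hA⟩ := hc.isCompact.exists_bound_of_continuousOn hu.continuousOn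
  refine ⟨max (K₁ * A) 0, fun x => ?_⟩
  by_cases hx : x ∈ tsupport Φ
  · refine le_trans ?_ (le_max_left _ _)
    refine ((fderiv ℝ Φ x).le_opNorm (u x)).trans ?_
    exact mul_le_mul (norm_fderiv_le_of_lipschitz ℝ hΦ) (hA x hx) (norm_nonneg _) K₁.2
  · rw [fderiv_eq_zero_of_notMem_tsupport hx]
    simp

lemma integrable_fderiv_apply {Φ : E3 → ℝ} {u : E3 → E3} {K₁ : ℝ≥0} (hΦ : LipschitzWith K₁ Φ)
    (hc : HasCompactSupport Φ) (hu : Continuous u) : Integrable fun x => fderiv ℝ Φ x (u x) := by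
  obtain ⟨C, hC⟩ := exists_bound_fderiv_apply hΦ hc hu
  refine integrable_of_bound_of_compact hc.isCompact
    (measurable_fderiv_apply_field hu).aestronglyMeasurable (Eventually.of_forall hC) fun x hx => ?_
  rw [fderiv_eq_zero_of_notMem_tsupport hx]
  simp

lemma integral_fderiv_mul_eq {Φ f : E3 → ℝ} {K₁ K₂ : ℝ≥0} (hΦ : LipschitzWith K₁ Φ)
    (hf : LipschitzWith K₂ f) (hc : HasCompactSupport Φ) (v : E3) :
    ∫ x, fderiv ℝ Φ x v * f x = -∫ x, Φ x * fderiv ℝ f x v := by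
  have h := hf.integral_lineDeriv_mul_eq (μ := volume) hΦ hc v
  have e1 : ∫ x, lineDeriv ℝ f x v * Φ x = ∫ x, Φ x * fderiv ℝ f x v := by
    refine integral_congr_ae ?_
    filter_upwards [hf.ae_differentiableAt (μ := volume)] with x hx
    rw [hx.lineDeriv_eq_fderiv, mul_comm]
  have e2 : ∫ x, lineDeriv ℝ Φ x (-v) * f x = -∫ x, fderiv ℝ Φ x v * f x := by
    rw [← integral_neg]
    refine integral_congr_ae ?_
    filter_upwards [hΦ.ae_differentiableAt (μ := volume)] with x hx
    rw [hx.lineDeriv_eq_fderiv, map_neg, neg_mul]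
  rw [e1, e2] at h
  rw [h, neg_neg]

lemma integral_fderiv_apply_eq_neg {Φ : E3 → ℝ} {u : E3 → E3} {K₁ K₂ : ℝ≥0}
    (hΦ : LipschitzWith K₁ Φ) (hu : LipschitzWith K₂ u) (hc : HasCompactSupport Φ) :
    ∫ x, fderiv ℝ Φ x (u x) = -∫ x, Φ x * divergence u x := by
  have i1 : ∀ j : Fin 3, Integrable fun x =>
      fderiv ℝ Φ x (EuclideanSpace.single j 1) * u x j := by
    intro j
    have := integrable_fderiv_apply hΦ hc (u := fun x => u x j • EuclideanSpace.single j 1)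
      ((lipschitzWith_apply hu j).continuous.smul continuous_const)
    simpa [mul_comm] using this
  have i2 : ∀ j : Fin 3, Integrable fun x =>
      Φ x * fderiv ℝ (fun x => u x j) x (EuclideanSpace.single j 1) := by
    intro j
    obtain ⟨B, hB⟩ := hc.exists_bound_of_continuous hΦ.continuous
    refine integrable_of_bound_of_compact hc.isCompact (C := B * K₂) ?_
      (Eventually.of_forall fun x => ?_) fun x hx => ?_
    · exact hΦ.continuous.aestronglyMeasurable.mul
        (measurable_fderiv_apply_const ℝ _ _).aestronglyMeasurable
    · rw [norm_mul]
      refine mul_le_mul (hB x) ?_ (norm_nonneg _) ((norm_nonneg _).trans (hB x))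
      refine ((fderiv ℝ (fun x => u x j) x).le_opNorm _).trans ?_
      rw [PiLp.norm_single, norm_one, mul_one]
      exact norm_fderiv_le_of_lipschitz ℝ (lipschitzWith_apply hu j)
    · rw [image_eq_zero_of_notMem_tsupport hx, zero_mul]
  have e1 : ∫ x, Φ x * divergence u x =
      ∫ x, ∑ j, Φ x * fderiv ℝ (fun x => u x j) x (EuclideanSpace.single j 1) := by
    refine integral_congr_ae ?_
    filter_upwards [hu.ae_differentiableAt (μ := volume)] with x hx
    rw [divergence_eq_sum, Finset.mul_sum]
    refine Finset.sum_congr rfl fun j _ => ?_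
    have : HasFDerivAt (fun x => u x j)
        ((EuclideanSpace.proj (𝕜 := ℝ) j : E3 →L[ℝ] ℝ) ∘L fderiv ℝ u x) x :=
      (EuclideanSpace.proj (𝕜 := ℝ) j : E3 →L[ℝ] ℝ).hasFDerivAt.comp x hx.hasFDerivAt
    rw [this.fderiv]
    rfl
  rw [funext fun x => fderiv_apply_eq_sum Φ x (u x)]
  rw [e1, integral_finsetSum _ fun j _ => i1 j, integral_finsetSum _ fun j _ => i2 j,
    ← Finset.sum_neg_distrib]
  exact Finset.sum_congr rfl fun j _ =>
    integral_fderiv_mul_eq hΦ (lipschitzWith_apply hu j) hc _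

/-- No boundary term arises, and outside `Ω`, where the extended field need not be solenoidal, the
factor `Φ` vanishes. -/
lemma integral_fderiv_apply_eq_zero_of_vanishing {Ω : Set E3} (hΩ : IsOpen Ω) {Φ : E3 → ℝ}
    {u : E3 → E3} {K₁ K₂ : ℝ≥0} (hΦ : LipschitzWith K₁ Φ) (hu : LipschitzWith K₂ u)
    (hc : HasCompactSupport Φ) (hau : IsAdmissible Ω u) (h0 : ∀ x, x ∉ Ω → Φ x = 0) :
    ∫ x, fderiv ℝ Φ x (u x) = 0 := by
  rw [integral_fderiv_apply_eq_neg hΦ hu hc, neg_eq_zero]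
  refine integral_eq_zero_of_ae ?_
  have := (ae_restrict_iff' hΩ.measurableSet).1 hau.div_eq_zero
  filter_upwards [this] with x hx
  by_cases hxΩ : x ∈ Ω
  · simp [hx hxΩ]
  · simp [h0 x hxΩ]

/-- The cutoff that grows linearly from `0` to `1` between the heights `0` and `ε`. -/
def heightCutoff (L : E3 ≃ₗᵢ[ℝ] E3) (a : E2 → ℝ) (ε : ℝ) (y : E3) : ℝ :=
  max 0 (min 1 (ε⁻¹ * height L a y))

/-! ### Cutoffs in terms of the height above the boundary -/

section Cutoff

variable {L : E3 ≃ₗᵢ[ℝ] E3} {a : E2 → ℝ} {K : ℝ≥0} {ε : ℝ}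

lemma heightCutoff_nonneg (y : E3) : 0 ≤ heightCutoff L a ε y := le_max_left _ _

lemma heightCutoff_le_one (y : E3) : heightCutoff L a ε y ≤ 1 :=
  max_le zero_le_one (min_le_left _ _)

lemma heightCutoff_eq_zero (hε : 0 < ε) {y : E3} (hy : height L a y ≤ 0) :
    heightCutoff L a ε y = 0 := by
  refine max_eq_left ((min_le_right _ _).trans ?_)
  exact mul_nonpos_of_nonneg_of_nonpos (inv_pos.2 hε).le hy

lemma heightCutoff_eq_one (hε : 0 < ε) {y : E3} (hy : ε ≤ height L a y) :
    heightCutoff L a ε y = 1 := by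
  have : 1 ≤ ε⁻¹ * height L a y := by
    rw [inv_mul_eq_div, one_le_div hε]
    exact hy
  rw [heightCutoff, min_eq_left this, max_eq_right zero_le_one]

lemma exists_lipschitzWith_heightCutoff (ha : LipschitzWith K a) :
    ∃ K', LipschitzWith K' (heightCutoff L a ε) := by
  have h1 : LipschitzWith (‖ε⁻¹‖₊ * (1 + K)) fun y => ε⁻¹ * height L a y :=
    (lipschitzWith_smul ε⁻¹).comp (lipschitzWith_height ha)
  exact ⟨_, (h1.const_min 1).const_max 0⟩

lemma fderiv_heightCutoff (hε : 0 < ε) (ha : Continuous (height L a)) {y : E3}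
    (h0 : 0 < height L a y) (h1 : height L a y < ε) (hd : DifferentiableAt ℝ (height L a) y) :
    fderiv ℝ (heightCutoff L a ε) y = ε⁻¹ • fderiv ℝ (height L a) y := by
  have hev : heightCutoff L a ε =ᶠ[𝓝 y] fun y => ε⁻¹ • height L a y := by
    filter_upwards [ha.tendsto y (Ioo_mem_nhds h0 h1)] with z hz
    have hz1 : ε⁻¹ * height L a z ≤ 1 := by
      rw [inv_mul_eq_div, div_le_one hε]
      exact hz.2.le
    rw [heightCutoff, min_eq_right hz1, max_eq_right (mul_nonneg (inv_pos.2 hε).le hz.1.le),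
      smul_eq_mul]
  rw [hev.fderiv_eq, fderiv_fun_const_smul hd]

end Cutoff

/-! ### Orthogonality to gradients near the boundary -/

section Boundary

variable {L : E3 ≃ₗᵢ[ℝ] E3} {a : E2 → ℝ} {K : ℝ≥0} {Ω : Set E3} {x₀ : E3} {ρ : ℝ}

/-- A tangential Lipschitz field crosses the level sets of the height function slowly. -/
lemma ae_abs_fderiv_heightCutoff_le (ha : LipschitzWith K a)
    (hch : ∀ y ∈ Metric.ball x₀ ρ, (y ∈ Ω ↔ 0 < height L a y)) {u : E3 → E3} {Ku : ℝ≥0}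
    (hu : LipschitzWith Ku u) (hau : IsAdmissible Ω u) {ε : ℝ} (hε : 0 < ε) (hερ : ε ≤ ρ / 2) :
    ∀ᵐ y : E3, y ∈ Metric.ball x₀ (ρ / 2) →
      |fderiv ℝ (heightCutoff L a ε) y (u y)| ≤ (1 + K) * Ku ∧
      (height L a y ≤ 0 ∨ ε ≤ height L a y → fderiv ℝ (heightCutoff L a ε) y = 0) := by
  have hN : (μHE[2] : Measure E3)
      ({x | ¬ ∀ n, IsOuterNormal Ω x n → ⟪u x, n⟫ = 0} ∩ frontier Ω) = 0 := by
    have := hau.tangential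
    rw [ae_iff, Measure.restrict_apply' isClosed_frontier.measurableSet] at this
    exact this
  -- Tangency may fail on a set of vanishing area; the points vertically above it have vanishing
  -- volume. Hence almost every point lies over a boundary point at which the field is tangential.
  have hshadow : ∀ᵐ y : E3, ¬ ∃ t : ℝ, y + t • axis L ∈
      {x | ¬ ∀ n, IsOuterNormal Ω x n → ⟪u x, n⟫ = 0} ∩ frontier Ω :=
    compl_mem_ae_iff.2 (volume_shadow_eq_zero hN)
  have hhL := lipschitzWith_height (L := L) ha
  have hK0 : (0 : ℝ) ≤ (1 + K) * Ku := by positivity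
  filter_upwards [hshadow, hhL.ae_differentiableAt (μ := volume)] with y hy1 hy2 hyb
  have hflat : height L a y ≤ 0 ∨ ε ≤ height L a y →
      fderiv ℝ (heightCutoff L a ε) y = 0 := by
    rintro (h | h)
    · refine IsLocalMin.fderiv_eq_zero (Eventually.of_forall fun z => ?_)
      rw [heightCutoff_eq_zero hε h]
      exact heightCutoff_nonneg z
    · refine IsLocalMax.fderiv_eq_zero (Eventually.of_forall fun z => ?_)
      rw [heightCutoff_eq_one hε h]
      exact heightCutoff_le_one z
  refine ⟨?_, hflat⟩
  by_cases h : height L a y ≤ 0 ∨ ε ≤ height L a y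
  · rw [hflat h]
    simpa using hK0
  push Not at h
  obtain ⟨h0, h1⟩ := h
  set t := height L a y with ht
  have hP0 : height L a (y + (-t) • axis L) = 0 := by
    rw [height_add_smul_axis, ← ht]
    ring
  have hdist : ‖y - (y + (-t) • axis L)‖ = t := by
    rw [sub_add_cancel_left, neg_smul, neg_neg, norm_smul, norm_axis, mul_one,
      Real.norm_of_nonneg h0.le]
  have hPb : y + (-t) • axis L ∈ Metric.ball x₀ ρ := by
    rw [Metric.mem_ball] at hyb ⊢
    have := dist_triangle (y + (-t) • axis L) y x₀
    rw [dist_comm _ y, dist_eq_norm y, hdist] at this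
    linarith
  have hPf := mem_frontier_of_height_eq_zero hch hPb hP0
  have htan : ∀ n, IsOuterNormal Ω (y + (-t) • axis L) n → ⟪u (y + (-t) • axis L), n⟫ = 0 := by
    by_contra hcon
    exact hy1 ⟨-t, hcon, hPf⟩
  have hz := fderiv_height_eq_zero_of_tangential hch hPb hP0
    (differentiableAt_height_add_smul_axis hy2 (-t)) htan
  rw [fderiv_height_add_smul_axis] at hz
  rw [fderiv_heightCutoff hε hhL.continuous h0 h1 hy2, smul_apply,
    smul_eq_mul, abs_mul, abs_of_pos (inv_pos.2 hε)]
  -- The derivative of the height annihilates `u` at the boundary point at distance `t` below `y`,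
  -- so only the increment of `u` counts. In the layer `t < ε`, which cancels the slope `ε⁻¹` of the
  -- cutoff.
  have h2 : |fderiv ℝ (height L a) y (u y)| ≤ (1 + K) * (Ku * t) := by
    have e : fderiv ℝ (height L a) y (u y) =
        fderiv ℝ (height L a) y (u y - u (y + (-t) • axis L)) := by
      rw [map_sub, hz, sub_zero]
    rw [e]
    refine ((fderiv ℝ (height L a) y).le_opNorm _).trans ?_
    refine mul_le_mul ?_ ?_ (norm_nonneg _) (by positivity)
    · simpa using norm_fderiv_le_of_lipschitz ℝ hhL (x₀ := y)
    · rw [← dist_eq_norm]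
      refine (hu.dist_le_mul _ _).trans_eq ?_
      rw [dist_eq_norm, hdist]
  calc ε⁻¹ * |fderiv ℝ (height L a) y (u y)| ≤ ε⁻¹ * ((1 + K) * (Ku * t)) := by gcongr
    _ ≤ ε⁻¹ * ((1 + K) * (Ku * ε)) := by gcongr
    _ = (1 + K) * Ku := by field_simp

/-- Multiply `φ` by the height cutoff, so that the product vanishes outside `Ω`. As `ε → 0` the
cutoff tends to the indicator of `Ω` on the support of `φ`; the term with its derivative is bounded
independently of `ε` and lives on a layer that shrinks to nothing. -/
lemma integral_fderiv_apply_eq_zero_of_chart (hΩ : IsOpen Ω) (ha : LipschitzWith K a) (hρ : 0 < ρ)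
    (hch : ∀ y ∈ Metric.ball x₀ ρ, (y ∈ Ω ↔ 0 < height L a y)) {u : E3 → E3} {Ku : ℝ≥0}
    (hu : LipschitzWith Ku u) (hau : IsAdmissible Ω u) {φ : E3 → ℝ} {Kφ : ℝ≥0}
    (hφ : LipschitzWith Kφ φ) (hc : HasCompactSupport φ)
    (hsupp : tsupport φ ⊆ Metric.ball x₀ (ρ / 2)) : ∫ x in Ω, fderiv ℝ φ x (u x) = 0 := by
  have hsub : ∀ {x}, x ∈ tsupport φ → x ∈ Metric.ball x₀ ρ := fun hx =>
    Metric.ball_subset_ball (by linarith) (hsupp hx)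
  obtain ⟨A, hA⟩ := hc.exists_bound_of_continuous hφ.continuous
  have hA0 : 0 ≤ A := (norm_nonneg _).trans (hA 0)
  have hi := integrable_fderiv_apply hφ hc hu.continuous
  set η := fun ε => heightCutoff L a ε with hη
  have hev : ∀ᶠ ε in 𝓝[>] (0 : ℝ), 0 < ε ∧ ε ≤ ρ / 2 := by
    filter_upwards [Ioo_mem_nhdsGT (show (0 : ℝ) < ρ / 2 by linarith)] with ε h
    exact ⟨h.1, h.2.le⟩
  have hηm : ∀ ε, Continuous (η ε) := fun ε =>
    (exists_lipschitzWith_heightCutoff ha).choose_spec.continuous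
  -- the product rule
  have hprod : ∀ ε, 0 < ε → ε ≤ ρ / 2 →
      ∫ x, η ε x * fderiv ℝ φ x (u x) = -∫ x, φ x * fderiv ℝ (η ε) x (u x) := by
    intro ε hε hερ
    obtain ⟨Kη, hKη⟩ := exists_lipschitzWith_heightCutoff (L := L) (ε := ε) ha
    obtain ⟨K', hK'⟩ := exists_lipschitzWith_smul hφ hKη hc
    have hc' : HasCompactSupport fun x => φ x • η ε x := hc.smul_right
    have h0 := integral_fderiv_apply_eq_zero_of_vanishing hΩ hK' hu hc' hau (fun x hx => by
      by_cases hxs : x ∈ tsupport φ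
      · have : height L a x ≤ 0 := not_lt.1 fun h => hx ((hch x (hsub hxs)).2 h)
        rw [heightCutoff_eq_zero hε this, smul_zero]
      · rw [image_eq_zero_of_notMem_tsupport hxs, zero_smul])
    have i1 : Integrable fun x => η ε x * fderiv ℝ φ x (u x) :=
      hi.bdd_mul (c := 1) (hηm ε).aestronglyMeasurable (Eventually.of_forall fun x => by
        rw [Real.norm_of_nonneg (heightCutoff_nonneg x)]
        exact heightCutoff_le_one x)
    have i2 : Integrable fun x => φ x * fderiv ℝ (η ε) x (u x) := by
      refine integrable_of_bound_of_compact hc.isCompact (C := A * ((1 + K) * Ku)) ?_ ?_ ?_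
      · exact hφ.continuous.aestronglyMeasurable.mul
          (measurable_fderiv_apply_field hu.continuous).aestronglyMeasurable
      · filter_upwards [ae_abs_fderiv_heightCutoff_le ha hch hu hau hε hερ] with x hx
        by_cases hxs : x ∈ tsupport φ
        · rw [norm_mul]
          exact mul_le_mul (hA x) (hx (hsupp hxs)).1 (norm_nonneg _) hA0
        · rw [image_eq_zero_of_notMem_tsupport hxs, zero_mul, norm_zero]
          positivity
      · intro x hx
        rw [image_eq_zero_of_notMem_tsupport hx, zero_mul]
    rw [← sub_eq_zero, sub_neg_eq_add, ← integral_add i1 i2, ← h0]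
    refine integral_congr_ae ?_
    filter_upwards [hφ.ae_differentiableAt (μ := volume), hKη.ae_differentiableAt (μ := volume)]
      with x h1 h2
    have := fderiv_fun_smul h1 h2
    rw [this]
    simp [hη]
    ring
  have hlim1 : Tendsto (fun ε => ∫ x, η ε x * fderiv ℝ φ x (u x)) (𝓝[>] 0)
      (𝓝 (∫ x, Ω.indicator (fun x => fderiv ℝ φ x (u x)) x)) := by
    refine tendsto_integral_filter_of_dominated_convergence
      (fun x => ‖fderiv ℝ φ x (u x)‖) ?_ ?_ hi.norm ?_
    · exact Eventually.of_forall fun ε => (hηm ε).aestronglyMeasurable.mul hi.1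
    · refine Eventually.of_forall fun ε => Eventually.of_forall fun x => ?_
      rw [norm_mul, Real.norm_of_nonneg (heightCutoff_nonneg x)]
      exact mul_le_of_le_one_left (norm_nonneg _) (heightCutoff_le_one x)
    · refine Eventually.of_forall fun x => tendsto_const_nhds.congr' ?_
      by_cases hxs : x ∈ tsupport φ
      · by_cases hxΩ : x ∈ Ω
        · have hpos := (hch x (hsub hxs)).1 hxΩ
          filter_upwards [Ioo_mem_nhdsGT hpos] with ε hε
          rw [indicator_of_mem hxΩ, hη]
          simp only
          rw [heightCutoff_eq_one hε.1 hε.2.le, one_mul]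
        · have hle : height L a x ≤ 0 := not_lt.1 fun h => hxΩ ((hch x (hsub hxs)).2 h)
          filter_upwards [self_mem_nhdsWithin] with ε hε
          rw [indicator_of_notMem hxΩ, hη]
          simp only
          rw [heightCutoff_eq_zero hε hle, zero_mul]
      · refine Eventually.of_forall fun ε => ?_
        simp [fderiv_eq_zero_of_notMem_tsupport hxs]
  -- The exceptional null set of the derivative bound depends on `ε`; along a sequence these sets
  -- can be united.
  have hlim2 : Tendsto (fun n : ℕ => ∫ x, φ x * fderiv ℝ (η (ρ / 2 / (n + 1))) x (u x)) atTop
      (𝓝 (∫ _ : E3, (0 : ℝ))) := by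
    have hpos : ∀ n : ℕ, 0 < ρ / 2 / ((n : ℝ) + 1) := fun n => by positivity
    have hle : ∀ n : ℕ, ρ / 2 / ((n : ℝ) + 1) ≤ ρ / 2 := fun n =>
      div_le_self (by linarith) (by linarith [n.cast_nonneg (α := ℝ)])
    have hae := ae_all_iff.2 fun n : ℕ =>
      ae_abs_fderiv_heightCutoff_le ha hch hu hau (hpos n) (hle n)
    refine tendsto_integral_of_dominated_convergence
      ((tsupport φ).indicator fun _ => A * ((1 + K) * Ku)) ?_ ?_ ?_ ?_
    · intro n
      exact hφ.continuous.aestronglyMeasurable.mul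
        (measurable_fderiv_apply_field hu.continuous).aestronglyMeasurable
    · rw [integrable_indicator_iff (isClosed_tsupport φ).measurableSet]
      exact integrableOn_const hc.isCompact.measure_lt_top.ne
    · intro n
      filter_upwards [hae] with x hx
      by_cases hxs : x ∈ tsupport φ
      · rw [indicator_of_mem hxs, norm_mul]
        exact mul_le_mul (hA x) (hx n (hsupp hxs)).1 (norm_nonneg _) hA0
      · rw [indicator_of_notMem hxs, image_eq_zero_of_notMem_tsupport hxs, zero_mul, norm_zero]
    · filter_upwards [hae] with x hx
      by_cases hxs : x ∈ tsupport φ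
      · refine tendsto_const_nhds.congr' ?_
        have hsmall : ∀ᶠ n : ℕ in atTop,
            height L a x ≤ 0 ∨ ρ / 2 / ((n : ℝ) + 1) ≤ height L a x := by
          by_cases hh : height L a x ≤ 0
          · exact Eventually.of_forall fun _ => Or.inl hh
          · have ht : Tendsto (fun n : ℕ => ρ / 2 / ((n : ℝ) + 1)) atTop (𝓝 0) :=
              tendsto_const_nhds.div_atTop (tendsto_atTop_add_const_right _ _
                tendsto_natCast_atTop_atTop)
            filter_upwards [ht.eventually (gt_mem_nhds (not_le.1 hh))] with n hn
            exact Or.inr hn.le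
        filter_upwards [hsmall] with n hn
        rw [(hx n (hsupp hxs)).2 hn]
        simp
      · refine tendsto_const_nhds.congr fun n => ?_
        rw [image_eq_zero_of_notMem_tsupport hxs, zero_mul]
  have hseq : Tendsto (fun n : ℕ => ρ / 2 / ((n : ℝ) + 1)) atTop (𝓝[>] 0) := by
    refine tendsto_nhdsWithin_iff.2 ⟨?_, Eventually.of_forall fun n => ?_⟩
    · exact tendsto_const_nhds.div_atTop (tendsto_atTop_add_const_right _ _
        tendsto_natCast_atTop_atTop)
    · show 0 < ρ / 2 / ((n : ℝ) + 1)
      positivity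
  have h1 := hlim1.comp hseq
  have h2 := hlim2.neg
  rw [integral_zero, neg_zero] at h2
  have h3 : Tendsto ((fun ε => ∫ x, η ε x * fderiv ℝ φ x (u x)) ∘
      fun n : ℕ => ρ / 2 / ((n : ℝ) + 1)) atTop (𝓝 0) := by
    refine h2.congr' ?_
    filter_upwards [hseq.eventually hev] with n hn
    exact (hprod _ hn.1 hn.2).symm
  rw [← integral_indicator hΩ.measurableSet]
  exact tendsto_nhds_unique h1 h3

end Boundary

/-- Admissible fields are orthogonal to gradients. -/
theorem integral_fderiv_apply_eq_zero {Ω : Set E3} (hΩ : IsBoundedLipschitzDomain Ω) {u : E3 → E3}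
    {Ku : ℝ≥0} (hu : LipschitzWith Ku u) (hau : IsAdmissible Ω u) {φ : E3 → ℝ} {Kφ : ℝ≥0}
    (hφ : LipschitzWith Kφ φ) : ∫ x in Ω, fderiv ℝ φ x (u x) = 0 := by
  have hcpt := hΩ.isBounded.isCompact_closure
  -- local statement
  have hloc : ∀ x ∈ closure Ω, ∃ U : Set E3, IsOpen U ∧ x ∈ U ∧ Bornology.IsBounded U ∧
      ∀ (ψ : E3 → ℝ) (K' : ℝ≥0), LipschitzWith K' ψ → HasCompactSupport ψ → tsupport ψ ⊆ U →
        ∫ x in Ω, fderiv ℝ ψ x (u x) = 0 := by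
    intro x hx
    by_cases hxΩ : x ∈ Ω
    · refine ⟨Ω, hΩ.isOpen, hxΩ, hΩ.isBounded, fun ψ K' hψ hc hs => ?_⟩
      rw [setIntegral_eq_integral_of_forall_compl_eq_zero fun y hy => by
        rw [fderiv_eq_zero_of_notMem_tsupport fun h => hy (hs h)]
        rfl]
      exact integral_fderiv_apply_eq_zero_of_vanishing hΩ.isOpen hψ hu hc hau fun y hy =>
        image_eq_zero_of_notMem_tsupport fun h => hy (hs h)
    · have hxf : x ∈ frontier Ω := by
        rw [hΩ.isOpen.frontier_eq]
        exact ⟨hx, hxΩ⟩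
      obtain ⟨L, a, K, ρ, ha, hρ, hch⟩ := hΩ.exists_chart hxf
      exact ⟨Metric.ball x (ρ / 2), Metric.isOpen_ball, Metric.mem_ball_self (by linarith),
        Metric.isBounded_ball, fun ψ K' hψ hc hs =>
          integral_fderiv_apply_eq_zero_of_chart hΩ.isOpen ha hρ hch hu hau hψ hc hs⟩
  choose! U hUo hxU hUb hU using hloc
  -- A smooth partition of unity on the closure splits `φ` into pieces, each supported in `Ω` or in
  -- a chart.
  obtain ⟨t, ht, hcov⟩ := hcpt.elim_nhds_subcover U fun x hx => (hUo x hx).mem_nhds (hxU x hx)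
  obtain ⟨f, hf⟩ := SmoothPartitionOfUnity.exists_isSubordinate (modelWithCornersSelf ℝ E3)
    (isClosed_closure (s := Ω)) (fun i : t => U i) (fun i => hUo i (ht i i.2))
    (fun x hx => by
      obtain ⟨i, hi, hxi⟩ := mem_iUnion₂.1 (hcov hx)
      exact mem_iUnion.2 ⟨⟨i, hi⟩, hxi⟩)
  have hfc : ∀ i, HasCompactSupport (f i) := fun i =>
    Metric.isCompact_of_isClosed_isBounded (isClosed_tsupport _) ((hUb i (ht i i.2)).subset (hf i))
  have hfs : ∀ i, ContDiff ℝ ∞ (f i) := fun i => (f i).contMDiff.contDiff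
  have hlip : ∀ i, ∃ K', LipschitzWith K' fun x => f i x • φ x := fun i => by
    obtain ⟨K', hK'⟩ := ContDiff.lipschitzWith_of_hasCompactSupport (hfc i) (hfs i) (by simp)
    exact exists_lipschitzWith_smul hK' hφ (hfc i)
  choose K' hK' using hlip
  have hc : ∀ i, HasCompactSupport fun x => f i x • φ x := fun i => (hfc i).smul_right
  have hzero : ∀ i, ∫ x in Ω, fderiv ℝ (fun x => f i x • φ x) x (u x) = 0 := fun i =>
    hU i (ht i i.2) _ (K' i) (hK' i) (hc i) ((tsupport_smul_subset_left _ _).trans (hf i))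
  have hsum : ∀ x ∈ Ω, φ x = ∑ i, f i x • φ x := by
    intro x hx
    have := f.sum_eq_one (subset_closure hx)
    rw [finsum_eq_sum_of_fintype] at this
    rw [← Finset.sum_smul, this, one_smul]
  have hcong : ∫ x in Ω, fderiv ℝ φ x (u x) =
      ∫ x in Ω, ∑ i, fderiv ℝ (fun x => f i x • φ x) x (u x) := by
    have hdiff : ∀ᵐ x : E3, ∀ i, DifferentiableAt ℝ (fun x => f i x • φ x) x :=
      ae_all_iff.2 fun i => (hK' i).ae_differentiableAt
    refine setIntegral_congr_ae hΩ.isOpen.measurableSet ?_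
    filter_upwards [hdiff] with x hx hxΩ
    have hev : φ =ᶠ[𝓝 x] fun x => ∑ i, f i x • φ x := by
      filter_upwards [hΩ.isOpen.mem_nhds hxΩ] with y hy
      exact hsum y hy
    rw [hev.fderiv_eq, fderiv_fun_sum fun i _ => hx i]
    simp
  rw [hcong, integral_finsetSum _ fun i _ =>
    (integrable_fderiv_apply (hK' i) (hc i) hu.continuous).integrableOn]
  exact Finset.sum_eq_zero fun i _ => hzero i

/-- The convective form is skew-symmetric on admissible fields. -/
theorem integral_inner_outer_grad_add_eq_zero {Ω : Set E3} (hΩ : IsBoundedLipschitzDomain Ω)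
    {u w z : E3 → E3} {Ku Kw Kz : ℝ≥0} (hu : LipschitzWith Ku u) (hau : IsAdmissible Ω u)
    (hw : LipschitzWith Kw w) (hwc : HasCompactSupport w) (hz : LipschitzWith Kz z) :
    ∫ x in Ω, (⟪outer (w x) (u x), grad z x⟫ + ⟪outer (z x) (u x), grad w x⟫) = 0 := by
  have hlip : ∃ K, LipschitzWith K fun x => ⟪w x, z x⟫ := by
    have h1 : ∀ j : Fin 3, ∃ K, LipschitzWith K fun x => w x j • z x j := fun j =>
      exists_lipschitzWith_smul (lipschitzWith_apply hw j) (lipschitzWith_apply hz j)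
        (hwc.comp_left (g := fun y : E3 => y j) rfl)
    choose K hK using h1
    refine ⟨K 0 + K 1 + K 2, ?_⟩
    have := ((hK 0).add (hK 1)).add (hK 2)
    have e : (fun x => ⟪w x, z x⟫) = fun x =>
        w x 0 • z x 0 + w x 1 • z x 1 + w x 2 • z x 2 := by
      funext x
      rw [inner_E3, Fin.sum_univ_three]
      rfl
    rw [e]
    exact this
  obtain ⟨K, hK⟩ := hlip
  -- The potential is the scalar product of `w` and `z`; its derivative in the direction `u` is
  -- exactly the integrand, by the product rule.
  rw [← integral_fderiv_apply_eq_zero hΩ hu hau hK]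
  refine setIntegral_congr_ae hΩ.isOpen.measurableSet ?_
  filter_upwards [hw.ae_differentiableAt (μ := volume), hz.ae_differentiableAt (μ := volume)]
    with x h1 h2 _
  rw [fderiv_inner_apply ℝ h1 h2, inner_fderiv_eq, real_inner_comm (outer (z x) (u x)),
    real_inner_comm (fderiv ℝ z x (u x)), inner_fderiv_eq, real_inner_comm (grad z x)]

/-! ### Traces of Lipschitz functions -/

section Trace

variable {L : E3 ≃ₗᵢ[ℝ] E3} {a : E2 → ℝ} {K : ℝ≥0} {Ω : Set E3} {x₀ : E3} {ρ : ℝ}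

lemma euclideanHausdorffMeasure_image_le {γ : E2 → E3} (hγ : LipschitzWith K γ) (s : Set E2) :
    (μHE[2] : Measure E3) (γ '' s) ≤ (K : ℝ≥0∞) ^ 2 * volume s := by
  have h := hγ.hausdorffMeasure_image_le (d := (2 : ℕ)) (by positivity) s
  rw [← EuclideanSpace.euclideanHausdorffMeasure_eq_volume, Measure.euclideanHausdorffMeasure_def,
    Measure.euclideanHausdorffMeasure_def, Measure.smul_apply, Measure.smul_apply,
    ENNReal.smul_def, ENNReal.smul_def, smul_eq_mul, smul_eq_mul]
  rw [ENNReal.rpow_natCast] at h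
  calc _ ≤ (Measure.addHaarScalarFactor (volume : Measure E2) μH[(2 : ℕ)] : ℝ≥0∞) *
        ((K : ℝ≥0∞) ^ 2 * μH[(2 : ℕ)] s) := mul_le_mul_right h _
    _ = _ := by ring

/-- Inside the chart the frontier lies on the graph, a Lipschitz image of the plane. An upper bound
for the area is enough for trace estimates, so no area formula is needed. -/
lemma surf_restrict_ball_le (hΩ : IsOpen Ω) (ha : LipschitzWith K a)
    (hch : ∀ y ∈ Metric.ball x₀ ρ, (y ∈ Ω ↔ 0 < height L a y)) {r : ℝ} (hr : r ≤ ρ) :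
    (surf Ω).restrict (Metric.ball x₀ r) ≤ (((1 + K : ℝ≥0) : ℝ≥0∞) ^ 2) •
      Measure.map (fun y => graphPoint L a (y, 0))
        (volume.restrict ((fun y => graphPoint L a (y, 0)) ⁻¹' Metric.ball x₀ r)) := by
  have hγ := lipschitzWith_graphPoint_zero (L := L) ha
  refine Measure.le_iff.2 fun s hs => ?_
  rw [Measure.smul_apply, Measure.map_apply hγ.continuous.measurable hs, smul_eq_mul,
    Measure.restrict_apply (hγ.continuous.measurable hs), Measure.restrict_apply hs,
    Measure.restrict_apply (hs.inter measurableSet_ball)]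
  refine le_trans (measure_mono ?_) (euclideanHausdorffMeasure_image_le hγ _)
  rintro y ⟨⟨hys, hyb⟩, hyf⟩
  have h0 := height_eq_zero_of_mem_frontier hΩ ha hch (Metric.ball_subset_ball hr hyb) hyf
  have he : graphPoint L a (proj2 (L y), 0) = y := by
    rw [← h0]
    exact graphPoint_eq y
  refine ⟨proj2 (L y), ⟨?_, ?_⟩, he⟩
  · rw [mem_preimage, he]
    exact hys
  · rw [mem_preimage, he]
    exact hyb

lemma enorm_le_of_vertical_segment {f : E3 → ℝ} {Kf : ℝ≥0} (hf : LipschitzWith Kf f) {y : E2}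
    {δ δ₀ : ℝ} (hδ : 0 < δ) (hδ₀ : δ ≤ δ₀)
    (hd : ∀ᵐ τ : ℝ, DifferentiableAt ℝ f (graphPoint L a (y, τ))) :
    ‖f (graphPoint L a (y, 0))‖ₑ ≤ ‖f (graphPoint L a (y, δ))‖ₑ +
      ∫⁻ τ in Ioo (0 : ℝ) δ₀, ‖fderiv ℝ f (graphPoint L a (y, τ)) (axis L)‖ₑ := by
  have hgp : ∀ τ, graphPoint L a (y, τ) = graphPoint L a (y, 0) + τ • axis L := fun τ => by
    rw [← graphPoint_add, zero_add]
  set g : ℝ → ℝ := fun τ => f (graphPoint L a (y, τ)) with hg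
  have hlip : LipschitzWith Kf g := by
    refine LipschitzWith.of_dist_le_mul fun s t => (hf.dist_le_mul _ _).trans_eq ?_
    rw [hgp s, hgp t, dist_add_left, dist_eq_norm, ← sub_smul, norm_smul, norm_axis, mul_one,
      ← dist_eq_norm]
  have hFTC := (hlip.lipschitzOnWith (s := uIcc 0 δ)).absolutelyContinuousOnInterval
    |>.integral_deriv_eq_sub
  have hder : ∀ᵐ τ : ℝ, ‖deriv g τ‖ₑ = ‖fderiv ℝ f (graphPoint L a (y, τ)) (axis L)‖ₑ := by
    filter_upwards [hd] with τ hτ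
    have h1 : HasDerivAt (fun τ : ℝ => graphPoint L a (y, τ)) (axis L) τ := by
      rw [funext hgp]
      simpa using ((hasDerivAt_id τ).smul_const (axis L)).const_add (graphPoint L a (y, 0))
    have h2 : HasDerivAt g (fderiv ℝ f (graphPoint L a (y, τ)) (axis L)) τ :=
      hτ.hasFDerivAt.comp_hasDerivAt τ h1
    rw [h2.deriv]
  have h1 : ‖∫ τ in (0 : ℝ)..δ, deriv g τ‖ₑ ≤
      ∫⁻ τ in Ioo (0 : ℝ) δ₀, ‖fderiv ℝ f (graphPoint L a (y, τ)) (axis L)‖ₑ := by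
    rw [intervalIntegral.integral_of_le hδ.le, integral_Ioc_eq_integral_Ioo]
    refine (enorm_integral_le_lintegral_enorm _).trans ?_
    refine le_trans ?_ (lintegral_mono_set (Ioo_subset_Ioo_right hδ₀))
    exact (lintegral_congr_ae (ae_restrict_of_ae hder)).le
  have h2 : f (graphPoint L a (y, 0)) = f (graphPoint L a (y, δ)) -
      ∫ τ in (0 : ℝ)..δ, deriv g τ := by
    rw [hFTC]
    simp [hg]
  rw [h2]
  exact enorm_sub_le.trans (add_le_add le_rfl h1)

/-- The vertical column of height `δ₀` over a boundary patch stays in the chart and hence in `Ω`,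
and graph coordinates preserve volume. -/
lemma lintegral_graphPoint_le (ha : LipschitzWith K a)
    (hch : ∀ y ∈ Metric.ball x₀ ρ, (y ∈ Ω ↔ 0 < height L a y)) (hΩ : IsOpen Ω) {r δ₀ : ℝ}
    (hr : r + δ₀ ≤ ρ) {G : E3 → ℝ≥0∞} (hG : Measurable G) :
    ∫⁻ y in (fun y => graphPoint L a (y, 0)) ⁻¹' Metric.ball x₀ r, ∫⁻ τ in Ioo (0 : ℝ) δ₀,
      G (graphPoint L a (y, τ)) ≤ ∫⁻ x in Ω, G x := by
  have hmp := measurePreserving_graphPoint (L := L) ha.continuous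
  have hGm : Measurable fun z => G (graphPoint L a z) := hG.comp hmp.measurable
  have hY : MeasurableSet ((fun y => graphPoint L a (y, 0)) ⁻¹' Metric.ball x₀ r) :=
    (lipschitzWith_graphPoint_zero ha).continuous.measurable measurableSet_ball
  rw [← lintegral_prod _ hGm.aemeasurable, Measure.prod_restrict,
    ← lintegral_indicator (hY.prod measurableSet_Ioo), ← lintegral_indicator hΩ.measurableSet,
    ← hmp.lintegral_comp (hG.indicator hΩ.measurableSet)]
  refine lintegral_mono fun z => ?_
  by_cases hz : z ∈ ((fun y => graphPoint L a (y, 0)) ⁻¹' Metric.ball x₀ r) ×ˢ Ioo 0 δ₀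
  · rw [indicator_of_mem hz]
    obtain ⟨h1, h2⟩ := hz
    have hb : graphPoint L a z ∈ Metric.ball x₀ ρ := by
      have : graphPoint L a z = graphPoint L a (z.1, 0) + z.2 • axis L := by
        rw [← graphPoint_add, zero_add]
      rw [mem_preimage, Metric.mem_ball, dist_eq_norm] at h1
      rw [Metric.mem_ball, dist_eq_norm, this, add_sub_right_comm]
      refine (norm_add_le _ _).trans_lt ?_
      rw [norm_smul, norm_axis, mul_one, Real.norm_of_nonneg h2.1.le]
      linarith [h2.2]
    have hzΩ : graphPoint L a z ∈ Ω := by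
      rw [hch _ hb, height_graphPoint]
      exact h2.1
    rw [indicator_of_mem hzΩ]
  · rw [indicator_of_notMem hz]
    exact zero_le

/-- The local trace inequality. -/
lemma exists_lintegral_surf_ball_le (hΩ : IsOpen Ω) (ha : LipschitzWith K a) (hρ : 0 < ρ)
    (hch : ∀ y ∈ Metric.ball x₀ ρ, (y ∈ Ω ↔ 0 < height L a y)) :
    ∃ C : ℝ≥0∞, C ≠ ⊤ ∧ ∀ (f : E3 → ℝ) (Kf : ℝ≥0), LipschitzWith Kf f →
      ∫⁻ x in Metric.ball x₀ (ρ / 2), ‖f x‖ₑ ∂(surf Ω) ≤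
        C * ((∫⁻ x in Ω, ‖f x‖ₑ) + ∫⁻ x in Ω, ‖fderiv ℝ f x (axis L)‖ₑ) := by
  set δ₀ := ρ / 2 with hδ₀
  have hδpos : 0 < δ₀ := by linarith
  set D := ENNReal.ofReal δ₀ with hD
  have hD0 : D ≠ 0 := by simpa [hD] using hδpos
  have hDt : D ≠ ⊤ := ENNReal.ofReal_ne_top
  set Y := (fun y => graphPoint L a (y, 0)) ⁻¹' Metric.ball x₀ (ρ / 2) with hYdef
  have hγ := lipschitzWith_graphPoint_zero (L := L) ha
  have hmp := measurePreserving_graphPoint (L := L) ha.continuous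
  have hY : MeasurableSet Y := hγ.continuous.measurable measurableSet_ball
  refine ⟨((1 + K : ℝ≥0) : ℝ≥0∞) ^ 2 * (D⁻¹ + 1), ?_, fun f Kf hf => ?_⟩
  · exact ENNReal.mul_ne_top (by simp) (ENNReal.add_ne_top.2 ⟨ENNReal.inv_ne_top.2 hD0, by simp⟩)
  have hfm : Measurable fun x => ‖f x‖ₑ := hf.continuous.measurable.enorm
  have hdm : Measurable fun x => ‖fderiv ℝ f x (axis L)‖ₑ :=
    (measurable_fderiv_apply_const ℝ f _).enorm
  set I1 := ∫⁻ x in Ω, ‖f x‖ₑ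
  set I2 := ∫⁻ x in Ω, ‖fderiv ℝ f x (axis L)‖ₑ
  have hm1 : Measurable fun z : E2 × ℝ => ‖f (graphPoint L a z)‖ₑ := hfm.comp hmp.measurable
  have hm2 : Measurable fun z : E2 × ℝ => ‖fderiv ℝ f (graphPoint L a z) (axis L)‖ₑ :=
    hdm.comp hmp.measurable
  have b1 := lintegral_graphPoint_le ha hch hΩ (r := ρ / 2) (δ₀ := δ₀) (by linarith) hfm
  have b2 := lintegral_graphPoint_le ha hch hΩ (r := ρ / 2) (δ₀ := δ₀) (by linarith) hdm
  have hae : ∀ᵐ y : E2, ∀ᵐ τ : ℝ, DifferentiableAt ℝ f (graphPoint L a (y, τ)) :=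
    Measure.ae_ae_of_ae_prod
      (hmp.quasiMeasurePreserving.ae (hf.ae_differentiableAt (μ := volume)))
  -- Averaging the vertical estimate over the upper end point turns the value of `f` there into an
  -- integral over the column.
  have key : ∀ᵐ y : E2, D * ‖f (graphPoint L a (y, 0))‖ₑ ≤
      (∫⁻ τ in Ioo (0 : ℝ) δ₀, ‖f (graphPoint L a (y, τ))‖ₑ) +
        D * ∫⁻ τ in Ioo (0 : ℝ) δ₀, ‖fderiv ℝ f (graphPoint L a (y, τ)) (axis L)‖ₑ := by
    filter_upwards [hae] with y hy
    have hvol : volume (Ioo (0 : ℝ) δ₀) = D := by rw [Real.volume_Ioo, sub_zero]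
    have hc : ∀ c : ℝ≥0∞, ∫⁻ _ in Ioo (0 : ℝ) δ₀, c = D * c := fun c => by
      rw [setLIntegral_const, hvol, mul_comm]
    have hm1y : Measurable fun τ : ℝ => ‖f (graphPoint L a (y, τ))‖ₑ :=
      hm1.comp (measurable_const.prodMk measurable_id)
    rw [← hc, ← hc, ← lintegral_add_left hm1y]
    exact setLIntegral_mono' measurableSet_Ioo fun δ hδ =>
      enorm_le_of_vertical_segment hf hδ.1 hδ.2.le hy
  have h1 : D * ∫⁻ y in Y, ‖f (graphPoint L a (y, 0))‖ₑ ≤ I1 + D * I2 := by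
    have hmγ : Measurable fun y => ‖f (graphPoint L a (y, 0))‖ₑ :=
      hfm.comp hγ.continuous.measurable
    rw [← lintegral_const_mul _ hmγ]
    refine (lintegral_mono_ae (ae_restrict_of_ae key)).trans ?_
    rw [lintegral_add_left hm1.lintegral_prod_right', lintegral_const_mul _
      hm2.lintegral_prod_right']
    exact add_le_add b1 (mul_le_mul_right b2 _)
  have h2 : ∫⁻ y in Y, ‖f (graphPoint L a (y, 0))‖ₑ ≤ (D⁻¹ + 1) * (I1 + I2) := by
    calc ∫⁻ y in Y, ‖f (graphPoint L a (y, 0))‖ₑ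
        = D⁻¹ * (D * ∫⁻ y in Y, ‖f (graphPoint L a (y, 0))‖ₑ) := by
          rw [← mul_assoc, ENNReal.inv_mul_cancel hD0 hDt, one_mul]
      _ ≤ D⁻¹ * (I1 + D * I2) := mul_le_mul_right h1 _
      _ = D⁻¹ * I1 + I2 := by
          rw [mul_add, ← mul_assoc, ENNReal.inv_mul_cancel hD0 hDt, one_mul]
      _ ≤ (D⁻¹ * I1 + I2) + (D⁻¹ * I2 + I1) := le_self_add
      _ = _ := by ring
  have h3 := lintegral_mono' (surf_restrict_ball_le hΩ ha hch (r := ρ / 2) (by linarith))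
    (le_refl fun x => ‖f x‖ₑ)
  rw [lintegral_smul_measure, lintegral_map hfm hγ.continuous.measurable, smul_eq_mul] at h3
  rw [mul_assoc]
  exact h3.trans (mul_le_mul_right h2 _)

end Trace

/-! ### The space `V_r` -/

/-- Subadditivity and boundedness make the functional Lipschitz. It serves for the seminorms on the
right-hand side of inequalities that are extended by density. -/
lemma continuous_of_le_add_of_le_mul_enorm {F : Type*} [SeminormedAddCommGroup F] {N : F → ℝ≥0∞}
    {C : ℝ≥0∞} (hC : C ≠ ⊤) (hadd : ∀ u v, N u ≤ N v + N (u - v)) (hb : ∀ u, N u ≤ C * ‖u‖ₑ) :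
    Continuous N := by
  have hfin : ∀ u, N u ≠ ⊤ := fun u =>
    ((hb u).trans_lt (ENNReal.mul_lt_top hC.lt_top enorm_lt_top)).ne
  have hle : ∀ u v, (N u).toReal - (N v).toReal ≤ C.toReal * ‖u - v‖ := fun u v => by
    have h1 := ENNReal.toReal_mono (ENNReal.add_ne_top.2
      ⟨hfin v, (ENNReal.mul_lt_top hC.lt_top enorm_lt_top).ne⟩)
      ((hadd u v).trans (add_le_add le_rfl (hb (u - v))))
    rw [ENNReal.toReal_add (hfin v) (ENNReal.mul_lt_top hC.lt_top enorm_lt_top).ne,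
      ENNReal.toReal_mul, toReal_enorm] at h1
    linarith
  have hlip : LipschitzWith C.toReal.toNNReal fun u => (N u).toReal := by
    refine LipschitzWith.of_dist_le_mul fun u v => ?_
    rw [Real.coe_toNNReal _ ENNReal.toReal_nonneg, Real.dist_eq, dist_eq_norm, abs_le]
    have h1 := hle u v
    have h2 := hle v u
    rw [norm_sub_rev] at h2
    constructor <;> linarith
  have : N = fun u => ENNReal.ofReal (N u).toReal := funext fun u => (ENNReal.ofReal_toReal (hfin u)).symm
  rw [this]
  exact ENNReal.continuous_ofReal.comp hlip.continuous

lemma IsBoundedLipschitzDomain.isFiniteMeasure_vol {Ω : Set E3} (hΩ : IsBoundedLipschitzDomain Ω) :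
    IsFiniteMeasure (vol Ω) :=
  ⟨by rw [Measure.restrict_apply_univ]; exact hΩ.isBounded.measure_lt_top⟩

section Fields

variable {Ω : Set E3} {r : ℝ} [Fact (1 ≤ ENNReal.ofReal r)]

/-- `v` is the element of `V_r` given by the admissible field `w`, which is Lipschitz on `ℝ³` and
has compact support. -/
def V.IsFieldOf (v : V Ω r) (w : E3 → E3) : Prop :=
  (∃ K, LipschitzWith K w) ∧ HasCompactSupport w ∧ IsAdmissible Ω w ∧ RepresentsV Ω r v.1 w

/-- The source of all density arguments. Admissible fields are replaced by compactly supported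
extensions, which changes neither their values on the closure nor their gradients in `Ω`. -/
lemma V.dense_isFieldOf (hΩ : IsBoundedLipschitzDomain Ω) :
    Dense {v : V Ω r | ∃ w, V.IsFieldOf v w} := by
  have hsub : ∀ x (hx : x ∈ preV Ω r), (⟨x, subset_closure hx⟩ : V Ω r) ∈
      {v : V Ω r | ∃ w, V.IsFieldOf v w} := fun x hx => by
    obtain ⟨v, hv, h1, h2, h3, h4⟩ := (mem_preV_iff hΩ.isOpen).1 hx
    obtain ⟨w, K, hK, hc, hw, heq⟩ := hv.exists_extension hΩ.isOpen hΩ.isBounded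
    have hE : v =ᵐ[vol Ω] w := by
      filter_upwards [ae_restrict_mem hΩ.isOpen.measurableSet] with y hy
      exact heq (subset_closure hy)
    refine ⟨w, ⟨K, hK⟩, hc, hw, h1.trans hE, h2.trans ?_, h3.trans hE, h4.trans ?_⟩
    · filter_upwards [ae_restrict_mem hΩ.isOpen.measurableSet] with y hy
      exact grad_congr hΩ.isOpen (heq.mono subset_closure) hy
    · filter_upwards [ae_restrict_mem isClosed_frontier.measurableSet] with y hy
      exact heq (frontier_subset_closure hy)
  intro v
  obtain ⟨x, hx, hxv⟩ := mem_closure_iff_seq_limit.1 v.2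
  have hlim : Tendsto (fun n => (⟨x n, subset_closure (hx n)⟩ : V Ω r)) atTop (𝓝 v) :=
    tendsto_subtype_rng.2 hxv
  exact mem_closure_of_tendsto hlim (Eventually.of_forall fun n => hsub _ (hx n))

lemma V.vel_sub (u v : V Ω r) : V.vel (u - v) =ᵐ[vol Ω] V.vel u - V.vel v := Lp.coeFn_sub u.1.1 v.1.1
lemma V.gradient_sub (u v : V Ω r) : V.gradient (u - v) =ᵐ[vol Ω] V.gradient u - V.gradient v :=
  Lp.coeFn_sub u.1.2.1 v.1.2.1
lemma V.trace_sub (u v : V Ω r) : V.trace (u - v) =ᵐ[surf Ω] V.trace u - V.trace v :=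
  Lp.coeFn_sub u.1.2.2.2 v.1.2.2.2

lemma V.memLp_vel (v : V Ω r) : MemLp (V.vel v) (ENNReal.ofReal r) (vol Ω) := Lp.memLp v.1.1
lemma V.memLp_gradient (v : V Ω r) : MemLp (V.gradient v) (ENNReal.ofReal r) (vol Ω) :=
  Lp.memLp v.1.2.1
lemma V.memLp_trace (v : V Ω r) : MemLp (V.trace v) 2 (surf Ω) := Lp.memLp v.1.2.2.2

lemma V.eLpNorm_vel_le (v : V Ω r) : eLpNorm (V.vel v) (ENNReal.ofReal r) (vol Ω) ≤ ‖v‖ₑ := by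
  have h : ‖v.1.1‖ ≤ ‖v‖ := norm_fst_le v.1
  have := ENNReal.ofReal_le_ofReal h
  rwa [ofReal_norm, ofReal_norm, Lp.enorm_def] at this

lemma V.eLpNorm_gradient_le (v : V Ω r) :
    eLpNorm (V.gradient v) (ENNReal.ofReal r) (vol Ω) ≤ ‖v‖ₑ := by
  have h : ‖v.1.2.1‖ ≤ ‖v‖ := (norm_fst_le v.1.2).trans (norm_snd_le v.1)
  have := ENNReal.ofReal_le_ofReal h
  rwa [ofReal_norm, ofReal_norm, Lp.enorm_def] at this

lemma V.continuous_vel : Continuous fun v : V Ω r => v.1.1 :=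
  continuous_fst.comp continuous_subtype_val
lemma V.continuous_velL2 : Continuous fun v : V Ω r => v.1.2.2.1 :=
  continuous_fst.comp (continuous_snd.comp (continuous_snd.comp continuous_subtype_val))
lemma V.continuous_trace : Continuous fun v : V Ω r => v.1.2.2.2 :=
  continuous_snd.comp (continuous_snd.comp (continuous_snd.comp continuous_subtype_val))

/-- A bound of an `L^p` seminorm by a continuous function passes from admissible fields to `V_r`. -/
lemma V.eLpNorm_le_of_isFieldOf (hΩ : IsBoundedLipschitzDomain Ω) {F : Type*} [NormedAddCommGroup F]
    {μ : Measure E3} {q P : ℝ≥0∞} [Fact (1 ≤ q)] {X : V Ω r → Lp F q μ} (hX : Continuous X)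
    {Ψ : V Ω r → ℝ≥0∞} (hΨ : Continuous Ψ) {μ' : Measure E3} (hμ : μ' ≪ μ)
    (h : ∀ v w, V.IsFieldOf v w → eLpNorm (X v) P μ' ≤ Ψ v) (v : V Ω r) :
    eLpNorm (X v) P μ' ≤ Ψ v := by
  obtain ⟨x, hx, hxv⟩ := mem_closure_iff_seq_limit.1 (V.dense_isFieldOf hΩ v)
  have hXv := (hX.tendsto v).comp hxv
  -- Lower semicontinuity suffices: Fatou's lemma along an almost everywhere convergent subsequence.
  -- Finiteness or continuity of the `L^P` seminorm need not be known beforehand.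
  obtain ⟨ns, hns, hae⟩ := (tendstoInMeasure_of_tendsto_Lp hXv).exists_seq_tendsto_ae
  have h1 := Lp.eLpNorm_lim_le_liminf_eLpNorm (p := P) (μ := μ') (f := fun n => X (x (ns n)))
    (fun n => (Lp.aestronglyMeasurable _).mono_ac hμ) (X v) (hμ.ae_le hae)
  refine h1.trans ?_
  have h2 : Tendsto (fun n => Ψ (x (ns n))) atTop (𝓝 (Ψ v)) :=
    (hΨ.tendsto v).comp (hxv.comp hns.tendsto_atTop)
  rw [← h2.liminf_eq]
  refine liminf_le_liminf (Eventually.of_forall fun n => ?_)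
  obtain ⟨w, hw⟩ := hx (ns n)
  exact h _ _ hw

/-- The `L^r` and `L²` components agree for admissible fields, and limits in measure are unique.
This connects the norm of `H` with the velocity used in the forms. -/
lemma V.vel_ae_eq (hΩ : IsBoundedLipschitzDomain Ω) (v : V Ω r) : V.vel v =ᵐ[vol Ω] v.1.2.2.1 := by
  obtain ⟨x, hx, hxv⟩ := mem_closure_iff_seq_limit.1 (V.dense_isFieldOf hΩ v)
  have h1 := tendstoInMeasure_of_tendsto_Lp ((V.continuous_vel.tendsto v).comp hxv)
  have h2 := tendstoInMeasure_of_tendsto_Lp ((V.continuous_velL2.tendsto v).comp hxv)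
  refine tendstoInMeasure_ae_unique h1 (h2.congr_left fun n => ?_)
  obtain ⟨w, _, _, _, e1, -, e2, -⟩ := hx n
  exact e2.trans e1.symm

/-- On a bounded domain the `L^p` seminorm dominates the `L^q` seminorm, `q ≤ p`. -/
lemma exists_eLpNorm_le_of_le {F : Type*} [NormedAddCommGroup F] (hΩ : IsBoundedLipschitzDomain Ω)
    {q p : ℝ≥0∞} (hq0 : q ≠ 0) (hq : q ≤ p) : ∃ C : ℝ≥0∞, C ≠ ⊤ ∧ ∀ f : E3 → F,
      AEStronglyMeasurable f (vol Ω) → eLpNorm f q (vol Ω) ≤ C * eLpNorm f p (vol Ω) := by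
  have := hΩ.isFiniteMeasure_vol
  refine ⟨vol Ω univ ^ (1 / q.toReal - 1 / p.toReal), ?_, fun f hf => ?_⟩
  · refine ENNReal.rpow_ne_top_of_nonneg ?_ (measure_ne_top _ _)
    rcases eq_or_ne p ⊤ with rfl | hp
    · simp
    · have h1 : 0 < q.toReal := ENNReal.toReal_pos hq0 (ne_top_of_le_ne_top hp hq)
      have h2 := ENNReal.toReal_mono hp hq
      rw [sub_nonneg]
      exact one_div_le_one_div_of_le h1 h2
  · rw [mul_comm]
    exact eLpNorm_le_eLpNorm_mul_rpow_measure_univ hq hf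

lemma V.continuous_eLpNorm_vel (hΩ : IsBoundedLipschitzDomain Ω) {q : ℝ≥0∞} (hq1 : 1 ≤ q)
    (hq : q ≤ ENNReal.ofReal r) : Continuous fun v : V Ω r => eLpNorm (V.vel v) q (vol Ω) := by
  obtain ⟨C, hC, hle⟩ := exists_eLpNorm_le_of_le (F := E3) hΩ (one_pos.trans_le hq1).ne' hq
  refine continuous_of_le_add_of_le_mul_enorm hC (fun u v => ?_) fun u => ?_
  · have : V.vel u =ᵐ[vol Ω] V.vel v + V.vel (u - v) := by
      filter_upwards [V.vel_sub u v] with x hx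
      simp [hx]
    rw [eLpNorm_congr_ae this]
    exact eLpNorm_add_le (V.memLp_vel _).1 (V.memLp_vel _).1 hq1
  · exact (hle _ (V.memLp_vel u).1).trans (mul_le_mul_right (V.eLpNorm_vel_le u) _)

lemma V.continuous_eLpNorm_clm_gradient (hΩ : IsBoundedLipschitzDomain Ω) {q : ℝ≥0∞} (hq1 : 1 ≤ q)
    (hq : q ≤ ENNReal.ofReal r) (A : T3 →L[ℝ] T3) :
    Continuous fun v : V Ω r => eLpNorm (fun x => A (V.gradient v x)) q (vol Ω) := by
  obtain ⟨C, hC, hle⟩ := exists_eLpNorm_le_of_le (F := T3) hΩ (one_pos.trans_le hq1).ne' hq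
  have hm : ∀ v : V Ω r, AEStronglyMeasurable (fun x => A (V.gradient v x)) (vol Ω) := fun v =>
    A.continuous.comp_aestronglyMeasurable (V.memLp_gradient v).1
  refine continuous_of_le_add_of_le_mul_enorm (C := ‖A‖ₑ * C) (ENNReal.mul_ne_top enorm_ne_top hC)
    (fun u v => ?_) fun u => ?_
  · have : (fun x => A (V.gradient u x)) =ᵐ[vol Ω]
        (fun x => A (V.gradient v x)) + fun x => A (V.gradient (u - v) x) := by
      filter_upwards [V.gradient_sub u v] with x hx
      simp [hx]
    rw [eLpNorm_congr_ae this]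
    exact eLpNorm_add_le (hm _) (hm _) hq1
  · have h1 : eLpNorm (fun x => A (V.gradient u x)) q (vol Ω) ≤
        ‖A‖ₑ * eLpNorm (V.gradient u) q (vol Ω) := by
      refine eLpNorm_le_mul_eLpNorm_of_ae_le_mul'' _ (V.memLp_gradient u).1
        (Eventually.of_forall fun x => ?_)
      exact A.le_opENorm _
    rw [mul_assoc]
    refine h1.trans (mul_le_mul_right ?_ _)
    exact (hle _ (V.memLp_gradient u).1).trans (mul_le_mul_right (V.eLpNorm_gradient_le u) _)

end Fields

/-! ### The Korn-Sobolev inequality on `V_r` -/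

section Korn

variable {Ω : Set E3} {r : ℝ} [Fact (1 ≤ ENNReal.ofReal r)]

lemma eLpNorm_two_eq {F : Type*} [NormedAddCommGroup F] {μ : Measure E3} (f : E3 → F) :
    eLpNorm f 2 μ = (∫⁻ x, ‖f x‖ₑ ^ (2 : ℝ) ∂μ) ^ (1 / 2 : ℝ) := by
  rw [eLpNorm_eq_lintegral_rpow_enorm_toReal (by norm_num) (by norm_num)]
  norm_num

/-- The Korn-Sobolev inequality on `V_r`, with exponent `2 * r / (r - 1)`. -/
lemma V.exists_eLpNorm_vel_le (hΩ : IsBoundedLipschitzDomain Ω) (hr : 2 < r) :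
    ∃ C : ℝ≥0∞, C ≠ ⊤ ∧ ∃ δ₀ : ℝ, 0 < δ₀ ∧ ∀ δ : ℝ, 0 < δ → δ ≤ δ₀ → ∀ w : V Ω r,
      eLpNorm (V.vel w) (ENNReal.ofReal (2 * r / (r - 1))) (vol Ω) ≤
        C * ENNReal.ofReal δ ^ (-(3 / (2 * r))) * (eLpNorm (V.vel w) 2 (vol Ω) +
          ENNReal.ofReal δ * eLpNorm (fun x => symPart (V.gradient w x)) 2 (vol Ω)) := by
  have hr1 : 0 < r - 1 := by linarith
  obtain ⟨p, hp⟩ : ∃ p, p = 2 * r / (r - 1) := ⟨_, rfl⟩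
  have hp2 : 2 < p := by rw [hp, lt_div_iff₀ hr1]; linarith
  have hp6 : p < 6 := by rw [hp, div_lt_iff₀ hr1]; linarith
  have hp0 : 0 < p := by linarith
  -- Taking the `p`-th root turns the scaling exponent of the potential estimate into `3 * (p - 2) /
  -- (2 * p)`, and `p = 2 * r / (r - 1)`.
  have hexp : -(3 * (p - 2) / 2) * p⁻¹ = -(3 / (2 * r)) := by
    rw [hp]
    field_simp
    ring
  obtain ⟨C, hC, δ₀, hδ₀, h⟩ := exists_kornSobolevOn_univ hΩ hp2 hp6
  have h2r : (2 : ℝ≥0∞) ≤ ENNReal.ofReal r := by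
    rw [← ENNReal.ofReal_ofNat]
    exact ENNReal.ofReal_le_ofReal hr.le
  refine ⟨C ^ p⁻¹, ENNReal.rpow_ne_top_of_nonneg (by positivity) hC, δ₀, hδ₀,
    fun δ hδ hδle => ?_⟩
  rw [← hp]
  refine V.eLpNorm_le_of_isFieldOf hΩ V.continuous_vel ?_ Measure.AbsolutelyContinuous.rfl ?_
  · have hc1 := V.continuous_eLpNorm_vel (r := r) hΩ one_le_two h2r
    have hc2 := V.continuous_eLpNorm_clm_gradient (r := r) hΩ one_le_two h2r symPartL
    have hd0 : ENNReal.ofReal δ ^ (-(3 / (2 * r))) ≠ ⊤ :=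
      ENNReal.rpow_ne_top_of_ne_zero (by simpa using hδ) ENNReal.ofReal_ne_top
    refine (ENNReal.continuous_const_mul (ENNReal.mul_ne_top
      (ENNReal.rpow_ne_top_of_nonneg (by positivity) hC) hd0)).comp (hc1.add ?_)
    exact (ENNReal.continuous_const_mul ENNReal.ofReal_ne_top).comp hc2
  · rintro v w ⟨⟨K, hK⟩, -, -, e1, e2, -, -⟩
    have e2' : (fun x => symPart (V.gradient v x)) =ᵐ[vol Ω] fun x => symPart (grad w x) := by
      filter_upwards [e2] with x hx
      exact congrArg symPart hx
    have e1' : V.vel v =ᵐ[vol Ω] w := e1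
    have hk := h δ hδ hδle w K hK
    rw [inter_eq_left.2 subset_closure] at hk
    rw [eLpNorm_congr_ae e1, eLpNorm_congr_ae e1', eLpNorm_congr_ae e2', eLpNorm_two_eq,
      eLpNorm_two_eq, eLpNorm_eq_lintegral_rpow_enorm_toReal (by simpa using hp0)
      ENNReal.ofReal_ne_top, ENNReal.toReal_ofReal hp0.le, one_div]
    refine (ENNReal.rpow_le_rpow hk (inv_nonneg.2 hp0.le)).trans ?_
    rw [ENNReal.mul_rpow_of_nonneg _ _ (inv_nonneg.2 hp0.le),
      ENNReal.mul_rpow_of_nonneg _ _ (inv_nonneg.2 hp0.le), ← ENNReal.rpow_mul, hexp]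
    refine mul_le_mul_right ?_ _
    have h3 : ∀ x : ℝ≥0∞, x ^ (p / 2) = (x ^ (1 / 2 : ℝ)) ^ p := fun x => by
      rw [← ENNReal.rpow_mul]
      congr 1
      ring
    rw [h3, h3, ← ENNReal.mul_rpow_of_nonneg _ _ hp0.le, ← one_div]
    exact ENNReal.rpow_add_rpow_le_add _ _ (by linarith)

/-- A fixed scale suffices here; the resulting embedding makes the convective form bounded on `V_r`.
-/
lemma V.exists_eLpNorm_vel_le_mul_enorm (hΩ : IsBoundedLipschitzDomain Ω) (hr : 2 < r) :
    ∃ C : ℝ≥0∞, C ≠ ⊤ ∧ ∀ w : V Ω r,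
      eLpNorm (V.vel w) (ENNReal.ofReal (2 * r / (r - 1))) (vol Ω) ≤ C * ‖w‖ₑ := by
  obtain ⟨C, hC, δ, hδ, h⟩ := V.exists_eLpNorm_vel_le (r := r) hΩ hr
  have h2r : (2 : ℝ≥0∞) ≤ ENNReal.ofReal r := by
    rw [← ENNReal.ofReal_ofNat]
    exact ENNReal.ofReal_le_ofReal hr.le
  obtain ⟨C₁, hC₁, h₁⟩ := exists_eLpNorm_le_of_le (F := E3) hΩ two_ne_zero h2r
  obtain ⟨C₂, hC₂, h₂⟩ := exists_eLpNorm_le_of_le (F := T3) hΩ two_ne_zero h2r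
  have hd0 : ENNReal.ofReal δ ^ (-(3 / (2 * r))) ≠ ⊤ :=
    ENNReal.rpow_ne_top_of_ne_zero (by simpa using hδ) ENNReal.ofReal_ne_top
  refine ⟨C * ENNReal.ofReal δ ^ (-(3 / (2 * r))) *
    (C₁ + ENNReal.ofReal δ * (‖symPartL‖ₑ * C₂)), ?_, fun w => (h δ hδ le_rfl w).trans ?_⟩
  · exact ENNReal.mul_ne_top (ENNReal.mul_ne_top hC hd0) (ENNReal.add_ne_top.2 ⟨hC₁,
      ENNReal.mul_ne_top ENNReal.ofReal_ne_top (ENNReal.mul_ne_top enorm_ne_top hC₂)⟩)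
  · rw [mul_assoc (_ * _), add_mul]
    refine mul_le_mul_right (add_le_add ?_ ?_) _
    · exact (h₁ _ (V.memLp_vel w).1).trans (mul_le_mul_right (V.eLpNorm_vel_le w) _)
    · rw [mul_assoc, mul_assoc]
      refine mul_le_mul_right (le_trans ?_ (mul_le_mul_right ((h₂ _ (V.memLp_gradient w).1).trans
        (mul_le_mul_right (V.eLpNorm_gradient_le w) _)) _)) _
      exact eLpNorm_le_mul_eLpNorm_of_ae_le_mul'' _ (V.memLp_gradient w).1
        (Eventually.of_forall fun x => symPartL.le_opENorm _)

lemma V.memLp_vel_two_mul_conj (hΩ : IsBoundedLipschitzDomain Ω) (hr : 2 < r) (w : V Ω r) :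
    MemLp (V.vel w) (ENNReal.ofReal (2 * r / (r - 1))) (vol Ω) := by
  obtain ⟨C, hC, h⟩ := V.exists_eLpNorm_vel_le_mul_enorm (r := r) hΩ hr
  exact ⟨(V.memLp_vel w).1, (h w).trans_lt (ENNReal.mul_lt_top hC.lt_top enorm_lt_top)⟩

end Korn

/-! ### The convective form -/

section Convection

lemma outer_sub_left (a b c : E3) : outer (a - b) c = outer a c - outer b c := by
  ext p
  simp [outer, sub_mul]

lemma outer_sub_right (a b c : E3) : outer a (b - c) = outer a b - outer a c := by
  ext p
  simp [outer, mul_sub]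

lemma continuous_outer : Continuous fun p : E3 × E3 => outer p.1 p.2 := by
  unfold outer
  fun_prop

/-- Hölder with `(r - 1) / (2 * r) + (r - 1) / (2 * r) + 1 / r = 1`. This fixes the exponent in
which velocities must be controlled. -/
lemma eLpNorm_inner_outer_le {r : ℝ} (hr : 2 < r) {f g : E3 → E3} {h : E3 → T3} {μ : Measure E3}
    (hf : AEStronglyMeasurable f μ) (hg : AEStronglyMeasurable g μ)
    (hh : AEStronglyMeasurable h μ) :
    eLpNorm (fun x => ⟪outer (f x) (g x), h x⟫) 1 μ ≤
      eLpNorm f (ENNReal.ofReal (2 * r / (r - 1))) μ *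
        eLpNorm g (ENNReal.ofReal (2 * r / (r - 1))) μ * eLpNorm h (ENNReal.ofReal r) μ := by
  have hr1 : 0 < r - 1 := by linarith
  have t1 : ENNReal.HolderTriple (ENNReal.ofReal (2 * r / (r - 1)))
      (ENNReal.ofReal (2 * r / (r - 1))) (ENNReal.ofReal (r / (r - 1))) :=
    Real.HolderTriple.ennrealOfReal ⟨by field_simp; norm_num, by positivity, by positivity⟩
  have t2 : ENNReal.HolderConjugate (ENNReal.ofReal (r / (r - 1))) (ENNReal.ofReal r) :=
    Real.HolderConjugate.ennrealOfReal ⟨by field_simp; ring, by positivity, by positivity⟩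
  have ho : AEStronglyMeasurable (fun x => outer (f x) (g x)) μ :=
    continuous_outer.comp_aestronglyMeasurable (hf.prodMk hg)
  have h1 := eLpNorm_le_eLpNorm_mul_eLpNorm'_of_norm (p := ENNReal.ofReal (2 * r / (r - 1)))
    (q := ENNReal.ofReal (2 * r / (r - 1))) (r := ENNReal.ofReal (r / (r - 1))) hf hg
    outer 1 (Eventually.of_forall fun x => by simp [norm_outer])
  have h2 := eLpNorm_le_eLpNorm_mul_eLpNorm'_of_norm (p := ENNReal.ofReal (r / (r - 1)))
    (q := ENNReal.ofReal r) (r := 1) ho hh (fun A B => ⟪A, B⟫) 1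
    (Eventually.of_forall fun x => by simpa using norm_inner_le_norm (𝕜 := ℝ) _ _)
  rw [ENNReal.coe_one, one_mul] at h1 h2
  exact h2.trans (mul_le_mul_left h1 _)

variable {Ω : Set E3} {r : ℝ} [Fact (1 ≤ ENNReal.ofReal r)]

lemma V.integrable_inner_outer (hΩ : IsBoundedLipschitzDomain Ω) (hr : 2 < r) (u w z : V Ω r) :
    Integrable (fun x => ⟪outer (V.vel w x) (V.vel u x), V.gradient z x⟫) (vol Ω) := by
  have hw := V.memLp_vel_two_mul_conj hΩ hr w
  have hu := V.memLp_vel_two_mul_conj hΩ hr u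
  rw [← memLp_one_iff_integrable]
  refine ⟨?_, (eLpNorm_inner_outer_le hr hw.1 hu.1 (V.memLp_gradient z).1).trans_lt ?_⟩
  · exact (continuous_outer.comp_aestronglyMeasurable (hw.1.prodMk hu.1)).inner
      (V.memLp_gradient z).1
  · exact ENNReal.mul_lt_top (ENNReal.mul_lt_top hw.2 hu.2) (V.memLp_gradient z).2

/-- The convective form `∫_Ω (w ⊗ u) : ∇z dx`. -/
def convForm (u w z : V Ω r) : ℝ :=
  ∫ x, ⟪outer (V.vel w x) (V.vel u x), V.gradient z x⟫ ∂(vol Ω)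

lemma abs_convForm_le (hΩ : IsBoundedLipschitzDomain Ω) (hr : 2 < r) (u w z : V Ω r) :
    |convForm u w z| ≤ (eLpNorm (V.vel w) (ENNReal.ofReal (2 * r / (r - 1))) (vol Ω)).toReal *
      (eLpNorm (V.vel u) (ENNReal.ofReal (2 * r / (r - 1))) (vol Ω)).toReal * ‖z‖ := by
  have hw := V.memLp_vel_two_mul_conj hΩ hr w
  have hu := V.memLp_vel_two_mul_conj hΩ hr u
  have h1 := eLpNorm_inner_outer_le hr hw.1 hu.1 (V.memLp_gradient z).1
  rw [eLpNorm_one_eq_lintegral_enorm] at h1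
  have h2 := ((enorm_integral_le_lintegral_enorm _).trans h1).trans
    (mul_le_mul_right (V.eLpNorm_gradient_le z) _)
  have h3 := ENNReal.toReal_mono
    (ENNReal.mul_ne_top (ENNReal.mul_ne_top hw.2.ne hu.2.ne) enorm_ne_top) h2
  rwa [ENNReal.toReal_mul, ENNReal.toReal_mul, toReal_enorm, toReal_enorm] at h3

lemma exists_abs_convForm_le (hΩ : IsBoundedLipschitzDomain Ω) (hr : 2 < r) :
    ∃ C : ℝ, ∀ u w z : V Ω r, |convForm u w z| ≤ C * ‖u‖ * ‖w‖ * ‖z‖ := by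
  obtain ⟨C, hC, h⟩ := V.exists_eLpNorm_vel_le_mul_enorm (r := r) hΩ hr
  have h' : ∀ w : V Ω r, (eLpNorm (V.vel w) (ENNReal.ofReal (2 * r / (r - 1))) (vol Ω)).toReal ≤
      C.toReal * ‖w‖ := fun w => by
    have := ENNReal.toReal_mono (ENNReal.mul_ne_top hC enorm_ne_top) (h w)
    rwa [ENNReal.toReal_mul, toReal_enorm] at this
  refine ⟨C.toReal * C.toReal, fun u w z => (abs_convForm_le hΩ hr u w z).trans ?_⟩
  calc _ ≤ (C.toReal * ‖w‖) * (C.toReal * ‖u‖) * ‖z‖ := by gcongr <;> exact h' _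
    _ = _ := by ring

lemma convForm_sub_left (hΩ : IsBoundedLipschitzDomain Ω) (hr : 2 < r) (u u' w z : V Ω r) :
    convForm (u - u') w z = convForm u w z - convForm u' w z := by
  rw [convForm, convForm, convForm, ← integral_sub (V.integrable_inner_outer hΩ hr _ _ _)
    (V.integrable_inner_outer hΩ hr _ _ _)]
  refine integral_congr_ae ?_
  filter_upwards [V.vel_sub u u'] with x hx
  rw [hx, Pi.sub_apply, outer_sub_right, inner_sub_left]

lemma convForm_sub_middle (hΩ : IsBoundedLipschitzDomain Ω) (hr : 2 < r) (u w w' z : V Ω r) :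
    convForm u (w - w') z = convForm u w z - convForm u w' z := by
  rw [convForm, convForm, convForm, ← integral_sub (V.integrable_inner_outer hΩ hr _ _ _)
    (V.integrable_inner_outer hΩ hr _ _ _)]
  refine integral_congr_ae ?_
  filter_upwards [V.vel_sub w w'] with x hx
  rw [hx, Pi.sub_apply, outer_sub_left, inner_sub_left]

lemma convForm_sub_right (hΩ : IsBoundedLipschitzDomain Ω) (hr : 2 < r) (u w z z' : V Ω r) :
    convForm u w (z - z') = convForm u w z - convForm u w z' := by
  rw [convForm, convForm, convForm, ← integral_sub (V.integrable_inner_outer hΩ hr _ _ _)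
    (V.integrable_inner_outer hΩ hr _ _ _)]
  refine integral_congr_ae ?_
  filter_upwards [V.gradient_sub z z'] with x hx
  rw [hx, Pi.sub_apply, inner_sub_right]

lemma continuous_of_sub_of_bound {E : Type*} [SeminormedAddCommGroup E] {F : E → ℝ} {C : ℝ}
    (hsub : ∀ u v, F (u - v) = F u - F v) (hb : ∀ u, |F u| ≤ C * ‖u‖) : Continuous F := by
  refine (LipschitzWith.of_dist_le_mul (K := C.toNNReal) fun u v => ?_).continuous
  rw [Real.dist_eq, ← hsub, dist_eq_norm]
  exact (hb _).trans (mul_le_mul_of_nonneg_right (Real.le_coe_toNNReal C) (norm_nonneg _))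

/-- The convective form is skew-symmetric in its last two arguments. -/
theorem convForm_skew (hΩ : IsBoundedLipschitzDomain Ω) (hr : 2 < r) (u w z : V Ω r) :
    convForm u w z + convForm u z w = 0 := by
  obtain ⟨C, hC⟩ := exists_abs_convForm_le (r := r) hΩ hr
  have hC' : ∀ u w z : V Ω r, |convForm u w z + convForm u z w| ≤ 2 * C * ‖u‖ * ‖w‖ * ‖z‖ :=
    fun u w z => (abs_add_le _ _).trans (by linarith [hC u w z, hC u z w])
  -- The three arguments are reduced to Lipschitz fields one after the other: the form is bounded
  -- and additive in each.
  have hcl : ∀ F : V Ω r → ℝ, Continuous F → (∀ v w, V.IsFieldOf v w → F v = 0) → ∀ v, F v = 0 :=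
    fun F hF h v => isClosed_property (V.dense_isFieldOf hΩ).denseRange_val
      (isClosed_eq hF continuous_const) (fun ⟨v, w, hw⟩ => h v w hw) v
  revert u
  refine hcl _ (continuous_of_sub_of_bound (C := 2 * C * ‖w‖ * ‖z‖) (fun u u' => ?_) fun u => ?_)
    fun u fu hu => ?_
  · rw [convForm_sub_left hΩ hr, convForm_sub_left hΩ hr]
    ring
  · exact (hC' u w z).trans_eq (by ring)
  revert w
  refine hcl _ (continuous_of_sub_of_bound (C := 2 * C * ‖u‖ * ‖z‖) (fun w w' => ?_) fun w => ?_)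
    fun w fw hw => ?_
  · rw [convForm_sub_middle hΩ hr, convForm_sub_right hΩ hr]
    ring
  · exact (hC' u w z).trans_eq (by ring)
  revert z
  refine hcl _ (continuous_of_sub_of_bound (C := 2 * C * ‖u‖ * ‖w‖) (fun z z' => ?_) fun z => ?_)
    fun z fz hz => ?_
  · rw [convForm_sub_middle hΩ hr, convForm_sub_right hΩ hr]
    ring
  · exact (hC' u w z).trans_eq (by ring)
  obtain ⟨⟨Ku, hKu⟩, -, hau, hu1, hu2, -⟩ := hu
  obtain ⟨⟨Kw, hKw⟩, hwc, -, hw1, hw2, -⟩ := hw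
  obtain ⟨⟨Kz, hKz⟩, -, -, hz1, hz2, -⟩ := hz
  rw [convForm, convForm, ← integral_add (V.integrable_inner_outer hΩ hr _ _ _)
    (V.integrable_inner_outer hΩ hr _ _ _),
    ← integral_inner_outer_grad_add_eq_zero hΩ hKu hau hKw hwc hKz]
  refine integral_congr_ae ?_
  filter_upwards [hu1, hw1, hw2, hz1, hz2] with x e1 e2 e3 e4 e5
  rw [V.vel, V.vel, V.vel, V.gradient, V.gradient, e1, e2, e3, e4, e5]

end Convection

/-! ### Injectivity of `V_r → H` -/

lemma fderiv_coord {w : E3 → E3} {x : E3} (hd : DifferentiableAt ℝ w x) (i : Fin 3) (z : E3) :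
    fderiv ℝ (fun y => w y i) x z = fderiv ℝ w x z i := by
  have h := ((EuclideanSpace.proj (𝕜 := ℝ) i).hasFDerivAt.comp x hd.hasFDerivAt).fderiv
  exact congrArg (fun A => A z) h

lemma enorm_fderiv_coord_le {w : E3 → E3} {x : E3} (hd : DifferentiableAt ℝ w x) (i : Fin 3) {z : E3}
    (hz : ‖z‖ = 1) : ‖fderiv ℝ (fun y => w y i) x z‖ₑ ≤ ‖grad w x‖ₑ := by
  have h := inner_fderiv_eq w x z (EuclideanSpace.single i 1)
  rw [EuclideanSpace.inner_single_right] at h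
  rw [fderiv_coord hd, enorm_le_iff_norm_le]
  have h2 := norm_inner_le_norm (𝕜 := ℝ) (grad w x) (outer (EuclideanSpace.single i 1) z)
  rw [← h, norm_outer, hz] at h2
  simpa using h2

section Injectivity

variable {Ω : Set E3} {r : ℝ} [Fact (1 ≤ ENNReal.ofReal r)]

lemma V.integrable_gradient_apply (hΩ : IsBoundedLipschitzDomain Ω) (v : V Ω r) (p : Fin 3 × Fin 3) :
    Integrable (fun x => V.gradient v x p) (vol Ω) := by
  have := hΩ.isFiniteMeasure_vol
  have h := (V.memLp_gradient v).integrable Fact.out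
  exact (EuclideanSpace.proj (𝕜 := ℝ) p).integrable_comp h

lemma V.integrable_vel_apply (hΩ : IsBoundedLipschitzDomain Ω) (v : V Ω r) (i : Fin 3) :
    Integrable (fun x => V.vel v x i) (vol Ω) := by
  have := hΩ.isFiniteMeasure_vol
  have h := (V.memLp_vel v).integrable Fact.out
  exact (EuclideanSpace.proj (𝕜 := ℝ) i).integrable_comp h

/-- Integrating the gradient and the velocity against bounded functions is continuous on `V_r`. -/
lemma V.continuous_integral_add (hΩ : IsBoundedLipschitzDomain Ω) {g h : E3 → ℝ} (hg : Continuous g)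
    (hgc : HasCompactSupport g) (hh : Continuous h) (hhc : HasCompactSupport h) (i j : Fin 3) :
    Continuous fun v : V Ω r => (∫ x, g x * V.gradient v x (i, j) ∂(vol Ω)) +
      ∫ x, h x * V.vel v x i ∂(vol Ω) := by
  obtain ⟨A, hA⟩ := hgc.exists_bound_of_continuous hg
  obtain ⟨B, hB⟩ := hhc.exists_bound_of_continuous hh
  have hA0 : 0 ≤ A := (norm_nonneg _).trans (hA 0)
  have hB0 : 0 ≤ B := (norm_nonneg _).trans (hB 0)
  have i1 : ∀ v : V Ω r, Integrable (fun x => g x * V.gradient v x (i, j)) (vol Ω) := fun v =>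
    (V.integrable_gradient_apply hΩ v (i, j)).bdd_mul hg.aestronglyMeasurable
      (Eventually.of_forall hA)
  have i2 : ∀ v : V Ω r, Integrable (fun x => h x * V.vel v x i) (vol Ω) := fun v =>
    (V.integrable_vel_apply hΩ v i).bdd_mul hh.aestronglyMeasurable (Eventually.of_forall hB)
  obtain ⟨C₁, hC₁, h₁⟩ := exists_eLpNorm_le_of_le (F := T3) hΩ one_ne_zero
    (Fact.out : 1 ≤ ENNReal.ofReal r)
  obtain ⟨C₂, hC₂, h₂⟩ := exists_eLpNorm_le_of_le (F := E3) hΩ one_ne_zero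
    (Fact.out : 1 ≤ ENNReal.ofReal r)
  have key : ∀ {F : Type} [NormedAddCommGroup F] {f : E3 → F} {k c : E3 → ℝ} {M : ℝ}
      {D : ℝ≥0∞} {v : V Ω r}, 0 ≤ M → D ≠ ⊤ → (∀ x, ‖k x‖ ≤ M) → (∀ x, ‖c x‖ ≤ ‖f x‖) →
      eLpNorm f 1 (vol Ω) ≤ D * ‖v‖ₑ → |∫ x, k x * c x ∂(vol Ω)| ≤ M * D.toReal * ‖v‖ := by
    intro F _ f k c M D v hM hD hk hc hf
    have h1 : ‖∫ x, k x * c x ∂(vol Ω)‖ₑ ≤ ENNReal.ofReal M * (D * ‖v‖ₑ) := by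
      refine (enorm_integral_le_lintegral_enorm _).trans
        (le_trans ?_ (mul_le_mul_right hf _))
      rw [eLpNorm_one_eq_lintegral_enorm, ← lintegral_const_mul' _ _ ENNReal.ofReal_ne_top]
      refine lintegral_mono fun x => ?_
      rw [enorm_mul]
      refine mul_le_mul' ?_ (enorm_le_iff_norm_le.2 (hc x))
      rw [← ofReal_norm]
      exact ENNReal.ofReal_le_ofReal (hk x)
    have h2 := ENNReal.toReal_mono (ENNReal.mul_ne_top ENNReal.ofReal_ne_top
      (ENNReal.mul_ne_top hD enorm_ne_top)) h1
    rwa [ENNReal.toReal_mul, ENNReal.toReal_mul, toReal_enorm, toReal_enorm,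
      ENNReal.toReal_ofReal hM, ← mul_assoc] at h2
  refine (continuous_of_sub_of_bound (C := A * C₁.toReal) (fun u v => ?_) fun v => ?_).add
    (continuous_of_sub_of_bound (C := B * C₂.toReal) (fun u v => ?_) fun v => ?_)
  · rw [← integral_sub (i1 u) (i1 v)]
    refine integral_congr_ae ?_
    filter_upwards [V.gradient_sub u v] with x hx
    simp [hx, mul_sub]
  · exact key hA0 hC₁ hA (fun x => PiLp.norm_apply_le (V.gradient v x) (i, j))
      ((h₁ _ (V.memLp_gradient v).1).trans (mul_le_mul_right (V.eLpNorm_gradient_le v) _))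
  · rw [← integral_sub (i2 u) (i2 v)]
    refine integral_congr_ae ?_
    filter_upwards [V.vel_sub u v] with x hx
    simp [hx, mul_sub]
  · exact key hB0 hC₂ hB (fun x => PiLp.norm_apply_le (V.vel v x) i)
      ((h₂ _ (V.memLp_vel v).1).trans (mul_le_mul_right (V.eLpNorm_vel_le v) _))

/-- The gradient of an element of `V_r` is the weak gradient of its velocity field. -/
lemma V.integral_mul_gradient_eq (hΩ : IsBoundedLipschitzDomain Ω) (v : V Ω r) {g : E3 → ℝ}
    (hg : ContDiff ℝ ∞ g) (hgc : HasCompactSupport g) (hgs : tsupport g ⊆ Ω) (i j : Fin 3) :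
    (∫ x, g x * V.gradient v x (i, j) ∂(vol Ω)) +
      ∫ x, fderiv ℝ g x (EuclideanSpace.single j 1) * V.vel v x i ∂(vol Ω) = 0 := by
  have hdc : Continuous fun x => fderiv ℝ g x (EuclideanSpace.single j 1) :=
    (hg.continuous_fderiv (by simp)).clm_apply continuous_const
  have hds : HasCompactSupport fun x => fderiv ℝ g x (EuclideanSpace.single j 1) :=
    hgc.fderiv_apply ℝ _
  obtain ⟨Kg, hKg⟩ := ContDiff.lipschitzWith_of_hasCompactSupport hgc (hg.of_le (by simp)) one_ne_zero
  revert v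
  refine fun v => isClosed_property (V.dense_isFieldOf hΩ).denseRange_val
    (isClosed_eq (V.continuous_integral_add hΩ hg.continuous hgc hdc hds i j) continuous_const)
    (fun ⟨v, w, hw⟩ => ?_) v
  obtain ⟨⟨K, hK⟩, -, -, e1, e2, -⟩ := hw
  have h1 : ∫ x, g x * V.gradient v x (i, j) ∂(vol Ω) =
      ∫ x, g x * fderiv ℝ (fun y => w y i) x (EuclideanSpace.single j 1) := by
    have h0 : ∀ x, x ∉ Ω →
        g x * fderiv ℝ (fun y => w y i) x (EuclideanSpace.single j 1) = 0 := fun x hx => by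
      rw [image_eq_zero_of_notMem_tsupport fun h => hx (hgs h), zero_mul]
    rw [← setIntegral_eq_integral_of_forall_compl_eq_zero h0]
    refine integral_congr_ae ?_
    filter_upwards [e2, ae_restrict_of_ae (hK.ae_differentiableAt (μ := volume))] with x hx hd
    rw [fderiv_coord hd, V.gradient, hx]
    rfl
  have h2 : ∫ x, fderiv ℝ g x (EuclideanSpace.single j 1) * V.vel v x i ∂(vol Ω) =
      ∫ x, fderiv ℝ g x (EuclideanSpace.single j 1) * w x i := by
    have h0 : ∀ x, x ∉ Ω → fderiv ℝ g x (EuclideanSpace.single j 1) * w x i = 0 := fun x hx => by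
      rw [fderiv_eq_zero_of_notMem_tsupport fun h => hx (hgs h)]
      simp
    rw [← setIntegral_eq_integral_of_forall_compl_eq_zero h0]
    refine integral_congr_ae ?_
    filter_upwards [e1] with x hx
    rw [V.vel, hx]
  rw [h1, h2, integral_fderiv_mul_eq hKg (lipschitzWith_apply hK i) hgc, add_neg_cancel]

/-- In the closure the gradient is a separate component; being the weak gradient of the velocity, it
integrates to zero against every test function once the velocity vanishes. -/
lemma V.gradient_ae_eq_zero (hΩ : IsBoundedLipschitzDomain Ω) {v : V Ω r}
    (hv : V.vel v =ᵐ[vol Ω] 0) : V.gradient v =ᵐ[vol Ω] 0 := by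
  have h : ∀ p : Fin 3 × Fin 3, ∀ᵐ x ∂(vol Ω), V.gradient v x p = 0 := fun p => by
    rw [ae_restrict_iff' hΩ.isOpen.measurableSet]
    refine hΩ.isOpen.ae_eq_zero_of_integral_contDiff_smul_eq_zero
      (IntegrableOn.locallyIntegrableOn (V.integrable_gradient_apply hΩ v p)) fun g hg hgc hgs => ?_
    have h1 := V.integral_mul_gradient_eq hΩ v hg hgc hgs p.1 p.2
    have h2 : ∫ x, fderiv ℝ g x (EuclideanSpace.single p.2 1) * V.vel v x p.1 ∂(vol Ω) = 0 := by
      refine integral_eq_zero_of_ae ?_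
      filter_upwards [hv] with x hx
      simp [hx]
    rw [h2, add_zero, setIntegral_eq_integral_of_forall_compl_eq_zero fun x hx => by
      rw [image_eq_zero_of_notMem_tsupport fun h => hx (hgs h), zero_mul]] at h1
    exact h1
  filter_upwards [ae_all_iff.2 h] with x hx
  ext p
  exact hx p

/-- The local trace inequality on `V_r`. -/
lemma V.exists_eLpNorm_trace_le (hΩ : IsBoundedLipschitzDomain Ω) {x₀ : E3} (hx₀ : x₀ ∈ frontier Ω) :
    ∃ ρ > 0, ∃ C : ℝ≥0∞, C ≠ ⊤ ∧ ∀ v : V Ω r,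
      eLpNorm (V.trace v) 1 ((surf Ω).restrict (Metric.ball x₀ ρ)) ≤
        C * (eLpNorm (V.vel v) 1 (vol Ω) + eLpNorm (V.gradient v) 1 (vol Ω)) := by
  obtain ⟨L, a, K, ρ, ha, hρ, hch⟩ := hΩ.exists_chart hx₀
  obtain ⟨C, hC, htr⟩ := exists_lintegral_surf_ball_le hΩ.isOpen ha hρ hch
  have h1r : (1 : ℝ≥0∞) ≤ ENNReal.ofReal r := Fact.out
  refine ⟨ρ / 2, by positivity, 3 * C, ENNReal.mul_ne_top (by simp) hC, ?_⟩
  refine V.eLpNorm_le_of_isFieldOf hΩ V.continuous_trace ?_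
    (Measure.absolutelyContinuous_of_le Measure.restrict_le_self) ?_
  · refine (ENNReal.continuous_const_mul (ENNReal.mul_ne_top (by simp) hC)).comp ?_
    exact (V.continuous_eLpNorm_vel hΩ le_rfl h1r).add
      (V.continuous_eLpNorm_clm_gradient hΩ le_rfl h1r (ContinuousLinearMap.id ℝ T3))
  · rintro v w ⟨⟨Kw, hKw⟩, -, -, e1, e2, -, e4⟩
    have e1' : V.vel v =ᵐ[vol Ω] w := e1
    have e2' : V.gradient v =ᵐ[vol Ω] grad w := e2
    rw [eLpNorm_congr_ae (ae_restrict_of_ae e4), eLpNorm_congr_ae e1', eLpNorm_congr_ae e2',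
      eLpNorm_one_eq_lintegral_enorm, eLpNorm_one_eq_lintegral_enorm,
      eLpNorm_one_eq_lintegral_enorm]
    -- The scalar trace inequality applied to each component; summing the three gives the factor
    -- `3`.
    have hi : ∀ i : Fin 3, ∫⁻ x in Metric.ball x₀ (ρ / 2), ‖w x i‖ₑ ∂(surf Ω) ≤
        C * ((∫⁻ x in Ω, ‖w x‖ₑ) + ∫⁻ x in Ω, ‖grad w x‖ₑ) := fun i => by
      refine (htr _ Kw (lipschitzWith_apply hKw i)).trans (mul_le_mul_right (add_le_add ?_ ?_) _)
      · exact lintegral_mono fun x => enorm_le_iff_norm_le.2 (PiLp.norm_apply_le (w x) i)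
      · refine lintegral_mono_ae ?_
        filter_upwards [ae_restrict_of_ae (hKw.ae_differentiableAt (μ := volume))] with x hx
        exact enorm_fderiv_coord_le hx i norm_axis
    have hle : ∀ y : E3, ‖y‖ₑ ≤ ∑ i, ‖y i‖ₑ := fun y => by
      have hy : y = ∑ i, y i • EuclideanSpace.single i (1 : ℝ) := by
        ext k
        simp [Finset.sum_apply, Pi.single_apply]
      conv_lhs => rw [hy]
      refine (enorm_sum_le _ _).trans (Finset.sum_le_sum fun i _ => ?_)
      rw [enorm_smul, ← ofReal_norm (EuclideanSpace.single i (1 : ℝ)), PiLp.norm_single]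
      simp
    calc ∫⁻ x in Metric.ball x₀ (ρ / 2), ‖w x‖ₑ ∂(surf Ω)
        ≤ ∫⁻ x in Metric.ball x₀ (ρ / 2), ∑ i, ‖w x i‖ₑ ∂(surf Ω) :=
          lintegral_mono fun x => hle (w x)
      _ = ∑ i, ∫⁻ x in Metric.ball x₀ (ρ / 2), ‖w x i‖ₑ ∂(surf Ω) :=
          lintegral_finsetSum _ fun i _ => (lipschitzWith_apply hKw i).continuous.measurable.enorm
      _ ≤ ∑ _ : Fin 3, C * ((∫⁻ x in Ω, ‖w x‖ₑ) + ∫⁻ x in Ω, ‖grad w x‖ₑ) :=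
          Finset.sum_le_sum fun i _ => hi i
      _ = _ := by
          rw [Finset.sum_const, Finset.card_univ, Fintype.card_fin, nsmul_eq_mul, mul_assoc]
          norm_num

/-- Near each boundary point the trace is controlled by velocity and gradient, which both vanish.
Without this the independent trace component could survive when the inner product of `H` has no
boundary part. -/
lemma V.trace_ae_eq_zero (hΩ : IsBoundedLipschitzDomain Ω) {v : V Ω r}
    (hv : V.vel v =ᵐ[vol Ω] 0) : V.trace v =ᵐ[surf Ω] 0 := by
  have hgrad := V.gradient_ae_eq_zero hΩ hv
  change surf Ω {x | V.trace v x ≠ 0} = 0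
  rw [Measure.restrict_apply₀' isClosed_frontier.measurableSet.nullMeasurableSet]
  refine measure_null_of_locally_null _ fun x hx => ?_
  obtain ⟨ρ, hρ, C, -, h⟩ := V.exists_eLpNorm_trace_le (r := r) hΩ hx.2
  have h0 := h v
  rw [eLpNorm_congr_ae hv, eLpNorm_congr_ae hgrad, eLpNorm_zero, eLpNorm_zero, add_zero, mul_zero,
    nonpos_iff_eq_zero, eLpNorm_eq_zero_iff (V.memLp_trace v).1.restrict one_ne_zero] at h0
  refine ⟨({x | V.trace v x ≠ 0} ∩ frontier Ω) ∩ Metric.ball x ρ,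
    inter_mem self_mem_nhdsWithin (mem_nhdsWithin_of_mem_nhds (Metric.ball_mem_nhds x hρ)), ?_⟩
  have h1 : (surf Ω).restrict (Metric.ball x ρ) {x | V.trace v x ≠ 0} = 0 := h0
  rw [Measure.restrict_apply₀' measurableSet_ball.nullMeasurableSet,
    Measure.restrict_apply₀' isClosed_frontier.measurableSet.nullMeasurableSet] at h1
  rw [inter_right_comm]
  exact h1

/-- The natural map `V_r → H` is injective. -/
lemma toH_injective (hΩ : IsBoundedLipschitzDomain Ω) (β : ℝ) :
    Function.Injective (toH (Ω := Ω) (r := r) β) := by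
  refine (injective_iff_map_eq_zero _).2 fun v hv => ?_
  have h1 : v.1.2.2.1 = 0 := congrArg (fun y : H Ω β => y.1.fst) hv
  have hvel : V.vel v =ᵐ[vol Ω] 0 := (V.vel_ae_eq hΩ v).trans ((Lp.eq_zero_iff_ae_eq_zero).1 h1)
  refine Subtype.ext (Prod.ext ((Lp.eq_zero_iff_ae_eq_zero).2 hvel)
    (Prod.ext ((Lp.eq_zero_iff_ae_eq_zero).2 (V.gradient_ae_eq_zero hΩ hvel))
    (Prod.ext h1 ((Lp.eq_zero_iff_ae_eq_zero).2 (V.trace_ae_eq_zero hΩ hvel)))))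

lemma eLpNorm_vel_two_le_norm_toH (hΩ : IsBoundedLipschitzDomain Ω) (β : ℝ) (v : V Ω r) :
    eLpNorm (V.vel v) 2 (vol Ω) ≤ ‖toH β v‖ₑ := by
  have h1 : ‖v.1.2.2.1‖ ≤ ‖toH β v‖ := WithLp.norm_fst_le _ (toH β v).1
  have := ENNReal.ofReal_le_ofReal h1
  rwa [ofReal_norm, ofReal_norm, Lp.enorm_def, ← eLpNorm_congr_ae (V.vel_ae_eq hΩ v)] at this

end Injectivity

/-! ### The nonlinear form on `V_r` -/

section Stress

variable {r ν₁ ν₂ c₁ c₂ : ℝ} {S : T3 → T3}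

lemma continuous_symPart : Continuous symPart := symPartL.continuous

lemma symPart_sub (A B : T3) : symPart (A - B) = symPart A - symPart B := map_sub symPartL A B

/-- The growth condition controls `S` on symmetric matrices only, whence the composition with
`symPart`. -/
lemma IsStressLaw.continuous (hS : IsStressLaw r ν₁ ν₂ c₁ c₂ S) (hr : 2 < r) :
    Continuous fun A => S (symPart A) := by
  refine continuous_iff_continuousAt.2 fun A => ?_
  rw [ContinuousAt, tendsto_iff_norm_sub_tendsto_zero]
  have hc : Continuous fun B => c₁ * (ν₁ + ν₂ * (‖symPart B‖ + ‖symPart A‖) ^ (r - 2)) *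
      ‖symPart B - symPart A‖ := by
    have h1 : Continuous fun B => (‖symPart B‖ + ‖symPart A‖) ^ (r - 2) :=
      (continuous_symPart.norm.add continuous_const).rpow_const fun _ => Or.inr (by linarith)
    exact (continuous_const.mul (continuous_const.add (continuous_const.mul h1))).mul
      (continuous_symPart.sub continuous_const).norm
  have h0 := hc.tendsto A
  rw [sub_self, norm_zero, mul_zero] at h0
  exact squeeze_zero (fun _ => norm_nonneg _)
    (fun B => hS.growth _ _ (isSymm3_symPart B) (isSymm3_symPart A)) h0

/-- With `m` the maximum of `1` and the two norms, every factor is dominated by a power of `m`, in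
total by `m ^ r`. Hence the pairing of the stress with a gradient is integrable. -/
lemma IsStressLaw.norm_inner_le (hS : IsStressLaw r ν₁ ν₂ c₁ c₂ S) (hr : 2 < r) (hν₁ : 0 < ν₁)
    (hν₂ : 0 < ν₂) (hc₁ : 0 < c₁) (A B : T3) :
    ‖⟪S (symPart A), B⟫‖ ≤ c₁ * (ν₁ + ν₂) * (1 + ‖symPart A‖ ^ r + ‖B‖ ^ r) := by
  obtain ⟨x, hx⟩ : ∃ x, x = ‖symPart A‖ := ⟨_, rfl⟩
  obtain ⟨y, hy⟩ : ∃ y, y = ‖B‖ := ⟨_, rfl⟩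
  have hx0 : 0 ≤ x := hx ▸ norm_nonneg _
  have hy0 : 0 ≤ y := hy ▸ norm_nonneg _
  have h1 : ‖S (symPart A)‖ ≤ c₁ * (ν₁ + ν₂ * x ^ (r - 2)) * x := by
    have := hS.growth _ 0 (isSymm3_symPart A) (fun i j => rfl)
    rwa [hS.zero, sub_zero, sub_zero, norm_zero, add_zero, ← hx] at this
  obtain ⟨m, hm⟩ : ∃ m, m = max 1 (max x y) := ⟨_, rfl⟩
  have hm1 : 1 ≤ m := hm ▸ le_max_left _ _
  have hxm : x ≤ m := hm ▸ (le_max_left _ _).trans (le_max_right _ _)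
  have hym : y ≤ m := hm ▸ (le_max_right _ _).trans (le_max_right _ _)
  have hm0 : 0 < m := by linarith
  have hmr : m ^ r ≤ 1 + x ^ r + y ^ r := by
    have hxr := Real.rpow_nonneg hx0 r
    have hyr := Real.rpow_nonneg hy0 r
    rcases max_choice 1 (max x y) with h | h
    · rw [hm, h, Real.one_rpow]
      linarith
    · rcases max_choice x y with h' | h' <;> rw [hm, h, h'] <;> linarith
  have hpow : m ^ r = m ^ (r - 2) * (m * m) := by
    rw [← pow_two, ← Real.rpow_natCast, ← Real.rpow_add hm0]
    norm_num
  have hmp : 1 ≤ m ^ (r - 2) := Real.one_le_rpow hm1 (by linarith)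
  have hxp : x ^ (r - 2) ≤ m ^ (r - 2) := Real.rpow_le_rpow hx0 hxm (by linarith)
  calc ‖⟪S (symPart A), B⟫‖ ≤ ‖S (symPart A)‖ * ‖B‖ := norm_inner_le_norm _ _
    _ ≤ (c₁ * (ν₁ + ν₂ * x ^ (r - 2)) * x) * y := by
        rw [← hy]
        exact mul_le_mul_of_nonneg_right h1 hy0
    _ ≤ (c₁ * (ν₁ * m ^ (r - 2) + ν₂ * m ^ (r - 2)) * m) * m := by
        gcongr
        exact le_mul_of_one_le_right hν₁.le hmp
    _ = c₁ * (ν₁ + ν₂) * m ^ r := by rw [hpow]; ring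
    _ ≤ c₁ * (ν₁ + ν₂) * (1 + x ^ r + y ^ r) := by gcongr
    _ = _ := by rw [hx, hy]

end Stress

/-- Optimisation of the scale `δ` in an interpolation inequality. -/
lemma exists_absorption_constant {a c δ₀ κ : ℝ} (ha : a < 1) (hc : 0 < c) (hδ₀ : 0 < δ₀)
    (hκ : 0 < κ) : ∃ k : ℝ, 0 ≤ k ∧ ∀ N X A B : ℝ, 1 ≤ N → 0 ≤ X →
      (∀ δ, 0 < δ → δ ≤ δ₀ → X ≤ c * δ ^ (-a) * (A + δ * B)) →
      X * X * N ≤ k * N ^ (1 - a)⁻¹ * A ^ 2 + κ * B ^ 2 := by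
  have ha1 : 0 < 2 - 2 * a := by linarith
  -- The scale at `N = 1`: admissible, and so small that the coefficient of `B ^ 2` is at most `κ`.
  obtain ⟨m, hm0, hmδ, hmκ⟩ : ∃ m : ℝ, 0 < m ∧ m ≤ δ₀ ∧ 2 * c ^ 2 * m ^ (2 - 2 * a) ≤ κ := by
    refine ⟨min δ₀ ((κ / (2 * c ^ 2)) ^ (2 - 2 * a)⁻¹), ?_, min_le_left _ _, ?_⟩
    · exact lt_min hδ₀ (by positivity)
    · have h1 := Real.rpow_le_rpow (z := 2 - 2 * a) (le_min hδ₀.le (by positivity))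
        (min_le_right δ₀ ((κ / (2 * c ^ 2)) ^ (2 - 2 * a)⁻¹)) ha1.le
      rw [← Real.rpow_mul (by positivity), inv_mul_cancel₀ ha1.ne', Real.rpow_one,
        le_div_iff₀ (by positivity)] at h1
      linarith
  refine ⟨2 * c ^ 2 * m ^ (-(2 * a)), by positivity, fun N X A B hN1 hX0 h => ?_⟩
  have hN0 : 0 < N := by linarith
  -- Chosen so that `δ ^ (2 - 2 * a) * N` does not depend on `N`. The other term then carries `N ^
  -- (1 + a / (1 - a)) = N ^ (1 - a)⁻¹`, and `N ≥ 1` keeps `δ ≤ m`.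
  obtain ⟨δ, hδ⟩ : ∃ δ, δ = m * N ^ (-(2 - 2 * a)⁻¹) := ⟨_, rfl⟩
  have hδpos : 0 < δ := by rw [hδ]; positivity
  have hδm : δ ≤ δ₀ := by
    refine le_trans ?_ hmδ
    rw [hδ]
    exact mul_le_of_le_one_right hm0.le (Real.rpow_le_one_of_one_le_of_nonpos hN1
      (neg_nonpos.2 (inv_nonneg.2 ha1.le)))
  have hvel := h δ hδpos hδm
  have hX2 : X * X ≤ 2 * c ^ 2 * δ ^ (-(2 * a)) * A ^ 2 + 2 * c ^ 2 * δ ^ (2 - 2 * a) * B ^ 2 := by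
    have e1 : δ ^ (-(2 * a)) = δ ^ (-a) * δ ^ (-a) := by
      rw [← Real.rpow_add hδpos]
      ring_nf
    have e2 : δ ^ (2 - 2 * a) = δ ^ (-a) * δ ^ (-a) * δ ^ 2 := by
      rw [← e1, ← Real.rpow_natCast, ← Real.rpow_add hδpos]
      norm_num
      ring_nf
    rw [e2, e1]
    calc X * X ≤ (c * δ ^ (-a) * (A + δ * B)) * (c * δ ^ (-a) * (A + δ * B)) :=
          mul_self_le_mul_self hX0 hvel
      _ = (c * δ ^ (-a)) ^ 2 * (A + δ * B) ^ 2 := by ring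
      _ ≤ (c * δ ^ (-a)) ^ 2 * (2 * (A ^ 2 + (δ * B) ^ 2)) := by
          gcongr
          exact add_sq_le
      _ = _ := by ring
  have hδ2 : δ ^ (2 - 2 * a) * N = m ^ (2 - 2 * a) := by
    rw [hδ, Real.mul_rpow hm0.le (by positivity), ← Real.rpow_mul hN0.le, neg_mul,
      inv_mul_cancel₀ ha1.ne', Real.rpow_neg_one, mul_assoc, inv_mul_cancel₀ hN0.ne', mul_one]
  have hδa : δ ^ (-(2 * a)) * N = m ^ (-(2 * a)) * N ^ (1 - a)⁻¹ := by
    rw [hδ, Real.mul_rpow hm0.le (by positivity), ← Real.rpow_mul hN0.le, mul_assoc]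
    congr 1
    nth_rewrite 2 [← Real.rpow_one N]
    rw [← Real.rpow_add hN0]
    congr 1
    have h3 : 1 - a ≠ 0 := by linarith
    have h4 : 2 - 2 * a = 2 * (1 - a) := by ring
    rw [h4]
    field_simp
    ring
  calc X * X * N ≤ (2 * c ^ 2 * δ ^ (-(2 * a)) * A ^ 2 +
        2 * c ^ 2 * δ ^ (2 - 2 * a) * B ^ 2) * N := by gcongr
    _ = 2 * c ^ 2 * (δ ^ (-(2 * a)) * N) * A ^ 2 +
        2 * c ^ 2 * (δ ^ (2 - 2 * a) * N) * B ^ 2 := by ring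
    _ = 2 * c ^ 2 * m ^ (-(2 * a)) * N ^ (1 - a)⁻¹ * A ^ 2 +
        2 * c ^ 2 * m ^ (2 - 2 * a) * B ^ 2 := by
        rw [hδa, hδ2]
        ring
    _ ≤ _ := by gcongr

/-! ### Lower bounds for the nonlinear form on differences -/

section Forms

variable {Ω : Set E3} {r : ℝ} [Fact (1 ≤ ENNReal.ofReal r)] {ν₁ ν₂ c₁ c₂ c₅ c₆ : ℝ} {S : T3 → T3}
  {s : E3 → E3}

lemma V.memLp_symPart (v : V Ω r) :
    MemLp (fun x => symPart (V.gradient v x)) (ENNReal.ofReal r) (vol Ω) :=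
  symPartL.comp_memLp' (V.memLp_gradient v)

lemma IsStressLaw.integrable (hS : IsStressLaw r ν₁ ν₂ c₁ c₂ S) (hΩ : IsBoundedLipschitzDomain Ω)
    (hr : 2 < r) (hν₁ : 0 < ν₁) (hν₂ : 0 < ν₂) (hc₁ : 0 < c₁) (u v : V Ω r) :
    Integrable (fun x => ⟪S (symPart (V.gradient u x)), V.gradient v x⟫) (vol Ω) := by
  have := hΩ.isFiniteMeasure_vol
  have hr0 : ENNReal.ofReal r ≠ 0 := by simpa using by linarith
  have h1 := (V.memLp_symPart u).integrable_norm_rpow hr0 ENNReal.ofReal_ne_top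
  have h2 := (V.memLp_gradient v).integrable_norm_rpow hr0 ENNReal.ofReal_ne_top
  rw [ENNReal.toReal_ofReal (by linarith)] at h1 h2
  refine ((((integrable_const (1 : ℝ)).add h1).add h2).const_mul (c₁ * (ν₁ + ν₂))).mono' ?_
    (Eventually.of_forall fun x => hS.norm_inner_le hr hν₁ hν₂ hc₁ _ _)
  exact ((hS.continuous hr).comp_aestronglyMeasurable (V.memLp_gradient u).1).inner
    (V.memLp_gradient v).1

lemma IsBoundaryLaw.integrable (hs : IsBoundaryLaw c₅ c₆ s) (hc₅ : 0 < c₅) (u v : V Ω r) :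
    Integrable (fun x => ⟪s (V.trace u x), V.trace v x⟫) (surf Ω) := by
  have hl : LipschitzWith c₅.toNNReal s := LipschitzWith.of_dist_le_mul fun x y => by
    rw [dist_eq_norm, dist_eq_norm, Real.coe_toNNReal _ hc₅.le]
    exact hs.lipschitz x y
  have h1 : MemLp (fun x => s (V.trace u x)) 2 (surf Ω) := hl.comp_memLp hs.zero (V.memLp_trace u)
  refine (L2.integrable_inner (𝕜 := ℝ) (h1.toLp _) v.1.2.2.2).congr ?_
  filter_upwards [h1.coeFn_toLp] with x hx
  rw [hx, V.trace, V.trace]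

lemma spatialForm_eq (hΩ : IsBoundedLipschitzDomain Ω) (hr : 2 < r)
    (hS : IsStressLaw r ν₁ ν₂ c₁ c₂ S) (hν₁ : 0 < ν₁) (hν₂ : 0 < ν₂) (hc₁ : 0 < c₁) (α : ℝ)
    (u φ : V Ω r) : spatialForm S s α u φ =
      (∫ x, ⟪S (symPart (V.gradient u x)), V.gradient φ x⟫ ∂(vol Ω)) - convForm u u φ +
        α * ∫ x, ⟪s (V.trace u x), V.trace φ x⟫ ∂(surf Ω) := by
  rw [spatialForm, convForm, ← integral_sub (hS.integrable hΩ hr hν₁ hν₂ hc₁ u φ)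
    (V.integrable_inner_outer hΩ hr u u φ)]
  simp only [inner_sub_left]

lemma V.sq_toReal_eLpNorm_symPart (hΩ : IsBoundedLipschitzDomain Ω) (hr : 2 < r) (w : V Ω r) :
    Integrable (fun x => ‖symPart (V.gradient w x)‖ ^ 2) (vol Ω) ∧
    (eLpNorm (fun x => symPart (V.gradient w x)) 2 (vol Ω)).toReal ^ 2 =
      ∫ x, ‖symPart (V.gradient w x)‖ ^ 2 ∂(vol Ω) := by
  have := hΩ.isFiniteMeasure_vol
  have h2r : (2 : ℝ≥0∞) ≤ ENNReal.ofReal r := by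
    rw [← ENNReal.ofReal_ofNat]
    exact ENNReal.ofReal_le_ofReal hr.le
  have hm : MemLp (fun x => symPart (V.gradient w x)) 2 (vol Ω) := (V.memLp_symPart w).mono_exponent h2r
  refine ⟨hm.integrable_norm_pow two_ne_zero, ?_⟩
  rw [hm.eLpNorm_eq_integral_rpow_norm two_ne_zero (by simp),
    ENNReal.toReal_ofReal (by positivity), ← Real.rpow_natCast, ← Real.rpow_mul (by positivity)]
  norm_num

/-- Monotonicity of the form up to the convective term. -/
lemma spatialForm_sub_ge (hΩ : IsBoundedLipschitzDomain Ω) (hr : 2 < r)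
    (hS : IsStressLaw r ν₁ ν₂ c₁ c₂ S) (hν₁ : 0 < ν₁) (hν₂ : 0 < ν₂) (hc₁ : 0 < c₁) (hc₂ : 0 < c₂)
    (hs : IsBoundaryLaw c₅ c₆ s) (hc₅ : 0 < c₅) (hc₆ : 0 < c₆) {α : ℝ} (hα : 0 ≤ α) (u v : V Ω r) :
    c₂ * ν₁ * (eLpNorm (fun x => symPart (V.gradient (u - v) x)) 2 (vol Ω)).toReal ^ 2 +
      convForm (u - v) (u - v) v ≤ spatialForm S s α u (u - v) - spatialForm S s α v (u - v) := by
  -- Skew-symmetry removes the transport of `u - v` by `u`, and then moves the derivative from `u -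
  -- v` to `v`. The gradient of `u` disappears, which is why the constants do not depend on `u`.
  have hconv : convForm v v (u - v) - convForm u u (u - v) = convForm (u - v) (u - v) v := by
    have e1 := convForm_skew hΩ hr u (u - v) (u - v)
    have e2 := convForm_skew hΩ hr (u - v) (u - v) v
    have e3 := convForm_sub_middle hΩ hr u u v (u - v)
    have e4 := convForm_sub_left hΩ hr u v v (u - v)
    linarith
  obtain ⟨hi, hsq⟩ := V.sq_toReal_eLpNorm_symPart hΩ hr (u - v)
  -- Since `S` takes symmetric values, the test gradient may be replaced by its symmetric part. Of
  -- the monotonicity only the quadratic term is kept.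
  have hstress : c₂ * ν₁ * ∫ x, ‖symPart (V.gradient (u - v) x)‖ ^ 2 ∂(vol Ω) ≤
      (∫ x, ⟪S (symPart (V.gradient u x)), V.gradient (u - v) x⟫ ∂(vol Ω)) -
        ∫ x, ⟪S (symPart (V.gradient v x)), V.gradient (u - v) x⟫ ∂(vol Ω) := by
    have i1 := hS.integrable hΩ hr hν₁ hν₂ hc₁ u (u - v)
    have i2 := hS.integrable hΩ hr hν₁ hν₂ hc₁ v (u - v)
    rw [← integral_sub i1 i2, ← integral_const_mul]
    refine integral_mono_ae (hi.const_mul _) (i1.sub i2) ?_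
    filter_upwards [V.gradient_sub u v] with x hx
    have hsu := isSymm3_symPart (V.gradient u x)
    have hsv := isSymm3_symPart (V.gradient v x)
    have hmono := hS.monotone _ _ hsu hsv
    have hw : symPart (V.gradient (u - v) x) =
        symPart (V.gradient u x) - symPart (V.gradient v x) := by
      rw [hx, Pi.sub_apply, symPart_sub]
    rw [← hw, inner_sub_left, inner_symPart_of_isSymm3 (hS.symm _ hsu),
      inner_symPart_of_isSymm3 (hS.symm _ hsv)] at hmono
    refine le_trans ?_ hmono
    have h0 : 0 ≤ ν₂ * (‖symPart (V.gradient u x)‖ + ‖symPart (V.gradient v x)‖) ^ (r - 2) := by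
      positivity
    gcongr
    linarith
  have hbdry : 0 ≤ (∫ x, ⟪s (V.trace u x), V.trace (u - v) x⟫ ∂(surf Ω)) -
      ∫ x, ⟪s (V.trace v x), V.trace (u - v) x⟫ ∂(surf Ω) := by
    rw [← integral_sub (hs.integrable hc₅ u (u - v)) (hs.integrable hc₅ v (u - v))]
    refine integral_nonneg_of_ae ?_
    filter_upwards [V.trace_sub u v] with x hx
    rw [← inner_sub_left, hx]
    exact (by positivity : 0 ≤ c₆ * ‖V.trace u x - V.trace v x‖ ^ 2).trans (hs.monotone _ _)
  rw [spatialForm_eq hΩ hr hS hν₁ hν₂ hc₁, spatialForm_eq hΩ hr hS hν₁ hν₂ hc₁, hsq]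
  have := mul_nonneg hα hbdry
  linarith

/-- The velocity of an element of `V_r` in `L^p`, `p = 2 * r / (r - 1)`, in terms of the norms of `H` and of the symmetric
gradient. -/
lemma V.exists_toReal_eLpNorm_vel_le (hΩ : IsBoundedLipschitzDomain Ω) (hr : 2 < r) (β : ℝ) :
    ∃ c : ℝ, 0 < c ∧ ∃ δ₀ : ℝ, 0 < δ₀ ∧ ∀ w : V Ω r, ∀ δ, 0 < δ → δ ≤ δ₀ →
      (eLpNorm (V.vel w) (ENNReal.ofReal (2 * r / (r - 1))) (vol Ω)).toReal ≤
        c * δ ^ (-(3 / (2 * r))) * (‖toH β w‖ +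
          δ * (eLpNorm (fun x => symPart (V.gradient w x)) 2 (vol Ω)).toReal) := by
  obtain ⟨C, hC, δ₀, hδ₀, hK⟩ := V.exists_eLpNorm_vel_le (r := r) hΩ hr
  refine ⟨C.toReal + 1, by positivity, δ₀, hδ₀, fun w δ hδ hδ' => ?_⟩
  have h2r : (2 : ℝ≥0∞) ≤ ENNReal.ofReal r := by
    rw [← ENNReal.ofReal_ofNat]
    exact ENNReal.ofReal_le_ofReal hr.le
  have := hΩ.isFiniteMeasure_vol
  have hB : eLpNorm (fun x => symPart (V.gradient w x)) 2 (vol Ω) ≠ ⊤ :=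
    ((V.memLp_symPart w).mono_exponent h2r).2.ne
  have h1 := (hK δ hδ hδ' w).trans
    (mul_le_mul_right (add_le_add_left (eLpNorm_vel_two_le_norm_toH hΩ β w) _) _)
  have hd0 : ENNReal.ofReal δ ^ (-(3 / (2 * r))) ≠ ⊤ :=
    ENNReal.rpow_ne_top_of_ne_zero (by simpa using hδ) ENNReal.ofReal_ne_top
  have h2 := ENNReal.toReal_mono (ENNReal.mul_ne_top (ENNReal.mul_ne_top hC hd0)
    (ENNReal.add_ne_top.2 ⟨enorm_ne_top, ENNReal.mul_ne_top ENNReal.ofReal_ne_top hB⟩)) h1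
  rw [ENNReal.toReal_mul, ENNReal.toReal_mul, ENNReal.toReal_add enorm_ne_top
    (ENNReal.mul_ne_top ENNReal.ofReal_ne_top hB), ENNReal.toReal_mul, toReal_enorm,
    ← ENNReal.toReal_rpow, ENNReal.toReal_ofReal hδ.le] at h2
  refine h2.trans ?_
  gcongr
  linarith

/-- The form is bounded below on differences by the norm of `H`. -/
lemma exists_spatialForm_sub_ge (hΩ : IsBoundedLipschitzDomain Ω) (hr : 2 < r)
    (hS : IsStressLaw r ν₁ ν₂ c₁ c₂ S) (hν₁ : 0 < ν₁) (hν₂ : 0 < ν₂) (hc₁ : 0 < c₁) (hc₂ : 0 < c₂)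
    (hs : IsBoundaryLaw c₅ c₆ s) (hc₅ : 0 < c₅) (hc₆ : 0 < c₆) {α : ℝ} (hα : 0 ≤ α) (β : ℝ) :
    ∃ k : ℝ, 0 ≤ k ∧ ∀ u v : V Ω r, spatialForm S s α v (u - v) - spatialForm S s α u (u - v) ≤
      k * (1 + ‖v‖) ^ (2 * r / (2 * r - 3)) * ‖toH β (u - v)‖ ^ 2 := by
  obtain ⟨c, hc, δ₀, hδ₀, hK⟩ := V.exists_toReal_eLpNorm_vel_le (r := r) hΩ hr β
  have ha1 : 3 / (2 * r) < 1 := by rw [div_lt_one (by linarith)]; linarith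
  obtain ⟨k, hk, h⟩ := exists_absorption_constant ha1 hc hδ₀ (mul_pos hc₂ hν₁)
  -- Here the time integrability required of `v` appears. The absorption uses `κ = c₂ * ν₁`, the
  -- entire viscous term, and `1 + ‖v‖` in place of `‖v‖` to have `N ≥ 1`.
  have hexp : (1 - 3 / (2 * r))⁻¹ = 2 * r / (2 * r - 3) := by
    rw [one_sub_div (by linarith), inv_div]
  rw [hexp] at h
  refine ⟨k, hk, fun u v => ?_⟩
  have hge := spatialForm_sub_ge hΩ hr hS hν₁ hν₂ hc₁ hc₂ hs hc₅ hc₆ hα u v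
  have hcv := abs_convForm_le hΩ hr (u - v) (u - v) v
  have h1 := h (1 + ‖v‖) _ _ _ (by linarith [norm_nonneg v]) ENNReal.toReal_nonneg
    (hK (u - v))
  have h2 : ∀ X : ℝ, X * X * ‖v‖ ≤ X * X * (1 + ‖v‖) := fun X =>
    mul_le_mul_of_nonneg_left (by linarith) (mul_self_nonneg X)
  have hneg := neg_abs_le (convForm (u - v) (u - v) v)
  linarith [h2 (eLpNorm (V.vel (u - v)) (ENNReal.ofReal (2 * r / (r - 1))) (vol Ω)).toReal]

end Forms

/-! ### Stability of weak solutions -/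

/-- Test functions with support in `Ioo 0 T` give information at interior times only; continuity
adds the end points. The condition `1 ≤ K` covers the case of equal times. -/
lemma le_mul_of_le_mul_Ioo {g : ℝ → ℝ} {T K : ℝ} (hg : ContinuousOn g (Icc 0 T))
    (hg0 : ∀ t ∈ Icc 0 T, 0 ≤ g t) (hK : 1 ≤ K)
    (h : ∀ a t, 0 < a → a ≤ t → t < T → g t ≤ K * g a) {a t : ℝ} (ha : 0 ≤ a) (hat : a ≤ t)
    (ht : t ≤ T) : g t ≤ K * g a := by
  have hright : ∀ a, 0 < a → ∀ t, a ≤ t → t ≤ T → g t ≤ K * g a := fun a ha t hat ht => by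
    rcases ht.lt_or_eq with ht' | rfl
    · exact h a t ha hat ht'
    rcases hat.lt_or_eq with hat' | rfl
    · have hne : (𝓝[Ioo a t] t).NeBot := right_nhdsWithin_Ioo_neBot hat'
      have hlim : Tendsto g (𝓝[Ioo a t] t) (𝓝 (g t)) :=
        (hg t ⟨by linarith, le_rfl⟩).mono_left
          (nhdsWithin_mono _ fun x hx => ⟨by linarith [hx.1], hx.2.le⟩)
      refine le_of_tendsto hlim ?_
      filter_upwards [self_mem_nhdsWithin] with x hx
      exact h a x ha hx.1.le hx.2
    · exact le_mul_of_one_le_left (hg0 a ⟨ha.le, le_rfl⟩) hK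
  rcases ha.lt_or_eq with ha' | rfl
  · exact hright a ha' t hat ht
  rcases hat.lt_or_eq with hat' | rfl
  · have hne : (𝓝[Ioo 0 t] (0 : ℝ)).NeBot := left_nhdsWithin_Ioo_neBot hat'
    have hlim : Tendsto g (𝓝[Ioo 0 t] 0) (𝓝 (g 0)) :=
      (hg 0 ⟨le_rfl, by linarith⟩).mono_left
        (nhdsWithin_mono _ fun x hx => ⟨hx.1.le, by linarith [hx.2]⟩)
    refine ge_of_tendsto (hlim.const_mul K) ?_
    filter_upwards [self_mem_nhdsWithin] with x hx
    exact hright x hx.1 t hx.2.le ht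
  · exact le_mul_of_one_le_left (hg0 0 ⟨le_rfl, ht⟩) hK

/-! ### From a differential inequality to a bound on the energy -/

section Energy

variable {V H : Type*} [NormedAddCommGroup V] [NormedSpace ℝ V] [NormedAddCommGroup H]
  [InnerProductSpace ℝ H] {p q : ℝ≥0∞}

/-- Testing with a fixed `φ` reduces the vector-valued weak derivative to a scalar one; the result
is the form of the derivative used by the energy identity. -/
lemma inner_sub_eq_integral_of_weakDeriv (hq : 1 ≤ q) {T : ℝ} (j : V →L[ℝ] H) {u : ℝ → V}
    {U : ℝ → H} {ξ : ℝ → StrongDual ℝ V} (hξ : MemLp ξ q (volume.restrict (Ioo 0 T)))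
    (hU : ContinuousOn U (Icc 0 T)) (hUu : ∀ᵐ t ∂(volume.restrict (Ioo 0 T)), U t = j (u t))
    (h : ∀ (φ : V) (ψ : ℝ → ℝ), ContDiff ℝ ∞ ψ → HasCompactSupport ψ → tsupport ψ ⊆ Ioo 0 T →
      ∫ t in Ioo 0 T, deriv ψ t * ⟪j (u t), j φ⟫ = -∫ t in Ioo 0 T, ψ t * ξ t φ) (φ : V) :
    IntegrableOn (fun t => ξ t φ) (Ioo 0 T) ∧ ∀ s t : ℝ, 0 < s → s ≤ t → t < T →
      ⟪U t - U s, j φ⟫ = ∫ τ in s..t, ξ τ φ := by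
  have hi : IntegrableOn (fun t => ξ t φ) (Ioo 0 T) := by
    have h1 : Integrable ξ (volume.restrict (Ioo 0 T)) := hξ.integrable hq
    exact (ContinuousLinearMap.apply ℝ ℝ φ).integrable_comp h1
  refine ⟨hi, fun s t hs hst ht => ?_⟩
  rw [inner_sub_left]
  refine sub_eq_integral_of_weakDeriv (g := fun t => ⟪U t, j φ⟫) (hU.inner continuousOn_const) hi
    (fun ψ h1 h2 h3 => ?_) hs hst ht
  rw [← h φ ψ h1 h2 h3]
  refine integral_congr_ae ?_
  filter_upwards [hUu] with τ hτ
  rw [hτ]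

/-- A differential inequality for the energy gives a bound on the energy. -/
theorem norm_sq_le_exp_mul_norm_sq [p.HolderConjugate q] [Fact (1 ≤ p)] [Fact (1 ≤ q)]
    (hp : p ≠ ⊤) (hq : q ≠ ⊤) {T : ℝ} (j : V →L[ℝ] H) {ξ : ℝ → StrongDual ℝ V} {w : ℝ → V}
    {W : ℝ → H} (hξ : MemLp ξ q (volume.restrict (Ioo 0 T)))
    (hw : MemLp w p (volume.restrict (Ioo 0 T))) (hW : ContinuousOn W (Icc 0 T))
    (hWw : ∀ᵐ t ∂(volume.restrict (Ioo 0 T)), W t = j (w t))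
    (hder : ∀ (φ : V) (s t : ℝ), 0 < s → s ≤ t → t < T →
      ⟪W t - W s, j φ⟫ = ∫ τ in s..t, ξ τ φ)
    {k : ℝ → ℝ} (hk : IntegrableOn k (Ioo 0 T)) (hk0 : ∀ t, 0 ≤ k t)
    (hle : ∀ᵐ t ∂(volume.restrict (Ioo 0 T)), ξ t (w t) ≤ k t * ‖W t‖ ^ 2)
    {a t : ℝ} (ha : 0 ≤ a) (hat : a ≤ t) (ht : t ≤ T) :
    ‖W t‖ ^ 2 ≤ Real.exp (4 * ∫ τ in Ioo 0 T, k τ) * ‖W a‖ ^ 2 := by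
  have hgc : ContinuousOn (fun t => ‖W t‖ ^ 2) (Icc 0 T) := hW.norm.pow 2
  have hI0 : 0 ≤ ∫ τ in Ioo 0 T, k τ := integral_nonneg hk0
  refine le_mul_of_le_mul_Ioo (g := fun t => ‖W t‖ ^ 2) hgc (fun _ _ => by positivity)
    (Real.one_le_exp (by positivity)) (fun a t ha hat ht => ?_) ha hat ht
  have hsub : ∀ {s b : ℝ}, a ≤ s → b ≤ t → Ioc s b ⊆ Ioo 0 T := fun hs hb x hx =>
    ⟨by linarith [hx.1], by linarith [hx.2]⟩
  -- One factor `2` comes from the energy identity and another from the Gronwall inequality, hence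
  -- the `4` in the exponent.
  have hkI : IntervalIntegrable (fun τ => 2 * k τ) volume a t :=
    ((intervalIntegrable_iff_integrableOn_Ioc_of_le hat).2
      (hk.mono_set (hsub le_rfl le_rfl))).const_mul 2
  have hG := le_exp_integral_mul_of_sub_le (g := fun t => ‖W t‖ ^ 2) (k := fun τ => 2 * k τ)
    (hgc.mono (Icc_subset_Icc ha.le ht.le)) (fun _ _ => by positivity) hkI
    (fun t => by linarith [hk0 t]) (fun s b has hsb hbt => ?_) t ⟨hat, le_rfl⟩
  · refine hG.trans (mul_le_mul_of_nonneg_right (Real.exp_le_exp.2 ?_) (by positivity))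
    rw [intervalIntegral.integral_const_mul, intervalIntegral.integral_of_le hat]
    have := setIntegral_mono_set hk (Eventually.of_forall hk0)
      (hsub (le_refl a) (le_refl t)).eventuallyLE
    linarith
  · have hen := norm_sq_sub_norm_sq_eq_integral hp hq j hξ hw hW hWw hder
      (by linarith : 0 < s) hsb (by linarith : b < T)
    have hsb' := hsub has hbt
    rw [hen, intervalIntegral.integral_of_le hsb, intervalIntegral.integral_of_le hsb,
      ← integral_const_mul]
    have i1 : IntegrableOn (fun τ => ξ τ (w τ)) (Ioc s b) :=
      IntegrableOn.mono_set (integrable_dual_apply hξ hw) hsb'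
    have hIcc : Icc s b ⊆ Icc 0 T := Icc_subset_Icc (by linarith) (by linarith)
    have i2 : IntegrableOn (fun τ => 2 * k τ * ‖W τ‖ ^ 2) (Ioc s b) := by
      have h1 : IntegrableOn (fun τ => 2 * k τ) (Ioc s b) := (hk.mono_set hsb').const_mul 2
      obtain ⟨B, hB⟩ := isCompact_Icc.exists_bound_of_continuousOn (hgc.mono hIcc)
      refine Integrable.mul_bdd (c := B) h1 ?_ ?_
      · exact ((hgc.mono hIcc).mono Ioc_subset_Icc_self).aestronglyMeasurable measurableSet_Ioc
      · filter_upwards [ae_restrict_mem measurableSet_Ioc] with x hx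
        exact hB x (Ioc_subset_Icc_self hx)
    refine integral_mono_ae (i1.const_mul 2) i2 ?_
    filter_upwards [ae_restrict_of_ae_restrict_of_subset hsb' hle] with τ hτ
    linarith

/-- The energy bound for the difference of two functions with weak time derivatives. -/
theorem norm_sub_sq_le_exp_mul_norm_sub_sq [p.HolderConjugate q] [Fact (1 ≤ p)] [hq1 : Fact (1 ≤ q)]
    (hp : p ≠ ⊤) (hq : q ≠ ⊤) {T : ℝ} (j : V →L[ℝ] H) {ξ η : ℝ → StrongDual ℝ V} {u v : ℝ → V}
    {U W : ℝ → H} (hξ : MemLp ξ q (volume.restrict (Ioo 0 T)))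
    (hη : MemLp η q (volume.restrict (Ioo 0 T))) (hu : MemLp u p (volume.restrict (Ioo 0 T)))
    (hv : MemLp v p (volume.restrict (Ioo 0 T))) (hU : ContinuousOn U (Icc 0 T))
    (hW : ContinuousOn W (Icc 0 T))
    (hUu : ∀ᵐ t ∂(volume.restrict (Ioo 0 T)), U t = j (u t))
    (hWv : ∀ᵐ t ∂(volume.restrict (Ioo 0 T)), W t = j (v t))
    (hξd : ∀ (φ : V) (ψ : ℝ → ℝ), ContDiff ℝ ∞ ψ → HasCompactSupport ψ → tsupport ψ ⊆ Ioo 0 T →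
      ∫ t in Ioo 0 T, deriv ψ t * ⟪j (u t), j φ⟫ = -∫ t in Ioo 0 T, ψ t * ξ t φ)
    (hηd : ∀ (φ : V) (ψ : ℝ → ℝ), ContDiff ℝ ∞ ψ → HasCompactSupport ψ → tsupport ψ ⊆ Ioo 0 T →
      ∫ t in Ioo 0 T, deriv ψ t * ⟪j (v t), j φ⟫ = -∫ t in Ioo 0 T, ψ t * η t φ)
    {k : ℝ → ℝ} (hk : IntegrableOn k (Ioo 0 T)) (hk0 : ∀ t, 0 ≤ k t)
    (hle : ∀ᵐ t ∂(volume.restrict (Ioo 0 T)),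
      ξ t (u t - v t) - η t (u t - v t) ≤ k t * ‖U t - W t‖ ^ 2)
    {a t : ℝ} (ha : 0 ≤ a) (hat : a ≤ t) (ht : t ≤ T) :
    ‖U t - W t‖ ^ 2 ≤ Real.exp (4 * ∫ τ in Ioo 0 T, k τ) * ‖U a - W a‖ ^ 2 := by
  have d1 := inner_sub_eq_integral_of_weakDeriv hq1.out j hξ hU hUu hξd
  have d2 := inner_sub_eq_integral_of_weakDeriv hq1.out j hη hW hWv hηd
  refine norm_sq_le_exp_mul_norm_sq hp hq j (ξ := fun t => ξ t - η t) (w := fun t => u t - v t)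
    (W := fun t => U t - W t) (hξ.sub hη) (hu.sub hv) (hU.sub hW) ?_ ?_ hk hk0 hle ha hat ht
  · filter_upwards [hUu, hWv] with τ h1 h2
    rw [h1, h2, map_sub]
  · intro φ s t hs hst ht
    have hsub : Ioc s t ⊆ Ioo 0 T := fun x hx => ⟨by linarith [hx.1], by linarith [hx.2]⟩
    have j1 : IntervalIntegrable (fun τ => ξ τ φ) volume s t :=
      (intervalIntegrable_iff_integrableOn_Ioc_of_le hst).2 ((d1 φ).1.mono_set hsub)
    have j2 : IntervalIntegrable (fun τ => η τ φ) volume s t :=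
      (intervalIntegrable_iff_integrableOn_Ioc_of_le hst).2 ((d2 φ).1.mono_set hsub)
    have e : ∫ τ in s..t, (ξ τ - η τ) φ = (∫ τ in s..t, ξ τ φ) - ∫ τ in s..t, η τ φ :=
      intervalIntegral.integral_sub j1 j2
    rw [e, ← (d1 φ).2 s t hs hst ht, ← (d2 φ).2 s t hs hst ht, ← inner_sub_left]
    congr 1
    abel

end Energy

/-! ### Lipschitz dependence of weak solutions -/

section Main

variable {Ω : Set E3} {r : ℝ} [Fact (1 ≤ ENNReal.ofReal r)] {ν₁ ν₂ c₁ c₂ c₅ c₆ : ℝ} {S : T3 → T3}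
  {s : E3 → E3}

/-- Convexity gives `(1 + x) ^ q ≤ 2 ^ (q - 1) * (1 + x ^ q)`. The bound involves only `q`, `T` and
`M`, so the Gronwall constant can be fixed before `v`; `max M 0` accounts for `ENNReal.ofReal M`. -/
lemma integral_one_add_norm_rpow_le {F : Type*} [NormedAddCommGroup F] {q T M : ℝ} (hq : 1 ≤ q)
    (hT : 0 < T) {v : ℝ → F} (hv : AEStronglyMeasurable v (volume.restrict (Ioo 0 T)))
    (hM : eLpNorm v (ENNReal.ofReal q) (volume.restrict (Ioo 0 T)) ≤ ENNReal.ofReal M) :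
    IntegrableOn (fun t => (1 + ‖v t‖) ^ q) (Ioo 0 T) ∧
      ∫ t in Ioo 0 T, (1 + ‖v t‖) ^ q ≤ 2 ^ (q - 1) * (T + (max M 0) ^ q) := by
  have hq0 : 0 < q := by linarith
  have hq' : ENNReal.ofReal q ≠ 0 := by simpa using hq0
  have hmem : MemLp v (ENNReal.ofReal q) (volume.restrict (Ioo 0 T)) :=
    ⟨hv, hM.trans_lt ENNReal.ofReal_lt_top⟩
  have hi := hmem.integrable_norm_rpow hq' ENNReal.ofReal_ne_top
  rw [ENNReal.toReal_ofReal hq0.le] at hi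
  have hint : ∫ t in Ioo 0 T, ‖v t‖ ^ q ≤ (max M 0) ^ q := by
    rw [hmem.eLpNorm_eq_integral_rpow_norm hq' ENNReal.ofReal_ne_top,
      ENNReal.toReal_ofReal hq0.le] at hM
    have hI0 : 0 ≤ ∫ t in Ioo 0 T, ‖v t‖ ^ q := integral_nonneg fun _ => by positivity
    have h1 := hM.trans (ENNReal.ofReal_le_ofReal (le_max_left M 0))
    rw [ENNReal.ofReal_le_ofReal_iff (le_max_right _ _)] at h1
    have h2 := Real.rpow_le_rpow (by positivity) h1 hq0.le
    rwa [← Real.rpow_mul hI0, inv_mul_cancel₀ hq0.ne', Real.rpow_one] at h2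
  have hpt : ∀ t, (1 + ‖v t‖) ^ q ≤ 2 ^ (q - 1) * (1 + ‖v t‖ ^ q) := fun t => by
    have := NNReal.rpow_add_le_mul_rpow_add_rpow 1 ‖v t‖₊ hq
    rw [NNReal.one_rpow] at this
    exact_mod_cast this
  have hbd : IntegrableOn (fun t => 2 ^ (q - 1) * (1 + ‖v t‖ ^ q)) (Ioo 0 T) :=
    ((integrable_const (1 : ℝ)).add hi).const_mul _
  have hI : IntegrableOn (fun t => (1 + ‖v t‖) ^ q) (Ioo 0 T) := by
    refine Integrable.mono' hbd ?_ (Eventually.of_forall fun t => ?_)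
    · have hc : Continuous fun x : ℝ => (1 + |x|) ^ q :=
        (continuous_const.add continuous_abs).rpow_const fun _ => Or.inr hq0.le
      have := hc.comp_aestronglyMeasurable hv.norm
      simpa only [abs_norm] using this
    · rw [Real.norm_of_nonneg (by positivity)]
      exact hpt t
  refine ⟨hI, (integral_mono hI hbd hpt).trans ?_⟩
  rw [integral_const_mul, integral_add (integrable_const _) hi]
  have h1 : ∫ _ in Ioo 0 T, (1 : ℝ) = T := by simp [hT.le]
  rw [h1]
  gcongr

/-- Lipschitz dependence of weak solutions on their values at earlier times. -/
theorem exists_norm_sub_sq_le (hΩ : IsBoundedLipschitzDomain Ω) (hr : 2 < r)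
    (hS : IsStressLaw r ν₁ ν₂ c₁ c₂ S) (hν₁ : 0 < ν₁) (hν₂ : 0 < ν₂) (hc₁ : 0 < c₁) (hc₂ : 0 < c₂)
    (hs : IsBoundaryLaw c₅ c₆ s) (hc₅ : 0 < c₅) (hc₆ : 0 < c₆) {α : ℝ} (hα : 0 ≤ α) (β : ℝ) {T : ℝ}
    (hT : 0 < T) (M : ℝ) : ∃ K : ℝ, ∀ (f : ℝ → StrongDual ℝ (V Ω r)) (u v : ℝ → V Ω r)
      (U W : ℝ → H Ω β), IsWeakSolution S s α β T f u → IsWeakSolution S s α β T f v →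
        IsContRep T β u U → IsContRep T β v W →
        eLpNorm v (ENNReal.ofReal (2 * r / (2 * r - 3))) (volume.restrict (Ioo 0 T)) ≤
          ENNReal.ofReal M →
        ∀ a t : ℝ, 0 ≤ a → a ≤ t → t ≤ T → ‖U t - W t‖ ^ 2 ≤ K * ‖U a - W a‖ ^ 2 := by
  obtain ⟨k, hk, hform⟩ := exists_spatialForm_sub_ge hΩ hr hS hν₁ hν₂ hc₁ hc₂ hs hc₅ hc₆ hα β
  obtain ⟨q, hqdef⟩ : ∃ q, q = 2 * r / (2 * r - 3) := ⟨_, rfl⟩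
  have hq1 : 1 ≤ q := by
    rw [hqdef, one_le_div (by linarith)]
    linarith
  rw [← hqdef] at hform ⊢
  refine ⟨Real.exp (4 * (k * (2 ^ (q - 1) * (T + (max M 0) ^ q)))), ?_⟩
  intro f u v U W hu hv hU hW hM a t ha hat ht
  obtain ⟨ξ, hξ, hξd, hξe⟩ := hu.equation
  obtain ⟨η, hη, hηd, hηe⟩ := hv.equation
  obtain ⟨hki, hkle⟩ := integral_one_add_norm_rpow_le hq1 hT hv.memLp_V.1 hM
  have hr1 : 0 < r - 1 := by linarith
  have hconj : (ENNReal.ofReal r).HolderConjugate (ENNReal.ofReal (r / (r - 1))) :=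
    Real.HolderConjugate.ennrealOfReal ⟨by field_simp; ring, by positivity, by positivity⟩
  have hr'1 : 1 ≤ ENNReal.ofReal (r / (r - 1)) := by
    rw [ENNReal.one_le_ofReal, one_le_div hr1]
    linarith
  have hfact : Fact (1 ≤ ENNReal.ofReal (r / (r - 1))) := ⟨hr'1⟩
  -- Both equations are tested with `u τ - v τ`; the force cancels.
  have hle : ∀ᵐ τ ∂(volume.restrict (Ioo 0 T)), ξ τ (u τ - v τ) - η τ (u τ - v τ) ≤
      k * (1 + ‖v τ‖) ^ q * ‖U τ - W τ‖ ^ 2 := by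
    filter_upwards [hξe, hηe, hU.2, hW.2] with τ h1 h2 h3 h4
    have e1 := h1 (u τ - v τ)
    have e2 := h2 (u τ - v τ)
    have e4 := hform (u τ) (v τ)
    rw [map_sub, ← h3, ← h4] at e4
    linarith
  have hmain : ‖U t - W t‖ ^ 2 ≤ Real.exp (4 * ∫ τ in Ioo 0 T, k * (1 + ‖v τ‖) ^ q) *
      ‖U a - W a‖ ^ 2 := by
    refine norm_sub_sq_le_exp_mul_norm_sub_sq (p := ENNReal.ofReal r)
      (q := ENNReal.ofReal (r / (r - 1))) (u := u) (v := v) (ξ := ξ) (η := η)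
      ENNReal.ofReal_ne_top ENNReal.ofReal_ne_top (toH β) ?_ ?_ ?_ ?_ ?_ ?_ ?_ ?_ ?_ ?_ ?_ ?_ ?_
      ha hat ht
    · exact hξ
    · exact hη
    · exact hu.memLp_V
    · exact hv.memLp_V
    · exact hU.1
    · exact hW.1
    · exact hU.2
    · exact hW.2
    · exact hξd
    · exact hηd
    · exact hki.const_mul k
    · exact fun t => by positivity
    · exact hle
  refine hmain.trans (mul_le_mul_of_nonneg_right (Real.exp_le_exp.2 ?_) (by positivity))
  rw [integral_const_mul]
  gcongr

end Main

end DynFluid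

end

theorem mainTheorem3
    (Ω : Set E3) (hΩ : IsBoundedLipschitzDomain Ω)
    (r : ℝ) [Fact (1 ≤ ENNReal.ofReal r)] (hr : 11 / 5 ≤ r)
    (α β : ℝ) (hα : 0 ≤ α) (hβ : 0 ≤ β)
    (ν₁ ν₂ c₁ c₂ c₅ c₆ : ℝ) (hν₁ : 0 < ν₁) (hν₂ : 0 < ν₂)
    (hc₁ : 0 < c₁) (hc₂ : 0 < c₂) (hc₅ : 0 < c₅) (hc₆ : 0 < c₆)
    (S : T3 → T3) (hS : IsStressLaw r ν₁ ν₂ c₁ c₂ S)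
    (s : E3 → E3) (hs : IsBoundaryLaw c₅ c₆ s)
    (T : ℝ) (hT : 0 < T) :
    -- uniqueness
    (∀ f : ℝ → StrongDual ℝ (V Ω r),
      MemLp f (ENNReal.ofReal (r / (r - 1))) (volume.restrict (Set.Ioo 0 T)) →
      ∀ (u v : ℝ → V Ω r) (U W : ℝ → H Ω β),
        IsWeakSolution S s α β T f u → IsWeakSolution S s α β T f v →
        IsContRep T β u U → IsContRep T β v W → U 0 = W 0 →
        MemLp v (ENNReal.ofReal (2 * r / (2 * r - 3))) (volume.restrict (Set.Ioo 0 T)) →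
        (∀ᵐ t ∂(volume.restrict (Set.Ioo 0 T)), u t = v t) ∧ Set.EqOn U W (Set.Icc 0 T)) ∧
    -- Lipschitz dependence; the constant depends on `v` only through a bound on its norm
    (∀ M : ℝ, ∃ K : ℝ, ∀ f : ℝ → StrongDual ℝ (V Ω r),
      MemLp f (ENNReal.ofReal (r / (r - 1))) (volume.restrict (Set.Ioo 0 T)) →
      ∀ (u v : ℝ → V Ω r) (U W : ℝ → H Ω β),
        IsWeakSolution S s α β T f u → IsWeakSolution S s α β T f v →
        IsContRep T β u U → IsContRep T β v W →
        eLpNorm v (ENNReal.ofReal (2 * r / (2 * r - 3))) (volume.restrict (Set.Ioo 0 T)) ≤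
          ENNReal.ofReal M →
        ∀ a t : ℝ, 0 ≤ a → a ≤ t → t ≤ T → ‖U t - W t‖ ^ 2 ≤ K * ‖U a - W a‖ ^ 2) := by
  have hr2 : 2 < r := by linarith
  have hstab := fun M => exists_norm_sub_sq_le hΩ hr2 hS hν₁ hν₂ hc₁ hc₂ hs hc₅ hc₆ hα β hT M
  refine ⟨fun f _ u v U W hu hv hU hW h0 hmem => ?_, fun M => ?_⟩
  -- For uniqueness the bound `M` is the norm of `v` itself.
  · obtain ⟨K, hK⟩ := hstab
      (eLpNorm v (ENNReal.ofReal (2 * r / (2 * r - 3))) (volume.restrict (Set.Ioo 0 T))).toReal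
    have hUW : Set.EqOn U W (Set.Icc 0 T) := fun t ht => by
      have h1 := hK f u v U W hu hv hU hW (ENNReal.ofReal_toReal hmem.2.ne).ge 0 t le_rfl ht.1 ht.2
      rw [h0, sub_self, norm_zero, zero_pow two_ne_zero, mul_zero] at h1
      exact sub_eq_zero.1 (norm_eq_zero.1
        (pow_eq_zero_iff two_ne_zero |>.1 (le_antisymm h1 (sq_nonneg _))))
    refine ⟨?_, hUW⟩
    filter_upwards [hU.2, hW.2, ae_restrict_mem measurableSet_Ioo] with t h1 h2 ht
    -- The stability estimate gives equality only in `H`; injectivity lifts it to gradients and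
    -- traces.
    refine toH_injective hΩ β ?_
    rw [← h1, ← h2, hUW (Set.Ioo_subset_Icc_self ht)]
  · obtain ⟨K, hK⟩ := hstab M
    exact ⟨K, fun f _ => hK f⟩
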